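/- For a continuous $V:\mathbb R\to\mathbb C$ let $H_V=\frac{d^4}{dx^4}+V$ be the maximal operator in $L^2(\mathbb R)$, i.e. $\mathrm{Dom}(H_V)=\{u\in L^2(\mathbb R): u''''+Vu\in L^2(\mathbb R)\}$, where $u''''+Vu$ is understood in the sense of distributions, and let $\|\cdot\|$ be the norm of $L^2(\mathbb R)$. **Assumption.** Let $N\ge 0$ be an integer and let $V\in W^{N+3,\infty}_{\mathrm{loc}}(\mathbb R)$ be complex-valued (we take its continuous representative), such that 1. $\limsup_{x\to-\infty}\operatorname{Im}V(x)<0<\liminf_{x\to+\infty}\operatorname{Im}V(x)$. 2. There are continuous functions $\tau_-:(-\infty,0]\to(0,\infty)$ and $\tau_+:[0,\infty)\to(0,\infty)$ such that $|V^{(n)}(x)|=O(\tau_\pm(x)^n|V(x)|)$ as $x\to\pm\infty$, for all $1\le n\le N+3$ (for almost every $x$). 3. At each of the two ends $+\infty$ and $-\infty$ separately, one of the following holds. a) If $V$ is unbounded at $\pm\infty$: $\tau_\pm$ is differentiable for large $|x|$, and there is $\nu_\pm\ge-1$ with $|x|^{\nu_\pm}=O(\tau_\pm(x))$ and $\tau_\pm'(x)=O(|x|^{\nu_\pm}\tau_\pm(x))$;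 moreover $|\operatorname{Im}V'(x)|=O(\tau_\pm(x)|\operatorname{Im}V(x)|)$, and for some $\varepsilon_1>0$ (which may depend on the end) $\tau_\pm(x)^4\big(\tau_\pm(x)^{12+4\varepsilon_1}+|\operatorname{Re}V(x)|^{3+\varepsilon_1}\big)=O(|\operatorname{Im}V(x)|^4)$, all as $x\to\pm\infty$. b) If $V$ is bounded at $\pm\infty$: for some $\varepsilon_2\in(0,\frac13)$ (which may depend on the end) $\tau_\pm(x)=O(|x|^{\frac13-\varepsilon_2})$ as $x\to\pm\infty$. **Theorem.** Let the assumption hold, and let $\beta_\pm\ge0$ satisfy $\limsup_{x\to-\infty}\operatorname{Im}V(x)<-\beta_-$ and $\beta_+<\liminf_{x\to+\infty}\operatorname{Im}V(x)$. Then there are constants $\alpha_0,C>0$ and a family of compactly supported functions $\Psi_{\lambda,N}\in\mathrm{Dom}(H_V)\setminus\{0\}$ such that for all $\lambda=\alpha+i\beta$ with $\alpha\ge\alpha_0$ and $\beta\in[-\beta_-,\beta_+]$ $$\frac{\|(H_V-\lambda)\Psi_{\lambda,N}\|}{\|\Psi_{\lambda,N}\|}\le C\Big(\alpha^{-\frac{N+1}4}+\sigma_-^{(N)}(\alpha)+\sigma_+^{(N)}(\alpha)\Big),$$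 where $$\sigma_-^{(N)}(\alpha)=\alpha^{-\frac{N+1}4}\sup_{x\in[-\delta_\alpha^-,0]}\tau_-(x)^{N+1}|V(x)|,\qquad \sigma_+^{(N)}(\alpha)=\alpha^{-\frac{N+1}4}\sup_{x\in[0,\delta_\alpha^+]}\tau_+(x)^{N+1}|V(x)|.$$ Here, if $V$ is unbounded at $\pm\infty$, $\delta_\alpha^\pm$ is the smallest positive solution $x$ of $\frac{|\operatorname{Im}V(\pm x)|}{\tau_\pm(\pm x)}=\alpha^{\frac{3+\varepsilon_1}{4+\varepsilon_1}}$ (which exists for $\alpha\ge\alpha_0$), and if $V$ is bounded at $\pm\infty$, $\delta_\alpha^\pm=\alpha^{\frac{3}{4-3\varepsilon_2}}$. In particular, if $V$ and $\tau_\pm$ are bounded at $\pm\infty$, then $\sigma_\pm^{(N)}(\alpha)=O(\alpha^{-\frac{N+1}4})$ as $\alpha\to+\infty$ (for each sign separately); hence if this is the case at both ends, the right-hand side above is $O(\alpha^{-\frac{N+1}4})$. -/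

import Mathlib

open MeasureTheory Filter Set
open scoped ContDiff ENNReal

namespace Biharmonic

/-- `φ` is a test function on the real line: smooth with compact support. -/
def IsTest (φ : ℝ → ℝ) : Prop := ContDiff ℝ ∞ φ ∧ HasCompactSupport φ

/-- `g` is the `n`-th weak derivative of `u` on the real line (for locally integrable `u`, `g`). -/
def IsWeakDeriv (n : ℕ) (u g : ℝ → ℂ) : Prop :=
  ∀ φ : ℝ → ℝ, IsTest φ →
    ∫ x, iteratedDeriv n φ x • u x = (-1 : ℂ) ^ n * ∫ x, φ x • g x

/-- `g` belongs to `L^∞_loc(ℝ)`. -/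
def LocEssBounded (g : ℝ → ℂ) : Prop :=
  ∀ K : Set ℝ, IsCompact K → MemLp g ∞ (volume.restrict K)

/-- `V` belongs to `W^{k,∞}_loc(ℝ)`, with weak derivatives `D 0, …, D k`
(these are determined up to null sets by `V`). -/
def IsSobolevLocInfty (k : ℕ) (V : ℝ → ℂ) (D : ℕ → ℝ → ℂ) : Prop :=
  LocEssBounded V ∧ ∀ n ≤ k, LocEssBounded (D n) ∧ IsWeakDeriv n V (D n)

/-! ### The maximal operator `H_V = d⁴/dx⁴ + V` in `L²(ℝ)` -/

/-- `u'''' + V u = f` in the sense of distributions (for `V ∈ L²_loc` and `u, f ∈ L²`). -/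
def DistribEq (V u f : ℝ → ℂ) : Prop :=
  ∀ φ : ℝ → ℝ, IsTest φ →
    (∫ x, iteratedDeriv 4 φ x • u x) + (∫ x, φ x • (V x * u x)) = ∫ x, φ x • f x

/-- The maximal domain of `H_V`: all `u ∈ L²(ℝ)` such that the distribution `u'''' + V u` is in
`L²(ℝ)`. -/
def domH (V : ℝ → ℂ) : Set (ℝ → ℂ) :=
  {u | MemLp u 2 volume ∧ ∃ f, MemLp f 2 volume ∧ DistribEq V u f}

open Classical in
/-- The operator `H_V`: for `u` in its domain, `opH V u` is the `L²` function representing the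
distribution `u'''' + V u`. -/
noncomputable def opH (V u : ℝ → ℂ) : ℝ → ℂ :=
  if h : u ∈ domH V then h.2.choose else 0

theorem opH_spec {V u : ℝ → ℂ} (h : u ∈ domH V) :
    MemLp (opH V u) 2 volume ∧ DistribEq V u (opH V u) := by
  unfold opH
  rw [dif_pos h]
  exact h.2.choose_spec

/-- The value of `H_V` is unique almost everywhere. -/
theorem opH_ae_eq {V u f : ℝ → ℂ} (hu : MemLp u 2 volume) (hf : MemLp f 2 volume)
    (he : DistribEq V u f) : opH V u =ᵐ[volume] f := by
  have h : u ∈ domH V := ⟨hu, f, hf, he⟩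
  obtain ⟨h1, h2⟩ := opH_spec h
  refine ae_eq_of_integral_contDiff_smul_eq (h1.locallyIntegrable one_le_two)
    (hf.locallyIntegrable one_le_two) ?_
  intro φ hφ hc
  rw [← h2 φ ⟨hφ, hc⟩, ← he φ ⟨hφ, hc⟩]

/-- The norm of `L²(ℝ)`. -/
noncomputable def normL2 (u : ℝ → ℂ) : ℝ := (eLpNorm u 2 volume).toReal

/-! ### Conditions on the potential at one of the two ends of the line -/

/-- `V` is bounded at the end `l` (with `l = atTop` for `+∞` and `l = atBot` for `-∞`). -/
def BoundedAtEnd (l : Filter ℝ) (V : ℝ → ℂ) : Prop := ∃ C : ℝ, ∀ᶠ x in l, ‖V x‖ ≤ C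

/-- The conditions on `V` and on the weight `τ` at one end `l` of the line, where `I` is the closed
half-line leading to that end. The exponent `ε` is `ε₁` if `V` is unbounded at that end, and `ε₂`
if `V` is bounded there. Bounds on weak derivatives are understood almost everywhere. -/
structure EndAssumption (N : ℕ) (V : ℝ → ℂ) (D : ℕ → ℝ → ℂ) (τ : ℝ → ℝ) (ε : ℝ)
    (l : Filter ℝ) (I : Set ℝ) : Prop where
  continuousOn_weight : ContinuousOn τ I
  weight_pos : ∀ x ∈ I, 0 < τ x
  deriv_bound : ∀ n, 1 ≤ n → n ≤ N + 3 →
    (fun x => D n x) =O[l ⊓ ae volume] fun x => τ x ^ n * ‖V x‖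
  of_unbounded : ¬ BoundedAtEnd l V →
    0 < ε ∧
    (∀ᶠ x in l, DifferentiableAt ℝ τ x) ∧
    (∃ ν : ℝ, -1 ≤ ν ∧
      ((fun x : ℝ => |x| ^ ν) =O[l] τ) ∧
      (deriv τ =O[l] fun x => |x| ^ ν * τ x)) ∧
    ((fun x => (D 1 x).im) =O[l ⊓ ae volume] fun x => τ x * |(V x).im|) ∧
    ((fun x => τ x ^ 4 * (τ x ^ (12 + 4 * ε) + |(V x).re| ^ (3 + ε)))
      =O[l] fun x => |(V x).im| ^ 4)
  of_bounded : BoundedAtEnd l V →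
    0 < ε ∧ ε < 1 / 3 ∧ (τ =O[l] fun x => |x| ^ (1 / 3 - ε))

/-- The standing assumption on the potential `V` (taken as its continuous representative) with
weak derivatives `D n`, the weights `τm` on `(-∞, 0]` and `τp` on `[0, ∞)`, and the exponents
`εm`, `εp` belonging to the ends `-∞` and `+∞`. -/
structure Assumption (N : ℕ) (V : ℝ → ℂ) (D : ℕ → ℝ → ℂ) (τm τp : ℝ → ℝ) (εm εp : ℝ) :
    Prop where
  continuous : Continuous V
  sobolev : IsSobolevLocInfty (N + 3) V D
  limsup_neg : limsup (fun x => ((V x).im : EReal)) atBot < 0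
  liminf_pos : 0 < liminf (fun x => ((V x).im : EReal)) atTop
  left : EndAssumption N V D τm εm atBot (Iic 0)
  right : EndAssumption N V D τp εp atTop (Ici 0)

/-! ### The quantities in the estimate -/

/-- The positive solutions `x` of `|Im V(s x)| / τ(s x) = α^((3+ε)/(4+ε))`, where the sign
`s = 1` belongs to the end `+∞` and `s = -1` to the end `-∞`. -/
def crossingSet (s : ℝ) (V : ℝ → ℂ) (τ : ℝ → ℝ) (ε α : ℝ) : Set ℝ :=
  {x | 0 < x ∧ |(V (s * x)).im| / τ (s * x) = α ^ ((3 + ε) / (4 + ε))}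

open Classical in
/-- The numbers `δ_α^±`. If `V` is unbounded at the end, this is the smallest positive solution of
the equation in `crossingSet` (whenever there is one). -/
noncomputable def cutoffRadius (s : ℝ) (l : Filter ℝ) (V : ℝ → ℂ) (τ : ℝ → ℝ) (ε α : ℝ) : ℝ :=
  if BoundedAtEnd l V then α ^ (3 / (4 - 3 * ε)) else sInf (crossingSet s V τ ε α)

/-- `δ_α^-` -/
noncomputable def deltaMinus (V : ℝ → ℂ) (τm : ℝ → ℝ) (εm α : ℝ) : ℝ :=
  cutoffRadius (-1) atBot V τm εm α

/-- `δ_α^+` -/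
noncomputable def deltaPlus (V : ℝ → ℂ) (τp : ℝ → ℝ) (εp α : ℝ) : ℝ :=
  cutoffRadius 1 atTop V τp εp α

/-- `σ_-^{(N)}(α)` -/
noncomputable def sigmaMinus (N : ℕ) (V : ℝ → ℂ) (τm : ℝ → ℝ) (εm α : ℝ) : ℝ :=
  α ^ (-((N : ℝ) + 1) / 4) *
    sSup ((fun x => τm x ^ (N + 1) * ‖V x‖) '' Icc (-deltaMinus V τm εm α) 0)

/-- `σ_+^{(N)}(α)` -/
noncomputable def sigmaPlus (N : ℕ) (V : ℝ → ℂ) (τp : ℝ → ℝ) (εp α : ℝ) : ℝ :=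
  α ^ (-((N : ℝ) + 1) / 4) *
    sSup ((fun x => τp x ^ (N + 1) * ‖V x‖) '' Icc 0 (deltaPlus V τp εp α))

end Biharmonic

/-! The pseudomode is a truncated WKB function. Put p = (λ - V)^{1/4} and u = exp(∫ p s) with s = -i
+ corrections. In the normalised derivatives η_j = V^{(j)} p^{-(4+j)} the operator p⁻¹ d/dx becomes
a derivation of a polynomial ring, and u'''' + (V - λ) u = p⁴ r u, where r is a differential
polynomial in s. Give η_j the weight j; differentiation raises the weight by one. Correcting s
successively, one weight at a time, pushes r to weight at least N + 1 (`exists_wkb`); each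
correction only requires dividing by 4(-i)³. Since |η_j| ≲ (τ α^{-1/4})^j |V|/α and every monomial
of positive weight contains at least one η, the residual p⁴ r is of order α^{-(N+1)/4} τ^{N+1} |V|,
which is the size of σ (`Graded.bound`, `exists_wkb_bound`).

Localisation comes from (log |u|)' = Re(p s) ≈ Im p. This has the sign of Im(λ - V) = β - Im V and
the size α^{-3/4} |Im(λ - V)| (`wp_im`), so the sign change of Im V makes |u| decrease in both
directions away from a bounded interval. The corrections in s do not spoil this because τ |V| is at
most a small multiple of α^{1/4} (1 + |Im V|) up to δ_α (`phase_lower_bound`). Next to δ_α there is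
a window of width w with w (1 + |Im V|) ≥ c α^{3/4+κ}. Hence |u| ≲ exp(-c' α^κ) where the cut-off
varies, and this beats every power of α produced there (`pseudomode_bound`,
`eventually_exp_error_le`).

The geometry at one end is collected in `CutoffGood`. If V is bounded, the window is a fixed
fraction of δ_α. If V is unbounded, its width is comparable to 1/τ(δ_α); on that scale Im V loses at
most a factor two (`slow_variation`), and the equation defining δ_α gives the exponent (3+ε)/(4+ε) >
3/4. The left end is treated by reflection.

The derivative of V of order N + 3 is only locally bounded, so the fourth derivative of the
pseudomode exists only almost everywhere. All regularity is therefore phrased by locally Lipschitz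
functions, which are stable under the operations used and satisfy the fundamental theorem of
calculus (`integral_eq_sub_of_lipAt`). On the bounded middle interval the derivatives of V are not
controlled by V and are merely bounded; this region accounts for the separate term α^{-(N+1)/4}. -/

namespace Biharmonic

/-! ### The formal WKB expansion -/

/-- Differential polynomials in the normalised derivatives `X j` of the potential, `j ≥ 1`. -/
abbrev DPoly := MvPolynomial ℕ ℂ

open MvPolynomial in
/-- The derivation on differential polynomials corresponding to `p⁻¹ d/dx`. -/
noncomputable def dder : Derivation ℂ DPoly DPoly :=
  -- Since p' = -p² η₁ / 4, differentiating the factor p^{-(4+j)} of η_j yields the coefficient (4 +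
  -- j)/4.
  mkDerivation ℂ fun j : ℕ => X (j + 1) + C (1 + (j : ℂ) / 4) * X 1 * X j

open MvPolynomial in
/-- The operator `r ↦ p^{-(m+1)} (p^m r)'` on differential polynomials. -/
noncomputable def tder (m : ℕ) (r : DPoly) : DPoly :=
  dder r - C ((m : ℂ) / 4) * X 1 * r

open MvPolynomial in
/-- `Graded M k P`: the differential polynomial `P` involves only variables `X j`, `1 ≤ j ≤ M`, and
all its monomials have weight at least `k`, where `X j` has weight `j`. -/
inductive Graded (M : ℕ) : ℕ → DPoly → Prop
  | zero (k : ℕ) : Graded M k 0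
  | const (c : ℂ) : Graded M 0 (C c)
  | var (j : ℕ) (h1 : 1 ≤ j) (h : j ≤ M) : Graded M j (X j)
  | add {k : ℕ} {P Q : DPoly} : Graded M k P → Graded M k Q → Graded M k (P + Q)
  | mul {k l : ℕ} {P Q : DPoly} : Graded M k P → Graded M l Q → Graded M (k + l) (P * Q)
  | weaken {k l : ℕ} {P : DPoly} : Graded M k P → l ≤ k → Graded M l P

namespace Graded

open MvPolynomial

theorem mono {M M' k : ℕ} {P : DPoly} (h : Graded M k P) (hM : M ≤ M') : Graded M' k P := by
  induction h with
  | zero k => exact .zero _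
  | const c => exact .const _
  | var j h1 h => exact .var _ h1 (h.trans hM)
  | add _ _ h1 h2 => exact .add h1 h2
  | mul _ _ h1 h2 => exact .mul h1 h2
  | weaken _ hl h => exact .weaken h hl

theorem mono' {M M' k k' : ℕ} {P : DPoly} (h : Graded M k P) (hM : M ≤ M') (hk : k' ≤ k) :
    Graded M' k' P := (h.mono hM).weaken hk

theorem mul' {M₁ M₂ M k l n : ℕ} {P Q : DPoly} (h1 : Graded M₁ k P) (h2 : Graded M₂ l Q)
    (hM₁ : M₁ ≤ M) (hM₂ : M₂ ≤ M) (hn : n ≤ k + l) : Graded M n (P * Q) :=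
  ((h1.mono hM₁).mul (h2.mono hM₂)).weaken hn

theorem const_mul {M k : ℕ} {P : DPoly} (c : ℂ) (h : Graded M k P) : Graded M k (C c * P) :=
  ((Graded.const (M := M) c).mul h).weaken (by omega)

theorem sub {M k : ℕ} {P Q : DPoly} (h1 : Graded M k P) (h2 : Graded M k Q) :
    Graded M k (P - Q) := by
  have := h1.add (h2.const_mul (-1))
  simpa [sub_eq_add_neg] using this

theorem dder {M k : ℕ} {P : DPoly} (h : Graded M k P) :
    Graded (M + 1) (k + 1) (dder P) := by
  induction h with
  | zero k => simpa using Graded.zero _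
  | const c => simpa [Biharmonic.dder] using Graded.zero _
  | var j h1 h =>
    rw [Biharmonic.dder, mkDerivation_X]
    refine .add (.var _ (by omega) (by omega)) ?_
    exact ((const_mul _ (.var 1 le_rfl (by omega))).mul (.var j h1 (by omega))).weaken
      (by omega)
  | add _ _ h1 h2 => rw [map_add]; exact .add h1 h2
  | mul g1 g2 h1 h2 =>
    rw [Derivation.leibniz, smul_eq_mul, smul_eq_mul]
    exact .add (g1.mul' h2 (by omega) le_rfl (by omega)) (g2.mul' h1 (by omega) le_rfl (by omega))
  | weaken _ hl h => exact .weaken h (by omega)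

theorem tder {M k : ℕ} {P : DPoly} (m : ℕ) (h : Graded M k P) :
    Graded (M + 1) (k + 1) (tder m P) := by
  refine h.dder.sub ?_
  exact ((const_mul _ (.var 1 le_rfl (by omega))).mul (h.mono (Nat.le_succ M))).weaken (by omega)

/-- Splitting off the part of lowest weight. -/
theorem split {M k : ℕ} {P : DPoly} (h : Graded M k P) :
    ∃ a b : DPoly, P = a + b ∧ Graded k k a ∧ Graded M (k + 1) b := by
  induction h with
  | zero k => exact ⟨0, 0, by simp, .zero _, .zero _⟩
  | const c => exact ⟨C c, 0, by simp, .const _, .zero _⟩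
  | var j h1 h => exact ⟨X j, 0, by simp, .var _ h1 le_rfl, .zero _⟩
  | add _ _ h1 h2 =>
    obtain ⟨a1, b1, rfl, ha1, hb1⟩ := h1
    obtain ⟨a2, b2, rfl, ha2, hb2⟩ := h2
    exact ⟨a1 + a2, b1 + b2, by ring, ha1.add ha2, hb1.add hb2⟩
  | @mul k l P Q g1 g2 h1 h2 =>
    obtain ⟨a1, b1, rfl, ha1, hb1⟩ := h1
    obtain ⟨a2, b2, rfl, ha2, hb2⟩ := h2
    refine ⟨a1 * a2, b1 * (a2 + b2) + (a1 + b1) * b2 - b1 * b2, by ring,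
      ha1.mul' ha2 (by omega) (by omega) le_rfl, ?_⟩
    exact ((hb1.mul' g2 le_rfl le_rfl (by omega)).add (g1.mul' hb2 le_rfl le_rfl (by omega))).sub
      (hb1.mul' hb2 le_rfl le_rfl (by omega))
  | @weaken k l P g hl h =>
    rcases hl.eq_or_lt with rfl | hlt
    · exact h
    · exact ⟨0, P, by simp, .zero _, g.weaken hlt⟩

end Graded

/-- The differential polynomial `r` for which `u'''' + (V - λ) u = p⁴ r u` if `u' = p s u`. -/
noncomputable def resid (s : DPoly) : DPoly :=
  tder 3 (tder 2 (tder 1 s)) + 4 * s * tder 2 (tder 1 s) + 3 * (tder 1 s) ^ 2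
    + 6 * s ^ 2 * tder 1 s + s ^ 4 - 1

theorem tder_add (m : ℕ) (r q : DPoly) : tder m (r + q) = tder m r + tder m q := by
  simp only [tder, map_add]; ring

/-- Grouped so that, apart from the linear term 4 s³ e, every summand carries a derivative or a
second factor e. If e has weight k ≥ 1, all of these have weight at least k + 1. -/
theorem resid_add (s e : DPoly) :
    resid (s + e) = resid s + 4 * s ^ 3 * e + (tder 3 (tder 2 (tder 1 e))
      + 4 * (s * tder 2 (tder 1 e)) + 4 * (e * tder 2 (tder 1 (s + e)))
      + 3 * (tder 1 s * tder 1 e) + 3 * (tder 1 e * tder 1 (s + e))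
      + 6 * (s * s * tder 1 e) + 12 * (s * (e * tder 1 (s + e))) + 6 * (e * (e * tder 1 (s + e)))
      + 6 * (s * s * (e * e)) + 4 * (s * e * (e * e)) + e * e * (e * e)) := by
  simp only [resid, tder_add]; ring

-- Formal solution of the WKB hierarchy, by induction on N. At s = -i the residual contains no term
-- of weight zero because (-i)⁴ = 1. Afterwards its lowest part `a` is removed by adding e = -a /
-- (4(-i)³) to s; by `resid_add` everything else that changes has higher weight.
open MvPolynomial in
theorem exists_wkb (N : ℕ) :
    ∃ s : DPoly, Graded N 1 (s - C (-Complex.I)) ∧ Graded (N + 3) (N + 1) (resid s) := by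
  have num : ∀ (n : ℕ) {M k : ℕ} {P : DPoly}, Graded M k P → Graded M k ((n : DPoly) * P) := by
    intro n M k P h
    have := h.const_mul (n : ℂ)
    simpa using this
  induction N with
  | zero =>
    refine ⟨C (-Complex.I), by simpa using Graded.zero _, ?_⟩
    have h0 : Graded 0 0 (C (-Complex.I) : DPoly) := .const _
    have h1 := h0.tder 1
    have h2 := h1.tder 2
    have h3 := h2.tder 3
    have e : (C (-Complex.I) : DPoly) ^ 4 = 1 := by
      rw [← map_pow, Even.neg_pow (by decide), Complex.I_pow_four, map_one]
    have := (((h3.mono' (M' := 3) (by omega) (by omega : 1 ≤ _)).add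
      (num 4 (h0.mul' h2 (M := 3) (by omega) (by omega) (by omega : 1 ≤ _)))).add
      (num 3 (h1.mul' h1 (M := 3) (by omega) (by omega) (by omega : 1 ≤ _)))).add
      (num 6 ((h0.mul h0).mul' h1 (M := 3) (by omega) (by omega) (by omega : 1 ≤ _)))
    convert this using 1
    rw [resid, e]; push_cast; ring
  | succ n ih =>
    obtain ⟨s, hs, hr⟩ := ih
    -- `a` involves only X 1, …, X (n+1), although the residual contains variables up to X (n+3).
    -- Thus s gains just one derivative of V per step.
    obtain ⟨a, b, hab, ha, hb⟩ := hr.split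
    set c : ℂ := -Complex.I with hc
    have hc3 : (4 * c ^ 3) ≠ 0 := by simp [hc]
    set e : DPoly := C (-(4 * c ^ 3)⁻¹) * a with he
    have hE : Graded (n + 1) (n + 1) e := ha.const_mul _
    have hs0 : Graded n 0 s := by
      have := (hs.weaken (Nat.zero_le 1)).add (.const (M := n) c)
      simpa using this
    have hcancel : 4 * C c ^ 3 * e = -a := by
      have : (4 : DPoly) * C c ^ 3 = C (4 * c ^ 3) := by rw [map_mul, map_pow, map_ofNat]
      rw [this, he, ← mul_assoc, ← C_mul, mul_neg, mul_inv_cancel₀ hc3]; simp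
    refine ⟨s + e, ?_, ?_⟩
    · have := (hs.mono (Nat.le_succ n)).add (hE.weaken (by omega : 1 ≤ _))
      convert this using 1; ring
    -- The linear term is 4 s³ e, while e only cancels 4 c³ e against `a`. The difference s³ - c³
    -- has the factor s - c of weight at least one.
    have key : resid s + 4 * s ^ 3 * e
        = b + 4 * ((s - C c) * ((s * s + (s * C c + C c * C c)) * e)) := by
      have : 4 * s ^ 3 * e = 4 * ((s - C c) * ((s * s + (s * C c + C c * C c)) * e))
        + 4 * C c ^ 3 * e := by ring
      rw [this, hcancel, hab]; ring
    rw [resid_add, key]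
    have hse : Graded (n + 1) 0 (s + e) := (hs0.mono (Nat.le_succ n)).add (hE.weaken (by omega))
    have hcc := Graded.const (M := n) c
    have s1 := hs0.tder 1
    have e1 := hE.tder 1
    have e2 := e1.tder 2
    have e3 := e2.tder 3
    have t1 := hse.tder 1
    have t2 := t1.tder 2
    have ss := hs0.mul hs0
    have ee := hE.mul hE
    have cast4 : (4 : DPoly) = ((4 : ℕ) : DPoly) := by norm_num
    have cast3 : (3 : DPoly) = ((3 : ℕ) : DPoly) := by norm_num
    have cast6 : (6 : DPoly) = ((6 : ℕ) : DPoly) := by norm_num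
    have cast12 : (12 : DPoly) = ((12 : ℕ) : DPoly) := by norm_num
    rw [cast4, cast3, cast6, cast12]
    refine .add (.add (hb.mono' (by omega) (by omega)) (num 4 ?_)) ?_
    · have : Graded (n + 1) (n + 1) ((s * s + (s * C c + C c * C c)) * e) :=
        (ss.add ((hs0.mul hcc).add (hcc.mul hcc))).mul' hE (by omega) le_rfl (by omega)
      exact hs.mul' this (by omega) (by omega) (by omega)
    refine .add (.add (.add (.add (.add (.add (.add (.add (.add (.add ?_ (num _ ?_)) (num _ ?_))
      (num _ ?_)) (num _ ?_)) (num _ ?_)) (num _ ?_)) (num _ ?_)) (num _ ?_)) (num _ ?_)) ?_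
    · exact e3.mono' (by omega) (by omega)
    · exact hs0.mul' e2 (by omega) (by omega) (by omega)
    · exact hE.mul' t2 (by omega) (by omega) (by omega)
    · exact s1.mul' e1 (by omega) (by omega) (by omega)
    · exact e1.mul' t1 (by omega) (by omega) (by omega)
    · exact ss.mul' e1 (by omega) (by omega) (by omega)
    · exact (hs0.mono' (by omega) le_rfl).mul' (hE.mul' t1 (by omega) le_rfl le_rfl) le_rfl
        (by omega) (by omega)
    · exact hE.mul' (hE.mul' t1 (by omega) le_rfl le_rfl) (by omega) (by omega) (by omega)
    · exact ss.mul' ee (by omega) (by omega) (by omega)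
    · exact (hs0.mul' hE (by omega) le_rfl le_rfl).mul' ee (by omega) (by omega) (by omega)
    · exact ee.mul' ee (by omega) (by omega) (by omega)

/-! ### Size of weighted differential polynomials -/

/-- The size of a differential polynomial of weight `k`. -/
noncomputable def gsize (t w : ℝ) (k : ℕ) : ℝ := if k = 0 then 1 else t ^ k * w

theorem gsize_nonneg {t w : ℝ} (ht : 0 ≤ t) (hw : 0 ≤ w) (k : ℕ) : 0 ≤ gsize t w k := by
  unfold gsize; split_ifs <;> positivity

theorem gsize_mul_le {t w : ℝ} (ht : 0 ≤ t) (hw : 0 ≤ w) (hw1 : w ≤ 1) (k l : ℕ) :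
    gsize t w k * gsize t w l ≤ gsize t w (k + l) := by
  unfold gsize
  rcases Nat.eq_zero_or_pos k with rfl | hk
  · simp
  rcases Nat.eq_zero_or_pos l with rfl | hl
  · simp
  rw [if_neg hk.ne', if_neg hl.ne', if_neg (by omega), pow_add]
  have : 0 ≤ t ^ k * t ^ l * w := by positivity
  nlinarith [mul_nonneg this (sub_nonneg.2 hw1)]

theorem gsize_anti {t w : ℝ} (ht : 0 ≤ t) (ht1 : t ≤ 1) (hw : 0 ≤ w) (hw1 : w ≤ 1) {k l : ℕ}
    (h : l ≤ k) : gsize t w k ≤ gsize t w l := by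
  unfold gsize
  split_ifs with h1 h2 h2
  · exact le_rfl
  · omega
  · exact mul_le_one₀ (pow_le_one₀ ht ht1) hw hw1
  · exact mul_le_mul_of_nonneg_right (pow_le_pow_of_le_one ht ht1 h) hw

/-- Each monomial of positive weight contains some η_j, hence a factor w; further factors w are
dropped using w ≤ 1, and surplus powers of t using t ≤ 1. Keeping one factor w is essential: it
becomes |V|/α and produces |V| in σ. Weight zero allows constants, whence the separate value of
`gsize` there. -/
theorem Graded.bound {M k : ℕ} {P : DPoly} (h : Graded M k P) (K : ℝ) :
    ∃ C : ℝ, 0 ≤ C ∧ ∀ (η : ℕ → ℂ) (t w : ℝ), 0 ≤ t → t ≤ 1 → 0 ≤ w → w ≤ 1 →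
      (∀ j, 1 ≤ j → j ≤ M → ‖η j‖ ≤ K * (t ^ j * w)) →
      ‖MvPolynomial.eval η P‖ ≤ C * gsize t w k := by
  induction h with
  | zero k => exact ⟨0, le_rfl, by intros; simp⟩
  | const c => exact ⟨‖c‖, norm_nonneg _, by intros; simp [gsize]⟩
  | var j h1 h =>
    refine ⟨max K 0, le_max_right _ _, fun η t w ht ht1 hw hw1 hη => ?_⟩
    rw [MvPolynomial.eval_X, gsize, if_neg (by omega)]
    exact (hη j h1 h).trans (mul_le_mul_of_nonneg_right (le_max_left _ _) (by positivity))
  | add _ _ h1 h2 =>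
    obtain ⟨C1, hC1, h1⟩ := h1
    obtain ⟨C2, hC2, h2⟩ := h2
    refine ⟨C1 + C2, by positivity, fun η t w ht ht1 hw hw1 hη => ?_⟩
    rw [map_add, add_mul]
    exact (norm_add_le _ _).trans (add_le_add (h1 η t w ht ht1 hw hw1 hη)
      (h2 η t w ht ht1 hw hw1 hη))
  | @mul k l P Q g1 g2 h1 h2 =>
    obtain ⟨C1, hC1, h1⟩ := h1
    obtain ⟨C2, hC2, h2⟩ := h2
    refine ⟨C1 * C2, by positivity, fun η t w ht ht1 hw hw1 hη => ?_⟩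
    rw [map_mul, norm_mul]
    calc _ ≤ (C1 * gsize t w k) * (C2 * gsize t w l) :=
          mul_le_mul (h1 η t w ht ht1 hw hw1 hη) (h2 η t w ht ht1 hw hw1 hη) (norm_nonneg _)
            (mul_nonneg hC1 (gsize_nonneg ht hw _))
      _ = C1 * C2 * (gsize t w k * gsize t w l) := by ring
      _ ≤ _ := mul_le_mul_of_nonneg_left (gsize_mul_le ht hw hw1 k l) (by positivity)
  | weaken _ hl h =>
    obtain ⟨C1, hC1, h1⟩ := h
    refine ⟨C1, hC1, fun η t w ht ht1 hw hw1 hη => (h1 η t w ht ht1 hw hw1 hη).trans ?_⟩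
    exact mul_le_mul_of_nonneg_left (gsize_anti ht ht1 hw hw1 hl) hC1

/-! ### Locally Lipschitz functions -/

open Topology in
/-- `f` is Lipschitz in a neighbourhood of `x`. -/
def LipAt {X Y : Type*} [PseudoEMetricSpace X] [PseudoEMetricSpace Y] (f : X → Y) (x : X) : Prop :=
  ∃ K : NNReal, ∃ t ∈ 𝓝 x, LipschitzOnWith K f t

namespace LipAt

variable {X Y Z : Type*} [PseudoEMetricSpace X] [PseudoEMetricSpace Y] [PseudoEMetricSpace Z]

theorem continuousAt {f : X → Y} {x : X} (hf : LipAt f x) : ContinuousAt f x := by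
  obtain ⟨K, t, ht, h⟩ := hf
  exact h.continuousOn.continuousAt ht

theorem comp {g : Y → Z} {f : X → Y} {x : X} (hg : LipAt g (f x)) (hf : LipAt f x) :
    LipAt (fun y => g (f y)) x := by
  have hc := hf.continuousAt
  obtain ⟨K, t, ht, h⟩ := hf
  obtain ⟨L, s, hs, g'⟩ := hg
  refine ⟨L * K, t ∩ f ⁻¹' s, inter_mem ht (hc hs), ?_⟩
  exact g'.comp (h.mono inter_subset_left) (fun y hy => hy.2)

theorem prodMk {f : X → Y} {g : X → Z} {x : X} (hf : LipAt f x) (hg : LipAt g x) :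
    LipAt (fun y => (f y, g y)) x := by
  obtain ⟨K, t, ht, h⟩ := hf
  obtain ⟨L, s, hs, g'⟩ := hg
  exact ⟨max K L, t ∩ s, inter_mem ht hs, (h.mono inter_subset_left).prodMk
    (g'.mono inter_subset_right)⟩

theorem const (c : Y) (x : X) : LipAt (fun _ => c) x :=
  ⟨0, univ, univ_mem, (LipschitzWith.const c).lipschitzOnWith⟩

theorem congr {f g : X → Y} {x : X} (hf : LipAt f x) (h : g =ᶠ[nhds x] f) : LipAt g x := by
  obtain ⟨K, t, ht, hl⟩ := hf
  refine ⟨K, t ∩ {y | g y = f y}, inter_mem ht h, fun y hy z hz => ?_⟩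
  rw [hy.2, hz.2]
  exact hl hy.1 hz.1

theorem _root_.Biharmonic.lipAt_add (z : ℂ × ℂ) : LipAt (fun z : ℂ × ℂ => z.1 + z.2) z := by
  have h : ContDiff ℝ 1 fun z : ℂ × ℂ => z.1 + z.2 := contDiff_fst.add contDiff_snd
  exact h.contDiffAt.exists_lipschitzOnWith

theorem _root_.Biharmonic.lipAt_mul (z : ℂ × ℂ) : LipAt (fun z : ℂ × ℂ => z.1 * z.2) z := by
  have h : ContDiff ℝ 1 fun z : ℂ × ℂ => z.1 * z.2 := contDiff_fst.mul contDiff_snd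
  exact h.contDiffAt.exists_lipschitzOnWith

theorem _root_.Biharmonic.lipAt_smul (z : ℝ × ℂ) : LipAt (fun z : ℝ × ℂ => z.1 • z.2) z := by
  have h : ContDiff ℝ 1 fun z : ℝ × ℂ => z.1 • z.2 := contDiff_fst.smul contDiff_snd
  exact h.contDiffAt.exists_lipschitzOnWith

theorem add {f g : X → ℂ} {x : X} (hf : LipAt f x) (hg : LipAt g x) :
    LipAt (fun y => f y + g y) x :=
  comp (f := fun y => (f y, g y)) (lipAt_add _) (hf.prodMk hg)

theorem mul {f g : X → ℂ} {x : X} (hf : LipAt f x) (hg : LipAt g x) :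
    LipAt (fun y => f y * g y) x :=
  comp (f := fun y => (f y, g y)) (lipAt_mul _) (hf.prodMk hg)

theorem smul {f : X → ℝ} {g : X → ℂ} {x : X} (hf : LipAt f x) (hg : LipAt g x) :
    LipAt (fun y => f y • g y) x :=
  comp (f := fun y => (f y, g y)) (lipAt_smul _) (hf.prodMk hg)

theorem pow {f : X → ℂ} {x : X} (hf : LipAt f x) (n : ℕ) : LipAt (fun y => f y ^ n) x := by
  induction n with
  | zero => simpa using LipAt.const (1 : ℂ) x
  | succ n ih => simpa only [pow_succ] using ih.mul hf

theorem of_hasStrictDerivAt {f : ℂ → ℂ} {f' x : ℂ} (h : HasStrictDerivAt f f' x) : LipAt f x :=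
  h.hasStrictFDerivAt.exists_lipschitzOnWith

theorem exists_lipschitzOnWith_Icc {f : ℝ → ℂ} (hf : ∀ x, LipAt f x) (a b : ℝ) :
    ∃ K, LipschitzOnWith K f (Icc a b) := by
  refine LocallyLipschitzOn.exists_lipschitzOnWith_of_compact isCompact_Icc fun x _ => ?_
  obtain ⟨K, t, ht, h⟩ := hf x
  exact ⟨K, t, mem_nhdsWithin_of_mem_nhds ht, h⟩

end LipAt

theorem lipAt_intervalIntegral {g : ℝ → ℂ} (hg : ∀ a b, IntervalIntegrable g volume a b)
    {x B : ℝ} {t : Set ℝ} (ht : t ∈ nhds x) (hb : ∀ᵐ y, y ∈ t → ‖g y‖ ≤ B) (c : ℂ) :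
    LipAt (fun y => c + ∫ s in (0 : ℝ)..y, g s) x := by
  obtain ⟨ε, hε, hsub⟩ := Metric.mem_nhds_iff.1 ht
  refine ⟨B.toNNReal, Metric.ball x ε, Metric.ball_mem_nhds x hε, ?_⟩
  refine LipschitzOnWith.of_dist_le_mul fun y hy z hz => ?_
  rw [dist_eq_norm, add_sub_add_left_eq_sub, intervalIntegral.integral_interval_sub_left
    (hg _ _) (hg _ _), dist_eq_norm, Real.norm_eq_abs]
  refine intervalIntegral.norm_integral_le_of_norm_le_const_ae ?_
  filter_upwards [hb] with s hs hs'
  refine (hs (hsub ?_)).trans (Real.le_coe_toNNReal B)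
  have : uIcc z y ⊆ Metric.ball x ε := (convex_ball x ε).ordConnected.uIcc_subset hz hy
  exact this (uIoc_subset_uIcc hs')

/-- The fundamental theorem of calculus for locally Lipschitz functions. -/
theorem integral_eq_sub_of_lipAt {f f' : ℝ → ℂ} (hf : ∀ x, LipAt f x)
    (hf' : ∀ᵐ x, HasDerivAt f (f' x) x) {a b : ℝ} (hab : a ≤ b) :
    IntervalIntegrable f' volume a b ∧ ∫ x in a..b, f' x = f b - f a := by
  -- The interval is enlarged so that a and b become interior points, where the Lipschitz constant
  -- bounds the derivative.
  obtain ⟨K, hK⟩ := LipAt.exists_lipschitzOnWith_Icc hf (a - 1) (b + 1)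
  have hbd : ∀ᵐ x, x ∈ Icc a b → ‖f' x‖ ≤ K := by
    filter_upwards [hf'] with x hx hxm
    rw [← hx.deriv]
    exact norm_deriv_le_of_lipschitzOn
      (Icc_mem_nhds (by linarith [hxm.1]) (by linarith [hxm.2])) hK
  have hmeas : AEStronglyMeasurable f' volume :=
    (stronglyMeasurable_deriv f).aestronglyMeasurable.congr
      (by filter_upwards [hf'] with x hx using hx.deriv)
  have hint : IntervalIntegrable f' volume a b := by
    rw [intervalIntegrable_iff_integrableOn_Icc_of_le hab]
    refine Integrable.mono' (g := fun _ => (K : ℝ)) (by simp) hmeas.restrict ?_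
    exact (ae_restrict_iff' measurableSet_Icc).2 hbd
  refine ⟨hint, ?_⟩
  have hf1 : AbsolutelyContinuousOnInterval f a b := by
    refine LipschitzOnWith.absolutelyContinuousOnInterval (K := K) (hK.mono ?_)
    rw [uIcc_of_le hab]; exact Icc_subset_Icc (by linarith) (by linarith)
  have hf2 : AbsolutelyContinuousOnInterval (fun y => ∫ s in a..y, f' s) a b := by
    refine LipschitzOnWith.absolutelyContinuousOnInterval (K := K) ?_
    rw [uIcc_of_le hab]
    refine LipschitzOnWith.of_dist_le_mul fun y hy z hz => ?_
    have hi : ∀ y ∈ Icc a b, IntervalIntegrable f' volume a y := fun y hy =>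
      hint.mono_set (by rw [uIcc_of_le hab, uIcc_of_le hy.1]; exact Icc_subset_Icc_right hy.2)
    rw [dist_eq_norm, intervalIntegral.integral_interval_sub_left (hi y hy) (hi z hz),
      dist_eq_norm, Real.norm_eq_abs]
    refine intervalIntegral.norm_integral_le_of_norm_le_const_ae ?_
    filter_upwards [hbd] with s hs hs'
    exact hs ((ordConnected_Icc.uIcc_subset hz hy) (uIoc_subset_uIcc hs'))
  -- f minus the primitive of f' is absolutely continuous with derivative zero almost everywhere,
  -- hence constant.
  obtain ⟨C, hC⟩ := (hf1.sub hf2).const_of_ae_hasDerivAt_zero (by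
    filter_upwards [hf', hint.ae_hasDerivAt_integral] with x hx1 hx2 hx3
    have := hx1.sub (hx2 hx3 a (by simp))
    simpa using this)
  have h1 := hC a (by simp)
  have h2 := hC b (by simp)
  simp only [Pi.sub_apply, intervalIntegral.integral_same, sub_zero] at h1 h2
  rw [h1, ← h2]; ring

theorem hasDerivAt_of_lipAt {f f' : ℝ → ℂ} (hf : ∀ x, LipAt f x)
    (hf' : ∀ᵐ x, HasDerivAt f (f' x) x) (hc : Continuous f') (x : ℝ) : HasDerivAt f (f' x) x := by
  have h1 : ∀ y ∈ Ioi (x - 1), f y = f (x - 1) + ∫ s in (x - 1)..y, f' s := fun y hy => by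
    rw [(integral_eq_sub_of_lipAt hf hf' (mem_Ioi.1 hy).le).2]; ring
  have h2 : HasDerivAt (fun y => f (x - 1) + ∫ s in (x - 1)..y, f' s) (f' x) x :=
    (intervalIntegral.integral_hasDerivAt_right (hc.intervalIntegrable _ _)
      (hc.stronglyMeasurableAtFilter _ _) hc.continuousAt).const_add _
  refine h2.congr_of_eventuallyEq ?_
  filter_upwards [Ioi_mem_nhds (show x - 1 < x by linarith)] with y hy using h1 y hy

/-! ### Weak derivatives and locally Lipschitz representatives -/

theorem IsTest.exists_bound {φ : ℝ → ℝ} (hφ : IsTest φ) :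
    ∃ L : ℝ, 0 < L ∧ ∀ x, x ∉ Ioo (-L) L → φ x = 0 ∧ deriv φ x = 0 := by
  obtain ⟨L, hL⟩ := hφ.2.isCompact.isBounded.subset_ball 0
  have key : ∀ x, x ∉ Ioo (-(max L 1)) (max L 1) → x ∉ tsupport φ := fun x hx hx' => by
    have := hL hx'
    rw [Metric.mem_ball, dist_zero_right, Real.norm_eq_abs] at this
    exact hx (abs_lt.1 (this.trans_le (le_max_left _ _)))
  refine ⟨max L 1, by positivity, fun x hx => ⟨image_eq_zero_of_notMem_tsupport (key x hx), ?_⟩⟩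
  exact image_eq_zero_of_notMem_tsupport fun h => key x hx (tsupport_deriv_subset h)

theorem IsTest.deriv {φ : ℝ → ℝ} (hφ : IsTest φ) : IsTest (deriv φ) :=
  ⟨(contDiff_infty_iff_deriv.1 hφ.1).2, hφ.2.deriv⟩

/-- Integration by parts of a locally Lipschitz function against a test function. -/
theorem integral_deriv_smul {f f' : ℝ → ℂ} (hf : ∀ x, LipAt f x)
    (hf' : ∀ᵐ x, HasDerivAt f (f' x) x) {φ : ℝ → ℝ} (hφ : IsTest φ) :
    ∫ x, deriv φ x • f x = -∫ x, φ x • f' x := by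
  obtain ⟨L, hL, hz⟩ := hφ.exists_bound
  have hsupp : ∀ g : ℝ → ℂ, (∀ x, x ∉ Ioo (-L) L → g x = 0) →
      ∫ x, g x = ∫ x in (-L)..L, g x := fun g hg => by
    refine (intervalIntegral.integral_eq_integral_of_support_subset fun x hx => ?_).symm
    by_contra h
    exact hx (hg x fun h' => h (Ioo_subset_Ioc_self h'))
  rw [hsupp _ fun x hx => by rw [(hz x hx).2, zero_smul],
    hsupp _ fun x hx => by rw [(hz x hx).1, zero_smul]]
  have hfc : Continuous f := continuous_iff_continuousAt.2 fun x => (hf x).continuousAt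
  have hd : ∀ x, HasDerivAt φ (deriv φ x) x := fun x =>
    (hφ.1.differentiable (by simp) x).hasDerivAt
  have hlip : ∀ x, LipAt φ x := fun x =>
    (hφ.1.contDiffAt.of_le (by simp)).exists_lipschitzOnWith (𝕂 := ℝ)
  have h1 := integral_eq_sub_of_lipAt (f := fun x => φ x • f x)
    (f' := fun x => φ x • f' x + deriv φ x • f x) (fun x => (hlip x).smul (hf x))
    (by filter_upwards [hf'] with x hx using (hd x).smul hx) (neg_le_self hL.le)
  have hi1 : IntervalIntegrable (fun x => deriv φ x • f x) volume (-L) L :=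
    (hφ.deriv.1.continuous.smul hfc).intervalIntegrable _ _
  have hi2 : IntervalIntegrable (fun x => φ x • f' x) volume (-L) L := by
    have := h1.1.sub hi1
    simpa using this
  have h2 := h1.2
  rw [intervalIntegral.integral_add hi2 hi1, (hz L (by simp)).1, (hz (-L) (by simp)).1] at h2
  simp only [zero_smul, sub_zero] at h2
  exact eq_neg_of_add_eq_zero_right h2

/-- The lemma of du Bois-Reymond. -/
theorem ae_eq_const_of_integral_deriv_smul {h : ℝ → ℂ} (hh : LocallyIntegrable h volume)
    (h0 : ∀ φ : ℝ → ℝ, IsTest φ → ∫ x, deriv φ x • h x = 0) :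
    ∃ c : ℂ, h =ᵐ[volume] fun _ => c := by
  let B : ContDiffBump (0 : ℝ) := ⟨1, 2, by norm_num, by norm_num⟩
  set ρ : ℝ → ℝ := B.normed volume with hρ
  have hρt : IsTest ρ := ⟨B.contDiff_normed, B.hasCompactSupport_normed⟩
  have hρ1 : ∫ x, ρ x = 1 := B.integral_normed
  have hint : ∀ φ : ℝ → ℝ, IsTest φ → Integrable (fun x => φ x • h x) volume := fun φ hφ =>
    hh.integrable_smul_left_of_hasCompactSupport hφ.1.continuous hφ.2
  refine ⟨∫ x, ρ x • h x, ?_⟩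
  refine ae_eq_of_integral_contDiff_smul_eq hh (locallyIntegrable_const _) ?_
  intro φ hφ hc
  have hφt : IsTest φ := ⟨hφ, hc⟩
  set I := ∫ x, φ x with hI
  -- Subtracting (∫ φ) ρ, with ∫ ρ = 1, leaves integral zero. The primitive ψ of g is then a test
  -- function, and h is orthogonal to g = ψ'.
  set g : ℝ → ℝ := fun x => φ x - I * ρ x with hg
  have hgc : ContDiff ℝ ∞ g := hφ.sub (contDiff_const.mul hρt.1)
  obtain ⟨L1, hL1, hz1⟩ := hφt.exists_bound
  obtain ⟨L2, hL2, hz2⟩ := hρt.exists_bound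
  set L := max L1 L2 with hL
  have hLpos : 0 < L := lt_max_of_lt_left hL1
  have hgz : ∀ x, x ∉ Ioo (-L) L → g x = 0 := fun x hx => by
    have e1 : x ∉ Ioo (-L1) L1 := fun h => hx ⟨by linarith [h.1, le_max_left L1 L2],
      by linarith [h.2, le_max_left L1 L2]⟩
    have e2 : x ∉ Ioo (-L2) L2 := fun h => hx ⟨by linarith [h.1, le_max_right L1 L2],
      by linarith [h.2, le_max_right L1 L2]⟩
    simp [hg, (hz1 x e1).1, (hz2 x e2).1]
  have hgi : ∫ x, g x = 0 := by
    rw [hg, integral_sub (hφ.continuous.integrable_of_hasCompactSupport hc)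
      ((hρt.1.continuous.integrable_of_hasCompactSupport hρt.2).const_mul _),
      integral_const_mul, hρ1, mul_one, sub_self]
  set ψ : ℝ → ℝ := fun x => ∫ s in (-L)..x, g s with hψ
  have hψd : ∀ x, HasDerivAt ψ (g x) x := fun x =>
    intervalIntegral.integral_hasDerivAt_right (hgc.continuous.intervalIntegrable _ _)
      (hgc.continuous.stronglyMeasurableAtFilter _ _) hgc.continuous.continuousAt
  have hψ' : deriv ψ = g := funext fun x => (hψd x).deriv
  have hψc : ContDiff ℝ ∞ ψ :=
    contDiff_infty_iff_deriv.2 ⟨fun x => (hψd x).differentiableAt, by rw [hψ']; exact hgc⟩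
  have hψs : HasCompactSupport ψ := by
    refine HasCompactSupport.intro (isCompact_Icc (a := -L) (b := L)) fun x hx => ?_
    rcases not_and_or.1 hx with hx | hx
    · rw [hψ]
      refine intervalIntegral.integral_zero_ae (Eventually.of_forall fun s hs => hgz s ?_)
      rw [uIoc_of_ge (not_le.1 hx).le] at hs
      exact fun h => absurd h.1 (not_lt.2 hs.2)
    · rw [hψ]
      have : ∫ s in (-L)..x, g s = ∫ s, g s := by
        refine intervalIntegral.integral_eq_integral_of_support_subset fun s hs => ?_
        by_contra h
        exact hs (hgz s fun h' => h ⟨h'.1, by linarith [h'.2]⟩)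
      exact this.trans hgi
  have h1 := h0 ψ ⟨hψc, hψs⟩
  rw [hψ'] at h1
  have h2 : ∫ x, g x • h x = (∫ x, φ x • h x) - I • ∫ x, ρ x • h x := by
    rw [← integral_smul, ← integral_sub (hint φ hφt) (by exact (hint ρ hρt).smul I)]
    refine integral_congr_ae (Eventually.of_forall fun x => ?_)
    simp only [hg]
    rw [sub_smul, mul_smul]
  rw [h1] at h2
  rw [sub_eq_zero.1 h2.symm, integral_smul_const]

theorem LocEssBounded.locallyIntegrable {g : ℝ → ℂ} (hg : LocEssBounded g) :
    LocallyIntegrable g volume := by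
  rw [locallyIntegrable_iff]
  intro K hK
  have : IsFiniteMeasure (volume.restrict K) := ⟨by simpa using hK.measure_lt_top⟩
  exact memLp_one_iff_integrable.1 ((hg K hK).mono_exponent le_top)

theorem LocEssBounded.exists_bound {g : ℝ → ℂ} (hg : LocEssBounded g) (L : ℝ) :
    ∃ B : ℝ, ∀ᵐ x, x ∈ Icc (-L) L → ‖g x‖ ≤ B := by
  have h := hg (Icc (-L) L) isCompact_Icc
  refine ⟨(eLpNorm g ∞ (volume.restrict (Icc (-L) L))).toReal, ?_⟩
  rw [← ae_restrict_iff' measurableSet_Icc]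
  rw [eLpNorm_exponent_top] at *
  filter_upwards [ae_le_eLpNormEssSup (f := g) (μ := volume.restrict (Icc (-L) L))] with x hx
  have h2 := h.2
  rw [eLpNorm_exponent_top] at h2
  have := ENNReal.toReal_mono h2.ne hx
  simpa using this

/-- A locally bounded weak derivative is the almost everywhere derivative of a locally Lipschitz
representative. -/
theorem exists_lipschitz_representative {u g : ℝ → ℂ} (hu : LocEssBounded u)
    (hg : LocEssBounded g)
    (h : ∀ φ : ℝ → ℝ, IsTest φ → ∫ x, deriv φ x • u x = -∫ x, φ x • g x) :
    ∃ f : ℝ → ℂ, u =ᵐ[volume] f ∧ (∀ x, LipAt f x) ∧ ∀ᵐ x, HasDerivAt f (g x) x := by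
  have hgl := hg.locallyIntegrable
  have hgi : ∀ a b, IntervalIntegrable g volume a b := fun a b =>
    intervalIntegrable_iff.2
      ((hgl.integrableOn_isCompact isCompact_uIcc).mono_set uIoc_subset_uIcc)
  have hlip : ∀ c x, LipAt (fun y => c + ∫ s in (0 : ℝ)..y, g s) x := fun c x => by
    obtain ⟨B, hB⟩ := hg.exists_bound (|x| + 1)
    exact lipAt_intervalIntegral hgi
      (Icc_mem_nhds (by linarith [neg_abs_le x]) (by linarith [le_abs_self x])) hB c
  have hder : ∀ c : ℂ, ∀ᵐ x, HasDerivAt (fun y => c + ∫ s in (0 : ℝ)..y, g s) (g x) x :=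
    fun c => by
      filter_upwards [LocallyIntegrable.ae_hasDerivAt_integral hgl] with x hx using (hx 0).const_add c
  set w : ℝ → ℂ := fun y => 0 + ∫ s in (0 : ℝ)..y, g s with hw
  have hwc : Continuous w := continuous_iff_continuousAt.2 fun x => (hlip 0 x).continuousAt
  have hul := hu.locallyIntegrable
  have hwl : LocallyIntegrable w volume := hwc.locallyIntegrable
  -- u and the primitive w of g have the same weak derivative, so they differ by a constant.
  obtain ⟨c, hc⟩ := ae_eq_const_of_integral_deriv_smul (h := fun x => u x - w x) (hul.sub hwl)
    fun φ hφ => by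
      simp only [smul_sub]
      rw [integral_sub, h φ hφ, integral_deriv_smul (hlip 0) (hder 0) hφ, sub_self]
      · exact hul.integrable_smul_left_of_hasCompactSupport hφ.deriv.1.continuous hφ.deriv.2
      · exact hwl.integrable_smul_left_of_hasCompactSupport hφ.deriv.1.continuous hφ.deriv.2
  refine ⟨fun y => c + ∫ s in (0 : ℝ)..y, g s, ?_, hlip c, hder c⟩
  filter_upwards [hc] with x hx
  rw [← hx, hw]; ring

/-- A representative of a function in `W^{n,∞}_loc` and of its derivatives, all but the last one
being locally Lipschitz. -/
theorem IsSobolevLocInfty.exists_chain {n : ℕ} {V : ℝ → ℂ} {D : ℕ → ℝ → ℂ} (hn : 0 < n)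
    (hc : Continuous V) (h : IsSobolevLocInfty n V D) :
    ∃ E : ℕ → ℝ → ℂ, E 0 = V ∧ (∀ j ≤ n, E j =ᵐ[volume] D j) ∧
      (∀ j < n, ∀ x, LipAt (E j) x) ∧ (∀ j < n, ∀ᵐ x, HasDerivAt (E j) (E (j + 1) x) x) := by
  have hstep : ∀ j, j < n → ∃ f : ℝ → ℂ, D j =ᵐ[volume] f ∧ (∀ x, LipAt f x) ∧
      ∀ᵐ x, HasDerivAt f (D (j + 1) x) x := fun j hj => by
    refine exists_lipschitz_representative (h.2 j hj.le).1 (h.2 (j + 1) hj).1 fun φ hφ => ?_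
    -- Testing the derivative of order j against φ' and that of order j + 1 against φ shows that `D
    -- (j + 1)` is the first weak derivative of `D j`.
    have h1 := (h.2 j hj.le).2 _ hφ.deriv
    have h2 := (h.2 (j + 1) hj).2 _ hφ
    rw [← iteratedDeriv_succ', h2, pow_succ] at h1
    have hne : (-1 : ℂ) ^ j ≠ 0 := by simp
    rw [mul_assoc] at h1
    rw [← mul_left_cancel₀ hne h1]; ring
  choose! F hF1 hF2 hF3 using hstep
  have hD0 : D 0 =ᵐ[volume] V := by
    refine ae_eq_of_integral_contDiff_smul_eq (h.2 0 (Nat.zero_le _)).1.locallyIntegrable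
      h.1.locallyIntegrable fun φ hφ hcs => ?_
    have := (h.2 0 (Nat.zero_le _)).2 φ ⟨hφ, hcs⟩
    simpa using this.symm
  have hF0 : F 0 = V := by
    have hFc : Continuous (F 0) :=
      continuous_iff_continuousAt.2 fun x => (hF2 0 hn x).continuousAt
    exact Measure.eq_of_ae_eq ((hF1 0 hn).symm.trans hD0) hFc hc
  -- The top derivative has no better representative and is kept as given.
  refine ⟨fun j => if j < n then F j else D j, by simp [hn, hF0], fun j hj => ?_,
    fun j hj x => ?_, fun j hj => ?_⟩
  · by_cases hjn : j < n
    · simp only [hjn, if_true]; exact (hF1 j hjn).symm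
    · simp only [hjn, if_false]; exact EventuallyEq.rfl
  · simp only [hj, if_true]; exact hF2 j hj x
  · simp only [hj, if_true]
    by_cases hjn : j + 1 < n
    · simp only [hjn, if_true]
      filter_upwards [hF3 j hj, hF1 (j + 1) hjn] with x hx hx2
      rwa [← hx2]
    · simp only [hjn, if_false]
      exact hF3 j hj

/-! ### The WKB functions -/

/-- The fourth root `(λ - V)^{1/4}`. -/
noncomputable def wp (lam : ℂ) (V : ℝ → ℂ) (x : ℝ) : ℂ := (lam - V x) ^ (4⁻¹ : ℂ)

/-- The normalised derivatives of the potential. -/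
noncomputable def eta (lam : ℂ) (E : ℕ → ℝ → ℂ) (j : ℕ) (x : ℝ) : ℂ :=
  E j x * (wp lam (E 0) x)⁻¹ ^ (4 + j)

/-- Evaluation of a differential polynomial at the normalised derivatives of the potential. -/
noncomputable def ev (lam : ℂ) (E : ℕ → ℝ → ℂ) (P : DPoly) (x : ℝ) : ℂ :=
  MvPolynomial.eval (fun j => eta lam E j x) P

theorem wp_pow_four (lam : ℂ) (V : ℝ → ℂ) (x : ℝ) : wp lam V x ^ 4 = lam - V x := by
  have := Complex.cpow_nat_inv_pow (lam - V x) (n := 4) (by norm_num)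
  exact this

theorem wp_ne_zero {lam : ℂ} {V : ℝ → ℂ} {x : ℝ} (h : lam - V x ∈ Complex.slitPlane) :
    wp lam V x ≠ 0 := by
  intro h0
  have := wp_pow_four lam V x
  rw [h0] at this
  exact Complex.slitPlane_ne_zero h (by simpa using this.symm)

theorem lipAt_wp {lam : ℂ} {V : ℝ → ℂ} {x : ℝ} (h : lam - V x ∈ Complex.slitPlane)
    (hV : LipAt V x) : LipAt (wp lam V) x := by
  have h1 : LipAt (fun z : ℂ => (lam - z) ^ (4⁻¹ : ℂ)) (V x) := by
    have h2 := (Complex.hasStrictDerivAt_cpow_const (x := lam - V x) (c := 4⁻¹) h).comp (V x)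
      ((hasStrictDerivAt_id (V x)).const_sub lam)
    exact LipAt.of_hasStrictDerivAt h2
  exact h1.comp hV

theorem lipAt_inv_wp {lam : ℂ} {V : ℝ → ℂ} {x : ℝ} (h : lam - V x ∈ Complex.slitPlane)
    (hV : LipAt V x) : LipAt (fun y => (wp lam V y)⁻¹) x :=
  (LipAt.of_hasStrictDerivAt (hasStrictDerivAt_inv (wp_ne_zero h))).comp (lipAt_wp h hV)

theorem hasDerivAt_wp {lam : ℂ} {V : ℝ → ℂ} {x : ℝ} {V' : ℂ}
    (h : lam - V x ∈ Complex.slitPlane) (hV : HasDerivAt V V' x) :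
    HasDerivAt (wp lam V) (-(1 / 4) * V' * (wp lam V x)⁻¹ ^ 3) x := by
  have h1 : HasDerivAt (fun z : ℂ => z ^ (4⁻¹ : ℂ)) _ (lam - V x) :=
    (Complex.hasStrictDerivAt_cpow_const (x := lam - V x) (c := 4⁻¹) h).hasDerivAt
  have h2 := HasDerivAt.comp x h1 (hV.const_sub lam)
  refine h2.congr_deriv ?_
  have hne := wp_ne_zero h
  have h3 : (lam - V x) ^ ((4⁻¹ : ℂ) - 1) = (wp lam V x)⁻¹ ^ 3 := by
    rw [Complex.cpow_sub _ _ (Complex.slitPlane_ne_zero h), Complex.cpow_one]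
    change wp lam V x / _ = _
    rw [div_eq_iff (Complex.slitPlane_ne_zero h), ← wp_pow_four lam V x]
    field_simp
  rw [h3]; ring

section chain

variable {lam : ℂ} {E : ℕ → ℝ → ℂ} {x : ℝ}

theorem lipAt_eta (h : lam - E 0 x ∈ Complex.slitPlane) {j : ℕ} (h0 : LipAt (E 0) x)
    (hj : LipAt (E j) x) : LipAt (eta lam E j) x :=
  hj.mul ((lipAt_inv_wp h h0).pow _)

theorem hasDerivAt_wp_eta (h : lam - E 0 x ∈ Complex.slitPlane)
    (h0 : HasDerivAt (E 0) (E 1 x) x) :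
    HasDerivAt (wp lam (E 0)) (-(1 / 4) * wp lam (E 0) x ^ 2 * eta lam E 1 x) x := by
  refine (hasDerivAt_wp h h0).congr_deriv ?_
  have := wp_ne_zero h
  simp only [eta, inv_pow]
  field_simp

theorem hasDerivAt_eta (h : lam - E 0 x ∈ Complex.slitPlane) {j : ℕ}
    (h0 : HasDerivAt (E 0) (E 1 x) x) (hj : HasDerivAt (E j) (E (j + 1) x) x) :
    HasDerivAt (eta lam E j) (wp lam (E 0) x *
      (eta lam E (j + 1) x + (1 + (j : ℂ) / 4) * eta lam E 1 x * eta lam E j x)) x := by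
  have hne := wp_ne_zero h
  have h1 := hj.mul (((hasDerivAt_wp_eta h h0).inv hne).pow (4 + j))
  refine h1.congr_deriv ?_
  simp only [eta, Pi.inv_apply, Pi.pow_apply]
  have e : 4 + j - 1 = 3 + j := by omega
  rw [e]
  generalize wp lam (E 0) x = p at *
  push_cast
  simp only [inv_pow]
  field_simp
  ring

variable {n : ℕ}

theorem Graded.lipAt_ev {M k : ℕ} {P : DPoly} (hP : Graded M k P) (hM : M < n)
    (h : lam - E 0 x ∈ Complex.slitPlane) (hE : ∀ j < n, LipAt (E j) x) :
    LipAt (ev lam E P) x := by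
  unfold ev
  induction hP with
  | zero k => simpa using LipAt.const (0 : ℂ) x
  | const c => simpa using LipAt.const c x
  | var j h1 hj =>
    simpa using lipAt_eta h (hE 0 (by omega)) (hE j (by omega))
  | add _ _ h1 h2 => simpa using h1.add h2
  | mul _ _ h1 h2 => simpa using h1.mul h2
  | weaken _ _ h => exact h

theorem Graded.hasDerivAt_ev {M k : ℕ} {P : DPoly} (hP : Graded M k P) (hM : M < n)
    (h : lam - E 0 x ∈ Complex.slitPlane) (hE : ∀ j < n, HasDerivAt (E j) (E (j + 1) x) x) :
    HasDerivAt (ev lam E P) (wp lam (E 0) x * ev lam E (Biharmonic.dder P) x) x := by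
  unfold ev
  induction hP with
  | zero k => simpa using hasDerivAt_const x (0 : ℂ)
  | const c => simpa [Biharmonic.dder] using hasDerivAt_const x c
  | var j h1 hj =>
    simpa [Biharmonic.dder, MvPolynomial.mkDerivation_X] using
      hasDerivAt_eta h (hE 0 (by omega)) (hE j (by omega))
  | add _ _ h1 h2 =>
    simp only [map_add, mul_add]
    exact h1.add h2
  | mul _ _ h1 h2 =>
    have := h1.mul h2
    simp only [map_mul, Derivation.leibniz, smul_eq_mul, map_add]
    exact this.congr_deriv (by ring)
  | weaken _ _ h => exact h

/-- The function `p^m r(η)`. -/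
noncomputable def pev (lam : ℂ) (E : ℕ → ℝ → ℂ) (m : ℕ) (r : DPoly) (x : ℝ) : ℂ :=
  wp lam (E 0) x ^ m * ev lam E r x

theorem Graded.lipAt_pev {M k : ℕ} {P : DPoly} (hP : Graded M k P) (hM : M < n) (m : ℕ)
    (h : lam - E 0 x ∈ Complex.slitPlane) (hE : ∀ j < n, LipAt (E j) x) :
    LipAt (pev lam E m P) x :=
  ((lipAt_wp h (hE 0 (by omega))).pow m).mul (hP.lipAt_ev hM h hE)

theorem Graded.hasDerivAt_pev {M k : ℕ} {P : DPoly} (hP : Graded M k P) (hM : M < n) (m : ℕ)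
    (h : lam - E 0 x ∈ Complex.slitPlane) (hE : ∀ j < n, HasDerivAt (E j) (E (j + 1) x) x) :
    HasDerivAt (pev lam E m P) (pev lam E (m + 1) (Biharmonic.tder m P) x) x := by
  have h1 := ((hasDerivAt_wp_eta h (hE 0 (by omega))).pow m).mul (hP.hasDerivAt_ev hM h hE)
  refine h1.congr_deriv ?_
  simp only [pev, Biharmonic.tder]
  have : ev lam E (Biharmonic.dder P - MvPolynomial.C ((m : ℂ) / 4) * MvPolynomial.X 1 * P) x
      = ev lam E (Biharmonic.dder P) x - (m : ℂ) / 4 * eta lam E 1 x * ev lam E P x := by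
    simp [ev]
  rw [this]
  simp only [Pi.pow_apply]
  rcases m with _ | m
  · simp
  · simp only [Nat.add_sub_cancel]; ring

end chain

/-! ### The WKB function, its derivatives and its truncation -/

/-- The differential polynomials `r_j` with `u^{(j)} = p^j r_j u` for `u' = p s u`. -/
noncomputable def derPoly (s : DPoly) : ℕ → DPoly
  | 0 => 1
  | j + 1 => tder j (derPoly s j) + derPoly s j * s

/-- The product rule for (p^m r)(p^l q), in which the powers of p add up. -/
theorem tder_mul (m l : ℕ) (r q : DPoly) :
    tder (m + l) (r * q) = tder m r * q + r * tder l q := by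
  simp only [tder, Derivation.leibniz, smul_eq_mul, Nat.cast_add, add_div, map_add]
  ring

/-- Since p⁴ = λ - V, the summand 1 is cancelled by (V - λ) u; hence `resid` is what remains of the
equation. -/
theorem derPoly_four (s : DPoly) : derPoly s 4 = resid s + 1 := by
  have h1 : derPoly s 1 = s := by simp [derPoly, tder]
  have h2 : derPoly s 2 = tder 1 s + s * s := by
    rw [show derPoly s 2 = tder 1 (derPoly s 1) + derPoly s 1 * s from rfl, h1]
  have h3 : derPoly s 3 = tder 2 (derPoly s 2) + derPoly s 2 * s := rfl
  have h4 : derPoly s 4 = tder 3 (derPoly s 3) + derPoly s 3 * s := rfl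
  rw [h4, h3, tder_add, tder_mul 2 1, h2, tder_add 2, tder_mul 1 1, resid]
  simp only [tder_add]
  rw [tder_mul 2 1, tder_mul 1 2]
  ring

/-- The first step r₁ = s needs no derivative of s, so r_j costs only j - 1 further derivatives of
V. For s of order N, r₄ ends at order N + 3, exactly the regularity available. -/
theorem Graded.derPoly {M : ℕ} {s : DPoly} (hs : Graded M 0 s) (j : ℕ) :
    Graded (M + j - 1) 0 (derPoly s j) ∧ (j = 0 → Graded 0 0 (Biharmonic.derPoly s j)) := by
  have one : ∀ M, Graded M 0 (1 : DPoly) := fun M => by simpa using Graded.const (M := M) 1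
  induction j with
  | zero => exact ⟨one _, fun _ => one _⟩
  | succ j ih =>
    refine ⟨?_, by simp⟩
    rcases Nat.eq_zero_or_pos j with rfl | hj
    · have : Biharmonic.derPoly s 1 = s := by simp [Biharmonic.derPoly, Biharmonic.tder]
      rw [this]; exact hs.mono (by omega)
    · exact ((ih.1.tder j).mono' (by omega) (by omega)).add
        (ih.1.mul' hs (by omega) (by omega) (by omega))

/-- The WKB function `exp(∫ p s)`. -/
noncomputable def wkb (lam : ℂ) (E : ℕ → ℝ → ℂ) (s : DPoly) (x : ℝ) : ℂ :=
  Complex.exp (∫ y in (0 : ℝ)..x, pev lam E 1 s y)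

theorem hasDerivAt_integral_of_continuousOn {f : ℝ → ℂ} {a b x : ℝ} (h0 : (0 : ℝ) ∈ Ioo a b)
    (hf : ContinuousOn f (Ioo a b)) (hx : x ∈ Ioo a b) :
    HasDerivAt (fun y => ∫ t in (0 : ℝ)..y, f t) (f x) x := by
  refine intervalIntegral.integral_hasDerivAt_right ?_ ?_
    (hf.continuousAt (Ioo_mem_nhds hx.1 hx.2))
  · exact (hf.mono (ordConnected_Ioo.uIcc_subset h0 hx)).intervalIntegrable
  · exact hf.stronglyMeasurableAtFilter isOpen_Ioo x hx

theorem lipAt_of_hasDerivAt {f f' : ℝ → ℂ} {a b x : ℝ} (hx : x ∈ Ioo a b)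
    (hf : ∀ y ∈ Ioo a b, HasDerivAt f (f' y) y) (hc : ContinuousOn f' (Ioo a b)) : LipAt f x := by
  have hca : ContinuousAt f' x := hc.continuousAt (Ioo_mem_nhds hx.1 hx.2)
  have h1 : ∀ᶠ y in nhds x, ‖f' y‖ < ‖f' x‖ + 1 :=
    hca.norm.eventually (gt_mem_nhds (by linarith))
  obtain ⟨ε, hε, hsub⟩ := Metric.mem_nhds_iff.1 (inter_mem h1 (Ioo_mem_nhds hx.1 hx.2))
  refine ⟨‖f' x‖₊ + 1, Metric.ball x ε, Metric.ball_mem_nhds x hε, ?_⟩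
  refine (convex_ball x ε).lipschitzOnWith_of_nnnorm_hasDerivWithin_le (f' := f')
    (fun y hy => (hf y (hsub hy).2).hasDerivWithinAt) fun y hy => ?_
  have : ‖f' y‖ < ‖f' x‖ + 1 := (hsub hy).1
  exact_mod_cast this.le

/-- The derivatives of `ξ u`, where `U j` are the derivatives of `u`. -/
noncomputable def cutDer (ξ : ℕ → ℝ → ℝ) (U : ℕ → ℝ → ℂ) : ℕ → ℝ → ℂ
  | 0, x => ξ 0 x * U 0 x
  | 1, x => ξ 1 x * U 0 x + ξ 0 x * U 1 x
  | 2, x => ξ 2 x * U 0 x + 2 * ξ 1 x * U 1 x + ξ 0 x * U 2 x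
  | 3, x => ξ 3 x * U 0 x + 3 * ξ 2 x * U 1 x + 3 * ξ 1 x * U 2 x + ξ 0 x * U 3 x
  -- This is the case of index 4; larger indices play no role.
  | _, x => ξ 4 x * U 0 x + 4 * ξ 3 x * U 1 x + 6 * ξ 2 x * U 2 x + 4 * ξ 1 x * U 3 x
      + ξ 0 x * U 4 x

theorem cutDer_eq_zero {ξ : ℕ → ℝ → ℝ} {U : ℕ → ℝ → ℂ} {x : ℝ} (h : ∀ i, ξ i x = 0) (j : ℕ) :
    cutDer ξ U j x = 0 := by
  unfold cutDer
  split <;> simp [h]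

theorem hasDerivAt_cutDer {ξ : ℕ → ℝ → ℝ} {U : ℕ → ℝ → ℂ} {x : ℝ}
    (hξ : ∀ i, HasDerivAt (ξ i) (ξ (i + 1) x) x)
    (hU : ∀ i ≤ 3, HasDerivAt (U i) (U (i + 1) x) x) {j : ℕ} (hj : j ≤ 3) :
    HasDerivAt (cutDer ξ U j) (cutDer ξ U (j + 1) x) x := by
  have t : ∀ i k, k ≤ 3 → HasDerivAt (fun y => (ξ i y : ℂ) * U k y)
      ((ξ (i + 1) x : ℂ) * U k x + ξ i x * U (k + 1) x) x := fun i k hk =>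
    (hξ i).ofReal_comp.mul (hU k hk)
  interval_cases j
  · exact t 0 0 (by norm_num)
  · refine ((t 1 0 (by norm_num)).add (t 0 1 (by norm_num))).congr_deriv ?_
    simp only [cutDer]; ring
  · refine HasDerivAt.congr_deriv (((t 2 0 (by norm_num)).add
      ((t 1 1 (by norm_num)).const_mul 2)).add (t 0 2 (by norm_num)) |>.congr_of_eventuallyEq
      (Eventually.of_forall fun y => ?_)) ?_
    · simp only [cutDer, Pi.add_apply]; ring
    · simp only [cutDer]; ring
  · refine HasDerivAt.congr_deriv ((((t 3 0 (by norm_num)).add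
      ((t 2 1 (by norm_num)).const_mul 3)).add ((t 1 2 (by norm_num)).const_mul 3)).add
      (t 0 3 (by norm_num)) |>.congr_of_eventuallyEq (Eventually.of_forall fun y => ?_)) ?_
    · simp only [cutDer, Pi.add_apply]; ring
    · simp only [cutDer]; ring

theorem lipAt_cutDer {ξ : ℕ → ℝ → ℝ} {U : ℕ → ℝ → ℂ} {x : ℝ}
    (hξ : ∀ i, LipAt (fun y => (ξ i y : ℂ)) x) (hU : ∀ i ≤ 3, LipAt (U i) x) {j : ℕ}
    (hj : j ≤ 3) : LipAt (cutDer ξ U j) x := by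
  have t : ∀ (c : ℂ) i k, k ≤ 3 → LipAt (fun y => c * (ξ i y : ℂ) * U k y) x := fun c i k hk =>
    ((LipAt.const c x).mul (hξ i)).mul (hU k hk)
  have e : ∀ {f : ℝ → ℂ}, LipAt f x → (∀ y, cutDer ξ U j y = f y) → LipAt (cutDer ξ U j) x :=
    fun hf h => hf.congr (Eventually.of_forall h)
  interval_cases j
  · exact e (t 1 0 0 (by norm_num)) fun y => by simp only [cutDer]; ring
  · exact e ((t 1 1 0 (by norm_num)).add (t 1 0 1 (by norm_num))) fun y => by
      simp only [cutDer]; ring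
  · exact e (((t 1 2 0 (by norm_num)).add (t 2 1 1 (by norm_num))).add (t 1 0 2 (by norm_num)))
      fun y => by simp only [cutDer]; ring
  · exact e ((((t 1 3 0 (by norm_num)).add (t 3 2 1 (by norm_num))).add
      (t 3 1 2 (by norm_num))).add (t 1 0 3 (by norm_num))) fun y => by simp only [cutDer]; ring

theorem integral_iteratedDeriv_four {Ψ : ℕ → ℝ → ℂ} (h1 : ∀ j ≤ 3, ∀ x, LipAt (Ψ j) x)
    (h2 : ∀ j ≤ 3, ∀ᵐ x, HasDerivAt (Ψ j) (Ψ (j + 1) x) x) {φ : ℝ → ℝ} (hφ : IsTest φ) :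
    ∫ x, iteratedDeriv 4 φ x • Ψ 0 x = ∫ x, φ x • Ψ 4 x := by
  have e : iteratedDeriv 4 φ = deriv (deriv (deriv (deriv φ))) := by
    simp [iteratedDeriv_succ]
  rw [e, integral_deriv_smul (h1 0 (by norm_num)) (h2 0 (by norm_num)) hφ.deriv.deriv.deriv,
    integral_deriv_smul (h1 1 (by norm_num)) (h2 1 (by norm_num)) hφ.deriv.deriv,
    integral_deriv_smul (h1 2 (by norm_num)) (h2 2 (by norm_num)) hφ.deriv,
    integral_deriv_smul (h1 3 (by norm_num)) (h2 3 (by norm_num)) hφ, neg_neg, neg_neg]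

/-- The derivatives of the WKB function. -/
noncomputable def wkbDer (lam : ℂ) (E : ℕ → ℝ → ℂ) (s : DPoly) (j : ℕ) (x : ℝ) : ℂ :=
  pev lam E j (derPoly s j) x * wkb lam E s x

/-- The truncated WKB function is in the domain of the operator. -/
theorem distribEq_cutDer {N : ℕ} {lam : ℂ} {E : ℕ → ℝ → ℂ} {s : DPoly} (hs : Graded N 0 s)
    (hE1 : ∀ j < N + 3, ∀ x, LipAt (E j) x)
    (hE2 : ∀ j < N + 3, ∀ᵐ x, HasDerivAt (E j) (E (j + 1) x) x) {a b a' b' : ℝ}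
    (h0 : (0 : ℝ) ∈ Ioo a b) (ha : a < a') (hb : b' < b)
    (hslit : ∀ x ∈ Ioo a b, lam - E 0 x ∈ Complex.slitPlane) {ξ : ℕ → ℝ → ℝ}
    (hξ : ∀ i x, HasDerivAt (ξ i) (ξ (i + 1) x) x)
    (hξ0 : ∀ i, ∀ x ∉ Icc a' b', ξ i x = 0) :
    Continuous (cutDer ξ (wkbDer lam E s) 0) ∧
    HasCompactSupport (cutDer ξ (wkbDer lam E s) 0) ∧
    AEStronglyMeasurable (cutDer ξ (wkbDer lam E s) 4) volume ∧
    (∀ φ : ℝ → ℝ, IsTest φ → ∫ x, iteratedDeriv 4 φ x • cutDer ξ (wkbDer lam E s) 0 x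
      = ∫ x, φ x • cutDer ξ (wkbDer lam E s) 4 x) := by
  set U := wkbDer lam E s with hU
  have hsc : ContinuousOn (pev lam E 1 s) (Ioo a b) := fun x hx =>
    ((hs.lipAt_pev (n := N + 3) (by omega) 1 (hslit x hx)
      fun j hj => hE1 j hj x).continuousAt).continuousWithinAt
  have hwd : ∀ x ∈ Ioo a b, HasDerivAt (wkb lam E s) (wkb lam E s x * pev lam E 1 s x) x :=
    fun x hx => (hasDerivAt_integral_of_continuousOn h0 hsc hx).cexp
  have hwc : ContinuousOn (wkb lam E s) (Ioo a b) := fun x hx =>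
    (hwd x hx).continuousAt.continuousWithinAt
  have hwl : ∀ x ∈ Ioo a b, LipAt (wkb lam E s) x := fun x hx =>
    lipAt_of_hasDerivAt hx hwd (hwc.mul hsc)
  -- Derivatives of u up to the third involve `E i` only for i ≤ N + 2, and these are locally
  -- Lipschitz. The fourth contains `E (N + 3)`, so the last differentiation holds only almost
  -- everywhere.
  have hg : ∀ j ≤ 3, Graded (N + 2) 0 (derPoly s j) := fun j hj => by
    exact (hs.derPoly j).1.mono (by omega)
  have hUl : ∀ x ∈ Ioo a b, ∀ j ≤ 3, LipAt (U j) x := fun x hx j hj =>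
    ((hg j hj).lipAt_pev (n := N + 3) (by omega) j (hslit x hx) fun i hi => hE1 i hi x).mul
      (hwl x hx)
  have hall : ∀ᵐ x, ∀ j < N + 3, HasDerivAt (E j) (E (j + 1) x) x := by
    rw [ae_all_iff]; intro j
    by_cases hj : j < N + 3
    · filter_upwards [hE2 j hj] with x hx _ using hx
    · exact Eventually.of_forall fun x h => absurd h hj
  have hUd : ∀ᵐ x, x ∈ Ioo a b → ∀ j ≤ 3, HasDerivAt (U j) (U (j + 1) x) x := by
    filter_upwards [hall] with x hx hxm j hj
    have := ((hg j hj).hasDerivAt_pev (n := N + 3) (by omega) j (hslit x hxm) hx).mul (hwd x hxm)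
    refine this.congr_deriv ?_
    simp only [hU, wkbDer, pev, ev, derPoly, map_add, map_mul]
    ring
  -- Nothing is known about the WKB function outside (a, b); there the cut-off vanishes on a whole
  -- neighbourhood, because its support lies strictly inside.
  have hout : ∀ x, x ∉ Ioo a b → ∀ᶠ y in nhds x, ∀ i, ξ i y = 0 := fun x hx => by
    have hx' : x ∉ Icc a' b' := fun h => hx ⟨ha.trans_le h.1, h.2.trans_lt hb⟩
    filter_upwards [isClosed_Icc.isOpen_compl.mem_nhds hx'] with y hy i using hξ0 i y hy
  have hξl : ∀ i x, LipAt (fun y => (ξ i y : ℂ)) x := fun i x => by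
    have hcont : Continuous fun y => (ξ (i + 1) y : ℂ) :=
      Complex.continuous_ofReal.comp
        (continuous_iff_continuousAt.2 fun y => (hξ (i + 1) y).continuousAt)
    exact lipAt_of_hasDerivAt (a := x - 1) (b := x + 1) ⟨by linarith, by linarith⟩
      (fun y _ => (hξ i y).ofReal_comp) hcont.continuousOn
  have hzero : ∀ x, x ∉ Ioo a b → ∀ j, cutDer ξ U j =ᶠ[nhds x] fun _ => 0 := fun x hx j => by
    filter_upwards [hout x hx] with y hy using cutDer_eq_zero hy j
  have L : ∀ j ≤ 3, ∀ x, LipAt (cutDer ξ U j) x := fun j hj x => by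
    by_cases hx : x ∈ Ioo a b
    · exact lipAt_cutDer (fun i => hξl i x) (hUl x hx) hj
    · exact (LipAt.const (0 : ℂ) x).congr (hzero x hx j)
  have A : ∀ j ≤ 3, ∀ᵐ x, HasDerivAt (cutDer ξ U j) (cutDer ξ U (j + 1) x) x := fun j hj => by
    filter_upwards [hUd] with x hx
    by_cases hxm : x ∈ Ioo a b
    · exact hasDerivAt_cutDer (fun i => hξ i x) (hx hxm) hj
    · rw [(hzero x hxm (j + 1)).self_of_nhds]
      exact (hasDerivAt_const x (0 : ℂ)).congr_of_eventuallyEq (hzero x hxm j)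
  refine ⟨continuous_iff_continuousAt.2 fun x => (L 0 (by norm_num) x).continuousAt,
    HasCompactSupport.intro (isCompact_Icc (a := a') (b := b')) fun x hx =>
      cutDer_eq_zero (fun i => hξ0 i x hx) 0, ?_, fun φ hφ => integral_iteratedDeriv_four L A hφ⟩
  -- The fourth derivative agrees almost everywhere with the derivative of an everywhere defined
  -- function, and such a derivative is measurable.
  refine (stronglyMeasurable_deriv (cutDer ξ U 3)).aestronglyMeasurable.congr ?_
  filter_upwards [A 3 le_rfl] with x hx using hx.deriv

/-! ### Geometry of the cut-off at one end of the line -/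

/-- The bounds on `[R, δ(α)]` used in the construction. -/
def CutoffBounds (v : ℝ → ℂ) (τ δ : ℝ → ℝ) (R c κ K : ℝ) : Prop :=
  ∀ θ > 0, ∀ᶠ α in atTop,
    (∀ x ∈ Icc R (δ α), |(v x).re| ≤ θ * α ∧ ‖v x‖ ≤ K * α ∧ τ x ≤ α ^ (1 / 4 : ℝ) ∧
      -- With θ small, the correction τ|v|/α to Re(p s) stays below the leading term, of size
      -- α^{-3/4} (1 + |Im v|).
      ‖v x‖ * τ x ≤ θ * α ^ (1 / 4 : ℝ) * (1 + |(v x).im|)) ∧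
    ∃ w : ℝ, α⁻¹ ≤ w ∧ w ≤ α ∧ R ≤ δ α - 2 * w ∧
      -- Multiplied by the factor α^{-3/4} in Im p, this gives a phase of order at least α^κ across
      -- the window.
      ∀ x ∈ Icc (δ α - 2 * w) (δ α - w), c * α ^ (3 / 4 + κ) ≤ w * (1 + |(v x).im|)

/-- The radius `δ(α)` satisfies the bounds with some constants, for all large `R`. -/
def CutoffGood (v : ℝ → ℂ) (τ δ : ℝ → ℝ) : Prop :=
  -- The constants do not depend on R, and every larger R is admitted, so that both ends can share
  -- one R.
  ∃ R₀ c κ K : ℝ, 0 < c ∧ 0 < κ ∧ 0 ≤ K ∧ ∀ R ≥ R₀, CutoffBounds v τ δ R c κ K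

theorem eventually_mul_rpow_le (K : ℝ) {r s θ : ℝ} (h : r < s) (hθ : 0 < θ) :
    ∀ᶠ α : ℝ in atTop, K * α ^ r ≤ θ * α ^ s := by
  have h1 : Tendsto (fun α : ℝ => α ^ (s - r)) atTop atTop := tendsto_rpow_atTop (by linarith)
  filter_upwards [h1.eventually_ge_atTop (K / θ), eventually_gt_atTop 0] with α h2 h3
  have h4 : α ^ s = α ^ (s - r) * α ^ r := by rw [← Real.rpow_add h3]; ring_nf
  rw [h4, ← mul_assoc]
  refine mul_le_mul_of_nonneg_right ?_ (Real.rpow_nonneg h3.le _)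
  rw [div_le_iff₀ hθ] at h2
  linarith

theorem eventually_le_mul_rpow (K : ℝ) {s θ : ℝ} (h : 0 < s) (hθ : 0 < θ) :
    ∀ᶠ α : ℝ in atTop, K ≤ θ * α ^ s := by
  simpa using eventually_mul_rpow_le K h hθ

theorem eventually_mul_rpow_le_self (K : ℝ) {r θ : ℝ} (h : r < 1) (hθ : 0 < θ) :
    ∀ᶠ α : ℝ in atTop, K * α ^ r ≤ θ * α := by
  simpa using eventually_mul_rpow_le K h hθ

/-- With q = 3/(4 - 3ε), the inequality q > 3/4 makes the window α^q/4 long enough even where |Im v|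
is small, and q(1/3 - ε) < 1/4 keeps τ below α^{1/4} up to α^q. These two requirements dictate the
exponent. -/
theorem cutoffGood_of_bounded {v : ℝ → ℂ} {τ : ℝ → ℝ} {ε C R₁ : ℝ} (hε : 0 < ε) (hε1 : ε < 1 / 3)
    (hC : 0 ≤ C) (hR₁ : 1 ≤ R₁) (hτ : ∀ x ≥ 0, 0 < τ x)
    (hv : ∀ x ≥ R₁, ‖v x‖ ≤ C) (hτb : ∀ x ≥ R₁, τ x ≤ C * x ^ (1 / 3 - ε)) :
    CutoffGood v τ fun α => α ^ (3 / (4 - 3 * ε)) := by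
  set q := 3 / (4 - 3 * ε) with hq
  have hden : 0 < 4 - 3 * ε := by linarith
  have hq1 : q < 1 := by rw [hq, div_lt_one hden]; linarith
  have hq2 : 3 / 4 < q := by rw [hq, div_lt_div_iff₀ (by norm_num) hden]; linarith
  have hr : q * (1 / 3 - ε) < 1 / 4 := by
    rw [hq, div_mul_eq_mul_div, div_lt_div_iff₀ hden (by norm_num)]; linarith
  refine ⟨R₁, 1 / 4, q - 3 / 4, 1, by norm_num, by linarith, by norm_num, fun R hR θ hθ => ?_⟩
  filter_upwards [eventually_ge_atTop (4 : ℝ), eventually_ge_atTop C, eventually_le_mul_rpow C (s := 1) one_pos hθ,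
    eventually_mul_rpow_le C hr one_pos, eventually_mul_rpow_le (C * C) hr hθ,
    eventually_le_mul_rpow R (by linarith : 0 < q) (by norm_num : (0 : ℝ) < 1 / 2)]
    with α h4 hαC hα1 hα2 hα3 hα4
  have hα0 : 0 < α := by linarith
  have hτx : ∀ x ∈ Icc R (α ^ q), τ x ≤ C * α ^ (q * (1 / 3 - ε)) := fun x hx => by
    have hx0 : 0 ≤ x := by linarith [hx.1]
    refine (hτb x (hR.trans hx.1)).trans (mul_le_mul_of_nonneg_left ?_ hC)
    rw [Real.rpow_mul hα0.le]
    exact Real.rpow_le_rpow hx0 hx.2 (by linarith)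
  refine ⟨fun x hx => ⟨(Complex.abs_re_le_norm _).trans
      ((hv x (hR.trans hx.1)).trans (by simpa using hα1)),
    (hv x (hR.trans hx.1)).trans (by linarith), (hτx x hx).trans (by simpa using hα2), ?_⟩, α ^ q / 4, ?_, ?_, ?_, fun x hx => ?_⟩
  · have hx0 : 0 ≤ x := by linarith [hx.1]
    have h1 : ‖v x‖ * τ x ≤ C * (C * α ^ (q * (1 / 3 - ε))) :=
      mul_le_mul (hv x (hR.trans hx.1)) (hτx x hx) (hτ x hx0).le hC
    have h2 : 0 ≤ θ * α ^ (1 / 4 : ℝ) * |(v x).im| := by positivity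
    nlinarith
  · have : (1 : ℝ) ≤ α ^ q := Real.one_le_rpow (by linarith) (by linarith)
    have : α⁻¹ ≤ 4⁻¹ := inv_anti₀ (by norm_num) h4
    linarith
  · have : α ^ q ≤ α ^ (1 : ℝ) := Real.rpow_le_rpow_of_exponent_le (by linarith) hq1.le
    rw [Real.rpow_one] at this
    linarith
  · linarith
  · have h1 : 0 ≤ α ^ q / 4 * |(v x).im| := by positivity
    have h2 : 3 / 4 + (q - 3 / 4) = q := by ring
    rw [h2]
    linarith

/-- The facts about the first crossing of a level by a continuous unbounded function. -/
theorem isLeast_crossing {g : ℝ → ℝ} (hg : ContinuousOn g (Ici 0)) {m : ℝ} (h0 : g 0 < m)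
    (hex : ∃ x ≥ 0, m ≤ g x) :
    IsLeast {x | 0 < x ∧ g x = m} (sInf {x | 0 < x ∧ g x = m}) ∧
      ∀ x ∈ Icc 0 (sInf {x | 0 < x ∧ g x = m}), g x ≤ m := by
  set S := {x | 0 < x ∧ g x = m} with hS
  have ivt : ∀ x ≥ 0, m ≤ g x → ∃ y ∈ S, y ≤ x := fun x hx hm => by
    obtain ⟨y, hy, hym⟩ := intermediate_value_Icc hx (hg.mono Icc_subset_Ici_self) ⟨h0.le, hm⟩
    refine ⟨y, ⟨hy.1.lt_of_ne ?_, hym⟩, hy.2⟩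
    rintro rfl
    linarith
  obtain ⟨x, hx, hm⟩ := hex
  obtain ⟨y, hyS, -⟩ := ivt x hx hm
  -- As g 0 < m, admitting x = 0 adds no solution; hence S is closed and its infimum is attained.
  have hSe : S = Ici 0 ∩ g ⁻¹' {m} := by
    ext z
    refine ⟨fun h => ⟨h.1.le, h.2⟩, fun h => ⟨lt_of_le_of_ne h.1 ?_, h.2⟩⟩
    rintro rfl
    exact h0.ne h.2
  have hcl : IsClosed S := by
    rw [hSe]; exact hg.preimage_isClosed_of_isClosed isClosed_Ici isClosed_singleton
  have hbdd : BddBelow S := ⟨0, fun z hz => hz.1.le⟩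
  have hmem : sInf S ∈ S := hcl.csInf_mem ⟨y, hyS⟩ hbdd
  refine ⟨⟨hmem, fun z hz => csInf_le hbdd hz⟩, fun x hx => ?_⟩
  by_contra hlt
  obtain ⟨y, hyS, hyx⟩ := ivt x hx.1 (not_le.1 hlt).le
  have : x = sInf S := le_antisymm hx.2 ((csInf_le hbdd hyS).trans hyx)
  rw [this, hmem.2] at hlt
  exact hlt le_rfl

/-- Slow variation of the weight and of the imaginary part near the point `δ`. -/
theorem slow_variation {τ y g : ℝ → ℝ} {ν C R₁ δ w : ℝ} (hC : 1 ≤ C)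
    (hτ : ∀ x ≥ R₁, 0 < τ x)
    (hy : ∀ x ≥ R₁, y x ≠ 0) (hyd : ∀ x ≥ R₁, HasDerivAt y (g x) x)
    (hg : ∀ x ≥ R₁, |g x| ≤ C * (τ x * |y x|)) (hτd : ∀ x ≥ R₁, DifferentiableAt ℝ τ x)
    (h1 : ∀ x ≥ R₁, x ^ ν ≤ C * τ x) (h2 : ∀ x ≥ R₁, |deriv τ x| ≤ C * (x ^ ν * τ x))
    (hw : 2 * w = 1 / (4 * C ^ 2) / τ δ) (hR : R₁ ≤ δ - 2 * w) :
    ∀ x ∈ Icc (δ - 2 * w) δ, |y δ| / 2 ≤ |y x| := by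
  have hC2 : 1 ≤ C ^ 2 := one_le_pow₀ hC
  by_cases hne : δ - 2 * w ≤ δ
  swap
  · intro x hx; exact absurd (hx.1.trans hx.2) hne
  have hδ : R₁ ≤ δ := hR.trans hne
  have hτδ := hτ δ hδ
  have hwC : C ^ 2 * (2 * w) ≤ 1 / 2 / τ δ := by
    rw [hw, ← mul_div_assoc]
    refine div_le_div_of_nonneg_right ?_ hτδ.le
    rw [mul_one_div, div_le_div_iff₀ (by positivity) (by norm_num)]
    nlinarith
  have hin : ∀ x ∈ Icc (δ - 2 * w) δ, R₁ ≤ x := fun x hx => hR.trans hx.1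
  have hδm : δ ∈ Icc (δ - 2 * w) δ := ⟨hne, le_rfl⟩
  -- comparison of the weights
  have hτ2 : ∀ x ∈ Icc (δ - 2 * w) δ, τ x ≤ 2 * τ δ := fun x hx => by
    have hder : ∀ z ∈ Icc (δ - 2 * w) δ, HasDerivWithinAt (fun z => (τ z)⁻¹)
        (-deriv τ z / τ z ^ 2) (Icc (δ - 2 * w) δ) z := fun z hz =>
      ((hτd z (hin z hz)).hasDerivAt.inv (hτ z (hin z hz)).ne').hasDerivWithinAt
    -- 1/τ is Lipschitz with constant C²: `h2` bounds |τ'| by C x^ν τ, and `h1` turns x^ν into C τ.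
    -- The window is short enough for 1/τ to change by at most half of 1/τ(δ).
    have hbd : ∀ z ∈ Icc (δ - 2 * w) δ, ‖-deriv τ z / τ z ^ 2‖ ≤ C ^ 2 := fun z hz => by
      have hz' := hτ z (hin z hz)
      rw [Real.norm_eq_abs, abs_div, abs_neg, abs_of_pos (pow_pos hz' 2),
        div_le_iff₀ (pow_pos hz' 2)]
      refine (h2 z (hin z hz)).trans ?_
      have := mul_le_mul_of_nonneg_right (h1 z (hin z hz)) hz'.le
      nlinarith
    have h3 := (convex_Icc (δ - 2 * w) δ).norm_image_sub_le_of_norm_hasDerivWithin_le hder hbd hx hδm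
    rw [Real.norm_eq_abs, Real.norm_eq_abs, abs_of_nonneg (by linarith [hx.2] : 0 ≤ δ - x)] at h3
    have h4 : C ^ 2 * (δ - x) ≤ 1 / 2 / τ δ :=
      (mul_le_mul_of_nonneg_left (by linarith [hx.1]) (by positivity)).trans hwC
    have h5 := (abs_le.1 (h3.trans h4)).1
    have h6 : 1 / 2 / τ δ = (τ δ)⁻¹ / 2 := by rw [div_div, one_div, mul_inv]; ring
    rw [h6] at h5
    have hx' := hτ x (hin x hx)
    have h7 : (2 * τ δ)⁻¹ ≤ (τ x)⁻¹ := by rw [mul_inv]; linarith [(abs_le.1 (h3.trans h4)).2]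
    exact (inv_le_inv₀ (by positivity) hx').1 h7
  intro x hx
  -- The real logarithm of a negative number is that of its absolute value, so the sign of y is
  -- immaterial. The logarithmic derivative is at most 2 C τ(δ), and the total change at most 1/2 <
  -- log 2.
  have hder : ∀ z ∈ Icc (δ - 2 * w) δ, HasDerivWithinAt (fun z => Real.log (y z))
      (g z / y z) (Icc (δ - 2 * w) δ) z := fun z hz =>
    ((hyd z (hin z hz)).log (hy z (hin z hz))).hasDerivWithinAt
  have hbd : ∀ z ∈ Icc (δ - 2 * w) δ, ‖g z / y z‖ ≤ 2 * C * τ δ := fun z hz => by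
    have hz' : 0 < |y z| := abs_pos.2 (hy z (hin z hz))
    rw [Real.norm_eq_abs, abs_div, div_le_iff₀ hz']
    refine (hg z (hin z hz)).trans ?_
    rw [← mul_assoc]
    refine mul_le_mul_of_nonneg_right ?_ hz'.le
    nlinarith [hτ2 z hz]
  have h3 := (convex_Icc (δ - 2 * w) δ).norm_image_sub_le_of_norm_hasDerivWithin_le hder hbd hx hδm
  rw [Real.norm_eq_abs, Real.norm_eq_abs, abs_of_nonneg (by linarith [hx.2] : 0 ≤ δ - x)] at h3
  have h4 : 2 * C * τ δ * (δ - x) ≤ 1 / 2 := by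
    have : 2 * C * τ δ * (δ - x) ≤ 2 * C ^ 2 * τ δ * (2 * w) := by
      have e1 : δ - x ≤ 2 * w := by linarith [hx.1]
      have e0 : 0 ≤ δ - x := by linarith [hx.2]
      refine mul_le_mul ?_ e1 e0 (by positivity)
      have : C ≤ C ^ 2 := le_self_pow₀ hC (by norm_num)
      exact mul_le_mul_of_nonneg_right (by linarith) hτδ.le
    refine this.trans ?_
    rw [hw]
    have : 2 * C ^ 2 * τ δ * (1 / (4 * C ^ 2) / τ δ) = 1 / 2 := by field_simp; norm_num
    exact this.le
  have h5 := (abs_le.1 (h3.trans h4)).2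
  rw [← Real.log_abs (y δ), ← Real.log_abs (y x)] at h5
  have hyx : 0 < |y x| := abs_pos.2 (hy x (hin x hx))
  have hyδ : 0 < |y δ| := abs_pos.2 (hy δ hδ)
  have h6 : Real.log (|y δ| / 2) ≤ Real.log |y x| := by
    rw [Real.log_div hyδ.ne' (by norm_num)]
    have := Real.log_two_gt_d9
    linarith
  exact (Real.log_le_log_iff (by positivity) hyx).1 h6

theorem rpow_le_of_rpow_le {a B p : ℝ} (ha : 0 ≤ a) (hp : 0 < p) (h : a ^ p ≤ B) :
    a ≤ B ^ (1 / p) := by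
  have := Real.rpow_le_rpow (Real.rpow_nonneg ha p) h (by positivity : 0 ≤ 1 / p)
  rwa [← Real.rpow_mul ha, mul_one_div_cancel hp.ne', Real.rpow_one] at this

/-- The bounds below the crossing. -/
theorem bounds_below_crossing {ε C α t ρ y : ℝ} (hε : 0 < ε) (hC : 1 ≤ C) (hα : 1 ≤ α)
    (ht : 0 < t) (hρ : 0 ≤ ρ) (hy : 0 ≤ y)
    (h3 : t ^ 4 * (t ^ (12 + 4 * ε) + ρ ^ (3 + ε)) ≤ C * y ^ 4)
    (hc : y ≤ t * α ^ ((3 + ε) / (4 + ε))) :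
    t ≤ C * α ^ (1 / (4 + ε)) ∧ y ≤ C * α ∧ ρ ≤ C * α ^ (4 / (4 + ε)) ∧
      ρ * t ≤ C * α ^ (1 / (4 + ε)) + C * C * α ^ (max 0 (1 - ε) / (4 + ε)) * y := by
  have hα0 : 0 < α := by linarith
  have hC0 : 0 < C := by linarith
  have h4e : 0 < 4 + ε := by linarith
  have hCle : ∀ p : ℝ, 0 ≤ p → p ≤ 1 → C ^ p ≤ C := fun p _ hp => by
    simpa using Real.rpow_le_rpow_of_exponent_le hC hp
  -- Inserting y ≤ t α^{(3+ε)/(4+ε)} into `h3`, the factor t⁴ cancels. Each summand on the left is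
  -- then bounded by a power of α, and taking roots gives the bounds on t and ρ.
  have hsum : t ^ (12 + 4 * ε) + ρ ^ (3 + ε) ≤ C * α ^ (4 * ((3 + ε) / (4 + ε))) := by
    have e1 : y ^ 4 ≤ t ^ 4 * α ^ (4 * ((3 + ε) / (4 + ε))) := by
      refine (pow_le_pow_left₀ hy hc 4).trans (le_of_eq ?_)
      rw [mul_pow, mul_comm (4 : ℝ), Real.rpow_mul hα0.le]
      congr 1
      norm_cast
    have e2 := h3.trans (mul_le_mul_of_nonneg_left e1 hC0.le)
    have e3 : 0 < t ^ 4 := by positivity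
    refine le_of_mul_le_mul_left ?_ e3
    linarith
  have ht1 : t ≤ C * α ^ (1 / (4 + ε)) := by
    have e0 : 0 ≤ ρ ^ (3 + ε) := Real.rpow_nonneg hρ _
    have := rpow_le_of_rpow_le ht.le (by linarith : 0 < 12 + 4 * ε)
      ((by linarith : t ^ (12 + 4 * ε) ≤ C * α ^ (4 * ((3 + ε) / (4 + ε)))))
    rw [Real.mul_rpow hC0.le (by positivity), ← Real.rpow_mul hα0.le] at this
    have e1 : 4 * ((3 + ε) / (4 + ε)) * (1 / (12 + 4 * ε)) = 1 / (4 + ε) := by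
      field_simp
      ring
    rw [e1] at this
    refine this.trans (mul_le_mul_of_nonneg_right (hCle _ (by positivity) ?_) (by positivity))
    rw [div_le_one (by linarith)]; linarith
  have hρ1 : ρ ≤ C * α ^ (4 / (4 + ε)) := by
    have e0 : 0 ≤ t ^ (12 + 4 * ε) := Real.rpow_nonneg ht.le _
    have := rpow_le_of_rpow_le hρ (by linarith : 0 < 3 + ε)
      ((by linarith : ρ ^ (3 + ε) ≤ C * α ^ (4 * ((3 + ε) / (4 + ε)))))
    rw [Real.mul_rpow hC0.le (by positivity), ← Real.rpow_mul hα0.le] at this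
    have e1 : 4 * ((3 + ε) / (4 + ε)) * (1 / (3 + ε)) = 4 / (4 + ε) := by
      field_simp
    rw [e1] at this
    refine this.trans (mul_le_mul_of_nonneg_right (hCle _ (by positivity) ?_) (by positivity))
    rw [div_le_one (by linarith)]; linarith
  refine ⟨ht1, ?_, hρ1, ?_⟩
  · refine hc.trans ?_
    refine (mul_le_mul_of_nonneg_right ht1 (by positivity)).trans (le_of_eq ?_)
    rw [mul_assoc, ← Real.rpow_add hα0]
    have : 1 / (4 + ε) + (3 + ε) / (4 + ε) = 1 := by field_simp; ring
    rw [this, Real.rpow_one]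
  · have hnn : 0 ≤ C * C * α ^ (max 0 (1 - ε) / (4 + ε)) * y := by positivity
    rcases le_or_gt ρ 1 with h | h
    · nlinarith
    have hρ0 : 0 < ρ := by linarith
    -- The fourth root of `h3` without its first summand.
    have hmain : ρ ^ ((3 + ε) / 4) * t ≤ C * y := by
      have e0 : 0 ≤ t ^ 4 * t ^ (12 + 4 * ε) := by positivity
      have e1 : (ρ ^ ((3 + ε) / 4) * t) ^ 4 ≤ (C * y) ^ 4 := by
        have e2 : (ρ ^ ((3 + ε) / 4) * t) ^ 4 = t ^ 4 * ρ ^ (3 + ε) := by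
          rw [mul_pow, ← Real.rpow_natCast (ρ ^ ((3 + ε) / 4)), ← Real.rpow_mul hρ]
          rw [mul_comm]; congr 2; push_cast; ring
        rw [e2, mul_pow]
        have e3 : C * y ^ 4 ≤ C ^ 4 * y ^ 4 :=
          mul_le_mul_of_nonneg_right (le_self_pow₀ hC (by norm_num)) (by positivity)
        linarith
      exact le_of_pow_le_pow_left₀ (by norm_num) (by positivity) e1
    have hρs : ρ ≤ ρ ^ ((3 + ε) / 4) * (C * α ^ (max 0 (1 - ε) / (4 + ε))) := by
      -- The missing power of ρ is (1 - ε)/4, to be paid for by the bound on ρ. For ε > 1 nothing is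
      -- missing because ρ > 1; hence the maximum with 0.
      have e1 : ρ ≤ ρ ^ ((3 + ε) / 4) * ρ ^ (max 0 (1 - ε) / 4) := by
        rw [← Real.rpow_add hρ0]
        nth_rewrite 1 [← Real.rpow_one ρ]
        refine Real.rpow_le_rpow_of_exponent_le h.le ?_
        have := le_max_right 0 (1 - ε)
        linarith
      refine e1.trans (mul_le_mul_of_nonneg_left ?_ (by positivity))
      have hm0 : 0 ≤ max 0 (1 - ε) := le_max_left _ _
      have hm1 : max 0 (1 - ε) ≤ 1 := max_le (by norm_num) (by linarith)
      refine (Real.rpow_le_rpow hρ hρ1 (by positivity)).trans ?_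
      rw [Real.mul_rpow hC0.le (by positivity), ← Real.rpow_mul hα0.le]
      have e2 : 4 / (4 + ε) * (max 0 (1 - ε) / 4) = max 0 (1 - ε) / (4 + ε) := by
        field_simp
      rw [e2]
      exact mul_le_mul_of_nonneg_right (hCle _ (by positivity) (by linarith)) (by positivity)
    calc ρ * t ≤ ρ ^ ((3 + ε) / 4) * (C * α ^ (max 0 (1 - ε) / (4 + ε))) * t :=
          mul_le_mul_of_nonneg_right hρs ht.le
      _ = C * α ^ (max 0 (1 - ε) / (4 + ε)) * (ρ ^ ((3 + ε) / 4) * t) := by ring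
      _ ≤ C * α ^ (max 0 (1 - ε) / (4 + ε)) * (C * y) :=
          mul_le_mul_of_nonneg_left hmain (by positivity)
      _ = C * C * α ^ (max 0 (1 - ε) / (4 + ε)) * y := by ring
      _ ≤ _ := by linarith [show 0 ≤ C * α ^ (1 / (4 + ε)) by positivity]

/-- Up to the first crossing |Im v| ≤ τ α^q, and `bounds_below_crossing` converts this into the
required pointwise bounds. At the crossing |Im v|/τ = α^q with q > 3/4; since |Im v| remains
comparable on a window of width about 1/τ(δ), its product with the width is of order α^q. -/
theorem cutoffGood_of_unbounded {v : ℝ → ℂ} {τ g : ℝ → ℝ} {ε b ν C R₁ : ℝ} (hv : Continuous v)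
    (hτc : ContinuousOn τ (Ici 0)) (hτ : ∀ x ≥ 0, 0 < τ x) (hε : 0 < ε) (hb : 0 < b)
    (hC : 1 ≤ C) (hR₁ : 1 ≤ R₁) (hν : -1 ≤ ν) (hyb : ∀ x ≥ R₁, b ≤ |(v x).im|)
    (hyd : ∀ x ≥ R₁, HasDerivAt (fun z => (v z).im) (g x) x)
    (hg : ∀ x ≥ R₁, |g x| ≤ C * (τ x * |(v x).im|)) (hτd : ∀ x ≥ R₁, DifferentiableAt ℝ τ x)
    (h1 : ∀ x ≥ R₁, x ^ ν ≤ C * τ x) (h2 : ∀ x ≥ R₁, |deriv τ x| ≤ C * (x ^ ν * τ x))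
    (h3 : ∀ x ≥ R₁, τ x ^ 4 * (τ x ^ (12 + 4 * ε) + |(v x).re| ^ (3 + ε)) ≤ C * |(v x).im| ^ 4)
    (hunb : ∀ M, ∃ x ≥ R₁, M < ‖v x‖) :
    (∀ᶠ α : ℝ in atTop,
      IsLeast {x | 0 < x ∧ |(v x).im| / τ x = α ^ ((3 + ε) / (4 + ε))}
        (sInf {x | 0 < x ∧ |(v x).im| / τ x = α ^ ((3 + ε) / (4 + ε))})) ∧
    CutoffGood v τ fun α => sInf {x | 0 < x ∧ |(v x).im| / τ x = α ^ ((3 + ε) / (4 + ε))} := by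
  set q := (3 + ε) / (4 + ε) with hq
  have h4e : 0 < 4 + ε := by linarith
  have hq1 : q < 1 := by rw [hq, div_lt_one h4e]; linarith
  have hq2 : 3 / 4 < q := by rw [hq, div_lt_div_iff₀ (by norm_num) h4e]; linarith
  have hC0 : 0 < C := by linarith
  set f : ℝ → ℝ := fun x => |(v x).im| / τ x with hf
  have hfc : ContinuousOn f (Ici 0) :=
    ContinuousOn.div (by fun_prop) hτc fun x hx => (hτ x hx).ne'
  have hqtop : Tendsto (fun α : ℝ => α ^ q) atTop atTop := tendsto_rpow_atTop (by linarith)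
  -- If |Im v|/τ stayed below a level M' = α^q, the bounds below the crossing would hold everywhere
  -- beyond R₁ with this fixed α, and v would be bounded.
  have hfunb : ∀ M : ℝ, ∃ x ≥ 0, M ≤ f x := by
    intro M
    by_contra hcon
    push Not at hcon
    set M' := max M 1 with hM'
    have hM1 : 1 ≤ M' := le_max_right _ _
    set α := M' ^ (1 / q) with hα
    have hα1 : 1 ≤ α := Real.one_le_rpow hM1 (by positivity)
    have hαq : α ^ q = M' := by
      rw [hα, ← Real.rpow_mul (by linarith), one_div_mul_cancel (by linarith), Real.rpow_one]
    obtain ⟨x, hx, hxM⟩ := hunb (C * α ^ (4 / (4 + ε)) + C * α)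
    have hx0 : x ≥ 0 := by linarith
    have hlt := (hcon x hx0).le.trans (le_max_left M 1)
    rw [← hM', ← hαq, div_le_iff₀ (hτ x hx0), mul_comm] at hlt
    obtain ⟨-, e1, e2, -⟩ := bounds_below_crossing hε hC hα1 (hτ x hx0) (abs_nonneg _)
      (abs_nonneg _) (h3 x hx) hlt
    have := Complex.norm_le_abs_re_add_abs_im (v x)
    linarith
  have hcross : ∀ᶠ α : ℝ in atTop, IsLeast {x | 0 < x ∧ f x = α ^ q}
      (sInf {x | 0 < x ∧ f x = α ^ q}) ∧
      ∀ x ∈ Icc 0 (sInf {x | 0 < x ∧ f x = α ^ q}), f x ≤ α ^ q := by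
    filter_upwards [hqtop.eventually_gt_atTop (f 0)] with α h0
    exact isLeast_crossing hfc h0 (hfunb _)
  -- f is bounded on [0, R], so no crossing of a higher level can occur there.
  have hlarge : ∀ R : ℝ, ∀ᶠ α : ℝ in atTop, R < sInf {x | 0 < x ∧ f x = α ^ q} := by
    intro R
    obtain ⟨M, hM⟩ := (isCompact_Icc (a := (0 : ℝ)) (b := R)).bddAbove_image
      (hfc.mono Icc_subset_Ici_self)
    filter_upwards [hcross, hqtop.eventually_gt_atTop M] with α hα hMα
    by_contra hle
    have hmem := hα.1.1
    have := hM (mem_image_of_mem f ⟨hmem.1.le, not_lt.1 hle⟩)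
    rw [hmem.2] at this
    linarith
  refine ⟨hcross.mono fun α h => h.1, R₁, 1 / (4 * C ^ 2) / 4, q - 3 / 4, 2 * C, by positivity,
    by linarith, by positivity, fun R hR θ hθ => ?_⟩
  have hp1 : 1 / (4 + ε) < 1 / 4 := one_div_lt_one_div_of_lt (by norm_num) (by linarith)
  have hp4 : 4 / (4 + ε) < 1 := by rw [div_lt_one h4e]; linarith
  have hpm : max 0 (1 - ε) / (4 + ε) < 1 / 4 := by
    rw [div_lt_iff₀ h4e]
    exact max_lt (by linarith) (by linarith)
  filter_upwards [hcross, hlarge (2 * R), eventually_ge_atTop (1 : ℝ),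
    eventually_mul_rpow_le_self C hp4 hθ,
    eventually_mul_rpow_le_self C hp4 hC0, eventually_mul_rpow_le C hp1 one_pos,
    eventually_mul_rpow_le (C + C) hp1 hθ,
    eventually_mul_rpow_le (2 * (C * C)) hpm hθ,
    eventually_mul_rpow_le_self (1 / (4 * C ^ 2) / 2 / b) hq1 one_pos,
    eventually_mul_rpow_le_self (2 * (4 * C ^ 2) * C) (hp1.trans (by norm_num)) one_pos]
    with α hα hδR hα1 hαv hαC hατ hατ2 hατ3 hαw hαw2
  obtain ⟨hleast, hbelow⟩ := hα
  set δ := sInf {x | 0 < x ∧ f x = α ^ q} with hδ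
  have hδ0 : 0 < δ := hleast.1.1
  have hδf : f δ = α ^ q := hleast.1.2
  have hτδ := hτ δ hδ0.le
  have hδR₁ : R₁ ≤ δ := by linarith
  have hbb : ∀ x ∈ Icc R δ, _ := fun x hx =>
    have hx0 : 0 ≤ x := by linarith [hx.1]
    bounds_below_crossing hε hC hα1 (hτ x hx0) (abs_nonneg _) (abs_nonneg _)
      (h3 x (hR.trans hx.1)) (by
        have := hbelow x ⟨hx0, hx.2⟩
        rw [hf] at this
        simp only at this
        rwa [div_le_iff₀ (hτ x hx0), mul_comm] at this)
  -- Here ν ≥ -1 enters: 1/δ ≤ δ^ν ≤ C τ(δ), so the window of total length (4C²)⁻¹/τ(δ) is at most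
  -- δ/2, whereas δ > 2R.
  have hwδ : R ≤ δ - 2 * (1 / (4 * C ^ 2) / τ δ / 2) := by
    have e0 : (1 : ℝ) / τ δ ≤ C * δ := by
      rw [div_le_iff₀ hτδ]
      have e1 := h1 δ hδR₁
      have e2 : δ ^ (-1 : ℝ) ≤ δ ^ ν := Real.rpow_le_rpow_of_exponent_le (by linarith) hν
      rw [Real.rpow_neg_one] at e2
      have e3 := mul_le_mul_of_nonneg_left (e2.trans e1) hδ0.le
      rw [mul_inv_cancel₀ hδ0.ne'] at e3
      linarith
    have e1 : 2 * (1 / (4 * C ^ 2) / τ δ / 2) = 1 / (4 * C ^ 2) * (1 / τ δ) := by ring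
    have e2 : 1 / (4 * C ^ 2) * (C * δ) ≤ δ / 2 := by
      have : 1 / (4 * C ^ 2) * (C * δ) = δ / (4 * C) := by field_simp
      rw [this]
      exact div_le_div_of_nonneg_left hδ0.le (by norm_num) (by linarith)
    have e3 : 1 / (4 * C ^ 2) * (1 / τ δ) ≤ 1 / (4 * C ^ 2) * (C * δ) :=
      mul_le_mul_of_nonneg_left e0 (by positivity)
    rw [e1]
    linarith
  refine ⟨fun x hx => ?_, 1 / (4 * C ^ 2) / τ δ / 2, ?_, ?_, ?_, fun x hx => ?_⟩
  · obtain ⟨e1, e2, e3, e4⟩ := hbb x hx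
    have hn := Complex.norm_le_abs_re_add_abs_im (v x)
    have hx0 : 0 ≤ x := by linarith [hx.1]
    refine ⟨e3.trans hαv, by linarith, e1.trans (by simpa using hατ), ?_⟩
    have hy := abs_nonneg (v x).im
    have g1 : ‖v x‖ * τ x ≤ |(v x).re| * τ x + τ x * |(v x).im| := by
      have := mul_le_mul_of_nonneg_right hn (hτ x hx0).le
      linarith
    have g2 : τ x * |(v x).im| ≤ C * α ^ (1 / (4 + ε)) * |(v x).im| :=
      mul_le_mul_of_nonneg_right e1 hy
    have g3 : (C + C) * α ^ (1 / (4 + ε)) * |(v x).im| ≤ θ * α ^ (1 / 4 : ℝ) * |(v x).im| :=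
      mul_le_mul_of_nonneg_right hατ2 hy
    have g4 : 2 * (C * C) * α ^ (max 0 (1 - ε) / (4 + ε)) * |(v x).im|
        ≤ θ * α ^ (1 / 4 : ℝ) * |(v x).im| :=
      mul_le_mul_of_nonneg_right hατ3 hy
    have g5 : 0 ≤ C * α ^ (1 / (4 + ε)) := by positivity
    nlinarith
  · have hτb := (hbb δ ⟨by linarith, le_rfl⟩).1
    have hτb' : 2 * (4 * C ^ 2) * τ δ ≤ α := by
      refine (mul_le_mul_of_nonneg_left hτb (by positivity)).trans ?_
      linarith
    have : 1 / (4 * C ^ 2) / τ δ / 2 = (2 * (4 * C ^ 2) * τ δ)⁻¹ := by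
      field_simp
    rw [this]
    exact inv_anti₀ (by positivity) hτb'
  · have hfb : b / τ δ ≤ α ^ q := by
      rw [← hδf]
      exact div_le_div_of_nonneg_right (hyb δ hδR₁) hτδ.le
    have e1 : 1 / (4 * C ^ 2) / τ δ / 2 = 1 / (4 * C ^ 2) / 2 / b * (b / τ δ) := by
      field_simp
    rw [e1]
    refine (mul_le_mul_of_nonneg_left hfb (by positivity)).trans ?_
    linarith
  · exact hwδ
  · have hv := slow_variation hC (fun x hx => hτ x (by linarith))
      (fun x hx h0 => by have := hyb x hx; rw [h0, abs_zero] at this; linarith) hyd hg hτd h1 h2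
      (w := 1 / (4 * C ^ 2) / τ δ / 2) (δ := δ) (by ring) (hR.trans hwδ) x
      ⟨hx.1, hx.2.trans (sub_le_self _ (by positivity))⟩
    have e1 : 3 / 4 + (q - 3 / 4) = q := by ring
    rw [e1, ← hδf]
    have e2 : 0 ≤ 1 / (4 * C ^ 2) / τ δ / 2 := by positivity
    have e3 := mul_le_mul_of_nonneg_left hv e2
    have e4 : 1 / (4 * C ^ 2) / 4 * f δ = 1 / (4 * C ^ 2) / τ δ / 2 * (|(v δ).im| / 2) := by
      simp only [hf]; ring
    rw [e4]
    linarith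

/-! ### Consequences of the assumption at one end -/

theorem exists_ae_of_eventually_inf {p : ℝ → Prop} (h : ∀ᶠ x in atTop ⊓ ae volume, p x) :
    ∃ R : ℝ, ∀ᵐ x, R ≤ x → p x := by
  obtain ⟨q, hq, r, hr, hqr⟩ := eventually_inf.1 h
  obtain ⟨R, hR⟩ := eventually_atTop.1 hq
  exact ⟨R, by filter_upwards [hr] with x hx hRx using hqr x ⟨hR x hRx, hx⟩⟩

theorem exists_bound_of_isBigO_inf {f : ℝ → ℂ} {g : ℝ → ℝ} (h : f =O[atTop ⊓ ae volume] g) :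
    ∃ R C : ℝ, ∀ᵐ x, R ≤ x → ‖f x‖ ≤ C * |g x| := by
  obtain ⟨C, hC⟩ := h.bound
  obtain ⟨R, hR⟩ := exists_ae_of_eventually_inf hC
  exact ⟨R, C, hR⟩

theorem exists_bound_of_isBigO {f g : ℝ → ℝ} (h : f =O[atTop] g) :
    ∃ C : ℝ, ∀ᶠ x in atTop, |f x| ≤ C * |g x| := h.bound

/-- The points of (R, ∞) violating the inequality form an open set; if it were nonempty, its measure
would be positive. -/
theorem le_of_ae_le_of_continuousOn {f g : ℝ → ℝ} {R : ℝ} (hf : ContinuousOn f (Ioi R))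
    (hg : ContinuousOn g (Ioi R)) (h : ∀ᵐ x, R ≤ x → f x ≤ g x) : ∀ x > R, f x ≤ g x := by
  intro x hx
  by_contra hlt
  have hopen : IsOpen (Ioi R ∩ (fun y => g y - f y) ⁻¹' Iio 0) :=
    (hg.sub hf).isOpen_inter_preimage isOpen_Ioi isOpen_Iio
  have hpos : 0 < volume (Ioi R ∩ (fun y => g y - f y) ⁻¹' Iio 0) :=
    hopen.measure_pos volume ⟨x, hx, by simpa using not_le.1 hlt⟩
  refine hpos.ne' ?_
  refine measure_mono_null (fun y hy => ?_) h
  have h2 : g y - f y < 0 := hy.2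
  exact fun hc => absurd (hc hy.1.le) (by linarith)

theorem EndAssumption.exists_deriv_bound {N : ℕ} {V : ℝ → ℂ} {D : ℕ → ℝ → ℂ} {τ : ℝ → ℝ} {ε : ℝ}
    (h : EndAssumption N V D τ ε atTop (Ici 0)) :
    ∃ R C : ℝ, 0 ≤ R ∧ 0 ≤ C ∧
      ∀ᵐ x, R ≤ x → ∀ j, 1 ≤ j → j ≤ N + 3 → ‖D j x‖ ≤ C * (τ x ^ j * ‖V x‖) := by
  have h1 : ∀ j, 1 ≤ j → j ≤ N + 3 → ∃ R C : ℝ,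
      ∀ᵐ x, R ≤ x → ‖D j x‖ ≤ C * |τ x ^ j * ‖V x‖| := fun j hj1 hj2 =>
    exists_bound_of_isBigO_inf (h.deriv_bound j hj1 hj2)
  choose! R C hRC using h1
  refine ⟨max 0 (∑ j ∈ Finset.range (N + 4), |R j|), ∑ j ∈ Finset.range (N + 4), |C j|,
    le_max_left _ _, Finset.sum_nonneg fun _ _ => abs_nonneg _, ?_⟩
  have h2 : ∀ᵐ x, ∀ j, 1 ≤ j → j ≤ N + 3 → R j ≤ x → ‖D j x‖ ≤ C j * |τ x ^ j * ‖V x‖| := by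
    rw [ae_all_iff]; intro j
    by_cases hj : 1 ≤ j ∧ j ≤ N + 3
    · filter_upwards [hRC j hj.1 hj.2] with x hx _ _ using hx
    · exact Eventually.of_forall fun x h1 h2 => absurd ⟨h1, h2⟩ hj
  filter_upwards [h2] with x hx hRx j hj1 hj2
  have hmem : j ∈ Finset.range (N + 4) := Finset.mem_range.2 (by omega)
  have e1 : |R j| ≤ ∑ j ∈ Finset.range (N + 4), |R j| :=
    Finset.single_le_sum (f := fun j => |R j|) (fun _ _ => abs_nonneg _) hmem
  have e2 : |C j| ≤ ∑ j ∈ Finset.range (N + 4), |C j| :=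
    Finset.single_le_sum (f := fun j => |C j|) (fun _ _ => abs_nonneg _) hmem
  have hx0 : 0 ≤ x := (le_max_left _ _).trans hRx
  have e3 : 0 ≤ τ x ^ j * ‖V x‖ := by
    have := h.weight_pos x hx0
    positivity
  have e4 := hx j hj1 hj2 ((le_abs_self _).trans (e1.trans ((le_max_right _ _).trans hRx)))
  rw [abs_of_nonneg e3] at e4
  exact e4.trans (mul_le_mul_of_nonneg_right ((le_abs_self _).trans e2) e3)

theorem EndAssumption.cutoffGood {N : ℕ} {V : ℝ → ℂ} {D : ℕ → ℝ → ℂ} {τ : ℝ → ℝ} {ε b : ℝ}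
    {V' : ℝ → ℂ} (h : EndAssumption N V D τ ε atTop (Ici 0)) (hV : Continuous V)
    (hV'c : Continuous V') (hV'D : V' =ᵐ[volume] D 1) (hVd : ∀ x, HasDerivAt V (V' x) x)
    (hb : 0 < b) (him : ∀ᶠ x in atTop, b ≤ |(V x).im|) :
    (¬ BoundedAtEnd atTop V → ∀ᶠ α : ℝ in atTop,
      IsLeast (crossingSet 1 V τ ε α) (cutoffRadius 1 atTop V τ ε α)) ∧
    CutoffGood V τ (cutoffRadius 1 atTop V τ ε) := by
  have hτ : ∀ x ≥ 0, 0 < τ x := fun x hx => h.weight_pos x hx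
  by_cases hB : BoundedAtEnd atTop V
  · refine ⟨fun h => absurd hB h, ?_⟩
    have hδ : cutoffRadius 1 atTop V τ ε = fun α => α ^ (3 / (4 - 3 * ε)) := by
      funext α; simp [cutoffRadius, hB]
    rw [hδ]
    obtain ⟨hε, hε1, hO⟩ := h.of_bounded hB
    obtain ⟨C₁, h1⟩ := hB
    obtain ⟨C₂, h2⟩ := exists_bound_of_isBigO hO
    obtain ⟨R, hR⟩ := eventually_atTop.1 (h1.and h2)
    refine cutoffGood_of_bounded (C := max 0 (max C₁ C₂)) (R₁ := max 1 R) hε hε1 (le_max_left _ _)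
      (le_max_left _ _) hτ (fun x hx => ?_) (fun x hx => ?_)
    · exact (hR x ((le_max_right _ _).trans hx)).1.trans
        ((le_max_left _ _).trans (le_max_right _ _))
    · have hx1 : 1 ≤ x := (le_max_left _ _).trans hx
      have hx2 := (hR x ((le_max_right _ _).trans hx)).2
      rw [abs_of_pos (hτ x (by linarith)), abs_of_nonneg (by linarith : 0 ≤ x),
        abs_of_nonneg (Real.rpow_nonneg (by linarith) _)] at hx2
      exact hx2.trans (mul_le_mul_of_nonneg_right
        ((le_max_right _ _).trans (le_max_right _ _)) (Real.rpow_nonneg (by linarith) _))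
  · have hcr : ∀ α, crossingSet 1 V τ ε α
        = {x | 0 < x ∧ |(V x).im| / τ x = α ^ ((3 + ε) / (4 + ε))} := fun α => by
      simp [crossingSet]
    have hδ : cutoffRadius 1 atTop V τ ε
        = fun α => sInf {x | 0 < x ∧ |(V x).im| / τ x = α ^ ((3 + ε) / (4 + ε))} := by
      funext α; simp [cutoffRadius, hB, hcr]
    simp only [hδ, hcr]
    obtain ⟨hε, hτd, ⟨ν, hν, hO1, hO2⟩, hO3, hO4⟩ := h.of_unbounded hB
    obtain ⟨C₁, h1⟩ := exists_bound_of_isBigO hO1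
    obtain ⟨C₂, h2⟩ := exists_bound_of_isBigO hO2
    obtain ⟨C₄, h4⟩ := exists_bound_of_isBigO hO4
    obtain ⟨C₃, hC₃⟩ := hO3.bound
    obtain ⟨R₃, h3⟩ := exists_ae_of_eventually_inf hC₃
    -- The argument along the line needs this bound at every point; the continuity of V' and τ
    -- upgrades the almost everywhere statement.
    have h3' : ∀ x > max 0 R₃, |(V' x).im| ≤ C₃ * ‖τ x * |(V x).im|‖ := by
      refine le_of_ae_le_of_continuousOn (by fun_prop) ?_ ?_
      · have : ContinuousOn τ (Ioi (max 0 R₃)) := h.continuousOn_weight.mono fun x hx =>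
          mem_Ici.2 ((le_max_left 0 R₃).trans_lt (mem_Ioi.1 hx)).le
        fun_prop
      · filter_upwards [h3, hV'D] with x hx hx' hxR
        rw [hx']
        exact hx ((le_max_right _ _).trans hxR)
    obtain ⟨R, hR⟩ := eventually_atTop.1 ((((hτd.and him).and h1).and h2).and h4)
    set C := max 1 (max (max C₁ C₂) (max C₃ C₄)) with hC
    have k1 : C₁ ≤ C := (le_max_left _ _).trans ((le_max_left _ _).trans (le_max_right _ _))
    have k2 : C₂ ≤ C := (le_max_right _ _).trans ((le_max_left _ _).trans (le_max_right _ _))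
    have k3 : C₃ ≤ C := (le_max_left _ _).trans ((le_max_right _ _).trans (le_max_right _ _))
    have k4 : C₄ ≤ C := (le_max_right _ _).trans ((le_max_right _ _).trans (le_max_right _ _))
    set R₁ := max 1 (max R (max 0 R₃ + 1)) with hR₁
    have r0 : ∀ x ≥ R₁, 1 ≤ x := fun x hx => (le_max_left _ _).trans hx
    have r1 : ∀ x ≥ R₁, R ≤ x := fun x hx =>
      ((le_max_left _ _).trans (le_max_right _ _)).trans hx
    have r2 : ∀ x ≥ R₁, max 0 R₃ < x := fun x hx => by
      have := ((le_max_right R (max 0 R₃ + 1)).trans (le_max_right 1 _)).trans hx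
      linarith
    have rτ : ∀ x ≥ R₁, 0 < τ x := fun x hx => hτ x (by linarith [r0 x hx])
    have := cutoffGood_of_unbounded (v := V) (τ := τ) (g := fun x => (V' x).im) (ε := ε) (b := b)
      (ν := ν) (C := C) (R₁ := R₁) hV h.continuousOn_weight hτ hε hb (le_max_left _ _)
      (le_max_left _ _) hν (fun x hx => (hR x (r1 x hx)).1.1.1.2)
      (fun x _ => by
        exact (Complex.imCLM.hasFDerivAt (x := V x)).comp_hasDerivAt x (hVd x))
      (fun x hx => by
        have h5 := h3' x (r2 x hx)
        have h6 : 0 ≤ τ x * |(V x).im| := mul_nonneg (rτ x hx).le (abs_nonneg _)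
        rw [Real.norm_of_nonneg h6] at h5
        exact h5.trans (mul_le_mul_of_nonneg_right k3 h6))
      (fun x hx => (hR x (r1 x hx)).1.1.1.1)
      (fun x hx => by
        have h5 := (hR x (r1 x hx)).1.1.2
        have hx0 : 0 ≤ x := by linarith [r0 x hx]
        rw [abs_of_nonneg hx0, abs_of_nonneg (Real.rpow_nonneg hx0 _),
          abs_of_pos (rτ x hx)] at h5
        exact h5.trans (mul_le_mul_of_nonneg_right k1 (rτ x hx).le))
      (fun x hx => by
        have h5 := (hR x (r1 x hx)).1.2
        have hx0 : 0 ≤ x := by linarith [r0 x hx]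
        have h6 : 0 ≤ x ^ ν * τ x := mul_nonneg (Real.rpow_nonneg hx0 _) (rτ x hx).le
        rw [abs_of_nonneg hx0, abs_of_nonneg h6] at h5
        exact h5.trans (mul_le_mul_of_nonneg_right k2 h6))
      (fun x hx => by
        have h5 := (hR x (r1 x hx)).2
        rw [abs_of_nonneg (by positivity : 0 ≤ |(V x).im| ^ 4)] at h5
        exact ((le_abs_self _).trans h5).trans (mul_le_mul_of_nonneg_right k4 (by positivity)))
      (fun M => by
        by_contra hcon
        push Not at hcon
        exact hB ⟨M, eventually_atTop.2 ⟨R₁, hcon⟩⟩)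
    exact ⟨fun _ => this.1, this.2⟩

/-! ### Reflection -/

theorem tendsto_neg_atTop_inf_ae :
    Tendsto (fun x : ℝ => -x) (atTop ⊓ ae volume) (atBot ⊓ ae volume) :=
  tendsto_inf.2 ⟨tendsto_neg_atTop_atBot.mono_left inf_le_left,
    ((Measure.measurePreserving_neg volume).quasiMeasurePreserving.tendsto_ae).mono_left
      inf_le_right⟩

theorem boundedAtEnd_neg {V : ℝ → ℂ} :
    BoundedAtEnd atTop (fun x => V (-x)) ↔ BoundedAtEnd atBot V := by
  refine exists_congr fun C => ⟨fun h => ?_, fun h => tendsto_neg_atTop_atBot.eventually h⟩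
  simpa using tendsto_neg_atBot_atTop.eventually h

theorem cutoffRadius_neg (V : ℝ → ℂ) (τ : ℝ → ℝ) (ε : ℝ) :
    cutoffRadius 1 atTop (fun x => V (-x)) (fun x => τ (-x)) ε = cutoffRadius (-1) atBot V τ ε := by
  funext α
  by_cases hB : BoundedAtEnd atBot V <;>
    simp [cutoffRadius, boundedAtEnd_neg, crossingSet, hB]

theorem crossingSet_neg (V : ℝ → ℂ) (τ : ℝ → ℝ) (ε α : ℝ) :
    crossingSet 1 (fun x => V (-x)) (fun x => τ (-x)) ε α = crossingSet (-1) V τ ε α := by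
  simp [crossingSet]

/-- Reduces the end -∞ to +∞ under x ↦ -x, which multiplies the derivative of order n by (-1)^n. -/
theorem EndAssumption.reflect {N : ℕ} {V : ℝ → ℂ} {D : ℕ → ℝ → ℂ} {τ : ℝ → ℝ} {ε : ℝ}
    (h : EndAssumption N V D τ ε atBot (Iic 0)) :
    EndAssumption N (fun x => V (-x)) (fun n x => (-1) ^ n * D n (-x)) (fun x => τ (-x)) ε atTop
      (Ici 0) where
  continuousOn_weight := h.continuousOn_weight.comp continuous_neg.continuousOn fun x hx => by
    simpa using hx
  weight_pos x hx := h.weight_pos (-x) (by simpa using hx)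
  deriv_bound n h1 h2 := by
    have := (h.deriv_bound n h1 h2).comp_tendsto tendsto_neg_atTop_inf_ae
    refine (Asymptotics.IsBigO.congr_left (f₂ := fun x => (-1) ^ n * D n (-x)) ?_ fun _ => rfl)
    rw [← Asymptotics.isBigO_norm_left] at this ⊢
    simpa [Function.comp_def] using this
  of_unbounded hB := by
    rw [boundedAtEnd_neg] at hB
    obtain ⟨hε, hd, ⟨ν, hν, h1, h2⟩, h3, h4⟩ := h.of_unbounded hB
    refine ⟨hε, ?_, ⟨ν, hν, ?_, ?_⟩, ?_, h4.comp_tendsto tendsto_neg_atTop_atBot⟩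
    · filter_upwards [tendsto_neg_atTop_atBot.eventually hd] with x hx
      exact hx.comp x differentiableAt_id.neg
    · have := h1.comp_tendsto tendsto_neg_atTop_atBot
      simpa [Function.comp_def] using this
    · have := h2.comp_tendsto tendsto_neg_atTop_atBot
      have e : deriv (fun x => τ (-x)) = fun x => -deriv τ (-x) := funext fun x =>
        deriv_comp_neg τ x
      rw [e]
      simpa [Function.comp_def] using this.neg_left
    · have := h3.comp_tendsto tendsto_neg_atTop_inf_ae
      simpa [Function.comp_def] using this
  of_bounded hB := by
    rw [boundedAtEnd_neg] at hB
    obtain ⟨h1, h2, h3⟩ := h.of_bounded hB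
    refine ⟨h1, h2, ?_⟩
    have := h3.comp_tendsto tendsto_neg_atTop_atBot
    simpa [Function.comp_def] using this

/-! ### Pointwise estimates of the WKB functions -/

theorem norm_wp {lam : ℂ} {V : ℝ → ℂ} {x : ℝ} :
    ‖wp lam V x‖ ^ 4 = ‖lam - V x‖ := by rw [← norm_pow, wp_pow_four]

theorem wp_norm_bounds {lam : ℂ} {V : ℝ → ℂ} {x α K : ℝ} (hα : 1 ≤ α) (hK : 1 ≤ K)
    (hre : α / 2 ≤ (lam - V x).re) (hn : ‖lam - V x‖ ≤ K * α) :
    α ^ (1 / 4 : ℝ) / 2 ≤ ‖wp lam V x‖ ∧ ‖wp lam V x‖ ≤ K * α ^ (1 / 4 : ℝ) := by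
  have hα0 : 0 ≤ α := by linarith
  have h4 : (α ^ (1 / 4 : ℝ)) ^ 4 = α := by
    rw [← Real.rpow_natCast, ← Real.rpow_mul hα0]; norm_num
  have hre' := hre.trans (Complex.re_le_norm _)
  constructor
  · refine le_of_pow_le_pow_left₀ (n := 4) (by norm_num) (norm_nonneg _) ?_
    rw [norm_wp, div_pow, h4]
    linarith
  · refine le_of_pow_le_pow_left₀ (n := 4) (by norm_num) (by positivity) ?_
    rw [norm_wp, mul_pow, h4]
    exact hn.trans (mul_le_mul_of_nonneg_right (le_self_pow₀ hK (by norm_num)) hα0)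

/-- The imaginary part of the fourth root is comparable with that of its argument. -/
theorem wp_im {lam : ℂ} {V : ℝ → ℂ} {x α K : ℝ} (hα : 1 ≤ α) (hK : 1 ≤ K)
    (hre : α / 2 ≤ (lam - V x).re) (hn : ‖lam - V x‖ ≤ K * α) :
    ∃ d : ℝ, α ^ (3 / 4 : ℝ) / 8 ≤ d ∧ d ≤ 4 * K ^ 3 * α ^ (3 / 4 : ℝ) ∧
      (wp lam V x).im * d = (lam - V x).im := by
  obtain ⟨hlo, hhi⟩ := wp_norm_bounds hα hK hre hn
  have hα0 : 0 ≤ α := by linarith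
  have hz0 : lam - V x ≠ 0 := fun h => by rw [h] at hre; simp at hre; linarith
  set z := lam - V x with hz
  set m := ‖wp lam V x‖ with hm
  have hm0 : 0 < m := lt_of_lt_of_le (by positivity) hlo
  set φ := z.arg / 4 with hφ
  have harg : |z.arg| < Real.pi / 2 :=
    Complex.abs_arg_lt_pi_div_two_iff.2 (Or.inl (by linarith))
  have hpexp : wp lam V x = Complex.exp (Complex.log z * 4⁻¹) := by
    rw [wp, Complex.cpow_def_of_ne_zero hz0]
  have hlre : (Complex.log z * 4⁻¹).re = Real.log ‖z‖ / 4 := by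
    have : (4⁻¹ : ℂ) = ((4⁻¹ : ℝ) : ℂ) := by push_cast; rfl
    rw [this, Complex.re_mul_ofReal, Complex.log_re]; ring
  have hlim : (Complex.log z * 4⁻¹).im = φ := by
    have : (4⁻¹ : ℂ) = ((4⁻¹ : ℝ) : ℂ) := by push_cast; rfl
    rw [this, Complex.im_mul_ofReal, Complex.log_im, hφ]; ring
  have hmexp : m = Real.exp (Real.log ‖z‖ / 4) := by
    rw [hm, hpexp, Complex.norm_exp, hlre]
  have hpre : (wp lam V x).re = m * Real.cos φ := by
    rw [hpexp, Complex.exp_re, hlre, hlim, ← hmexp]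
  have hpim : (wp lam V x).im = m * Real.sin φ := by
    rw [hpexp, Complex.exp_im, hlre, hlim, ← hmexp]
  have hφ1 : |φ| ≤ Real.pi / 8 := by
    rw [hφ, abs_div, abs_of_pos (by norm_num : (0 : ℝ) < 4)]
    linarith
  have hpi := Real.pi_pos
  have hcos1 : 1 / 2 ≤ Real.cos φ := by
    rw [← Real.cos_pi_div_three, ← Real.cos_abs φ]
    exact Real.cos_le_cos_of_nonneg_of_le_pi (abs_nonneg _) (by linarith) (by linarith)
  have hcos2 : 1 / 2 ≤ Real.cos (2 * φ) := by
    rw [← Real.cos_pi_div_three, ← Real.cos_abs (2 * φ), abs_mul]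
    refine Real.cos_le_cos_of_nonneg_of_le_pi (by positivity) (by linarith) ?_
    rw [abs_of_pos (by norm_num : (0 : ℝ) < 2)]
    linarith
  have hc1 := Real.cos_le_one φ
  have hc2 := Real.cos_le_one (2 * φ)
  have h34 : (α ^ (1 / 4 : ℝ)) ^ 3 = α ^ (3 / 4 : ℝ) := by
    rw [← Real.rpow_natCast, ← Real.rpow_mul hα0]; norm_num
  -- For p = m e^{iφ}, Im p⁴ = m⁴ sin 4φ = (m sin φ) · 4m³ cos φ cos 2φ. As |φ| ≤ π/8, both cosines
  -- are at least 1/2. Writing Im p · d = Im(λ - V) retains the sign.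
  refine ⟨4 * m ^ 3 * (Real.cos φ * Real.cos (2 * φ)), ?_, ?_, ?_⟩
  · have h1 : (α ^ (1 / 4 : ℝ) / 2) ^ 3 ≤ m ^ 3 := pow_le_pow_left₀ (by positivity) hlo 3
    rw [div_pow, h34] at h1
    have h2 : 1 / 4 ≤ Real.cos φ * Real.cos (2 * φ) := by nlinarith
    have h3 : 0 ≤ m ^ 3 := by positivity
    nlinarith
  · have h1 : m ^ 3 ≤ (K * α ^ (1 / 4 : ℝ)) ^ 3 := pow_le_pow_left₀ hm0.le hhi 3
    rw [mul_pow, h34] at h1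
    have h2 : Real.cos φ * Real.cos (2 * φ) ≤ 1 := by nlinarith
    have h3 : 0 ≤ m ^ 3 := by positivity
    nlinarith
  · have h1 : z.im = ((wp lam V x) ^ 4).im := by rw [wp_pow_four]
    have h2 : ((wp lam V x) ^ 4).im
        = 4 * (wp lam V x).re * (wp lam V x).im * ((wp lam V x).re ^ 2 - (wp lam V x).im ^ 2) := by
      simp only [pow_succ, pow_zero, one_mul, Complex.mul_im, Complex.mul_re]; ring
    rw [h1, h2, hpre, hpim, Real.cos_two_mul']
    ring

theorem eta_bound {lam : ℂ} {E : ℕ → ℝ → ℂ} {x α A K T W : ℝ} {j n : ℕ} (hα : 1 ≤ α)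
    (hK : 1 ≤ K) (hA : 0 ≤ A) (hT : 0 ≤ T) (hW : 0 ≤ W) (hj : j ≤ n)
    (hp : α ^ (1 / 4 : ℝ) / 2 ≤ ‖wp lam (E 0) x‖) (hE : ‖E j x‖ ≤ A * (T ^ j * W)) :
    ‖eta lam E j x‖ ≤ A * 2 ^ (4 + n) * K * ((T / α ^ (1 / 4 : ℝ)) ^ j * (W / (K * α))) := by
  have hα0 : 0 < α := by linarith
  set a := α ^ (1 / 4 : ℝ) with ha
  have ha0 : 0 < a := by positivity
  have ha4 : a ^ 4 = α := by
    rw [ha, ← Real.rpow_natCast, ← Real.rpow_mul hα0.le]; norm_num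
  have h1 : ‖(wp lam (E 0) x)⁻¹‖ ≤ 2 / a := by
    rw [norm_inv, ← inv_div]
    exact inv_anti₀ (by positivity) hp
  rw [eta, norm_mul, norm_pow]
  calc ‖E j x‖ * ‖(wp lam (E 0) x)⁻¹‖ ^ (4 + j) ≤ A * (T ^ j * W) * (2 / a) ^ (4 + j) :=
        mul_le_mul hE (pow_le_pow_left₀ (norm_nonneg _) h1 _) (by positivity) (by positivity)
    _ = A * 2 ^ (4 + j) * K * ((T / a) ^ j * (W / (K * α))) := by
        rw [← ha4, div_pow, div_pow, pow_add a]
        field_simp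
    _ ≤ A * 2 ^ (4 + n) * K * ((T / a) ^ j * (W / (K * α))) := by
        have : (2 : ℝ) ^ (4 + j) ≤ 2 ^ (4 + n) := pow_le_pow_right₀ (by norm_num) (by omega)
        gcongr

/-- The pointwise estimates of the WKB functions with constants independent of `λ` and `x`. -/
theorem exists_wkb_bound {N : ℕ} {s : DPoly} (hs : Graded N 0 s)
    (hs1 : Graded N 1 (s - MvPolynomial.C (-Complex.I)))
    (hr : Graded (N + 3) (N + 1) (resid s)) (A K : ℝ) (hA : 0 ≤ A) (hK : 1 ≤ K) :
    ∃ B : ℝ, 0 ≤ B ∧ ∀ (lam : ℂ) (E : ℕ → ℝ → ℂ) (x α T W : ℝ), 1 ≤ α →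
      α / 2 ≤ (lam - E 0 x).re → ‖lam - E 0 x‖ ≤ K * α → 0 ≤ T → T ≤ α ^ (1 / 4 : ℝ) →
      0 ≤ W → W ≤ K * α → (∀ j, 1 ≤ j → j ≤ N + 3 → ‖E j x‖ ≤ A * (T ^ j * W)) →
      |(pev lam E 1 s x).re - (wp lam (E 0) x).im| ≤ B * (T * W / α) ∧
      ‖pev lam E 4 (resid s) x‖ ≤ B * (α ^ (-((N : ℝ) + 1) / 4) * (T ^ (N + 1) * W)) ∧
      ∀ j ≤ 4, ‖pev lam E j (derPoly s j) x‖ ≤ B * α := by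
  set κ := A * 2 ^ (4 + (N + 3)) * K with hκ
  obtain ⟨B₁, hB₁, h1⟩ := hs1.bound κ
  obtain ⟨B₂, hB₂, h2⟩ := hr.bound κ
  have h3 : ∀ j, ∃ C : ℝ, j ≤ 4 → 0 ≤ C ∧ ∀ (η : ℕ → ℂ) (t w : ℝ), 0 ≤ t → t ≤ 1 → 0 ≤ w →
      w ≤ 1 → (∀ j, 1 ≤ j → j ≤ N + 3 → ‖η j‖ ≤ κ * (t ^ j * w)) →
      ‖MvPolynomial.eval η (derPoly s j)‖ ≤ C := fun j => by
    by_cases hj : j ≤ 4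
    · obtain ⟨C, hC, h⟩ := (((hs.derPoly j).1).mono (by omega : N + j - 1 ≤ N + 3)).bound κ
      exact ⟨C, fun _ => ⟨hC, fun η t w a b c d e => by simpa [gsize] using h η t w a b c d e⟩⟩
    · exact ⟨0, fun h => absurd h hj⟩
  choose B₃ h3 using h3
  set S := ∑ j ∈ Finset.range 5, |B₃ j| with hS
  have hS0 : 0 ≤ S := Finset.sum_nonneg fun _ _ => abs_nonneg _
  have hK0 : 0 ≤ K := by linarith
  refine ⟨K ^ 4 * (B₁ + B₂ + S), by positivity, ?_⟩
  intro lam E x α T W hα hre hn hT hT1 hW hW1 hE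
  have hα0 : 0 < α := by linarith
  obtain ⟨hlo, hhi⟩ := wp_norm_bounds (V := E 0) hα hK hre hn
  set a := α ^ (1 / 4 : ℝ) with ha
  have ha0 : 0 < a := by positivity
  have ha1 : 1 ≤ a := Real.one_le_rpow hα (by norm_num)
  have ha4 : a ^ 4 = α := by
    rw [ha, ← Real.rpow_natCast, ← Real.rpow_mul hα0.le]; norm_num
  -- t and w are the small parameters of `Graded.bound`; the factor K in w is there to ensure w ≤ 1.
  set t := T / a with ht
  set w := W / (K * α) with hw
  have ht0 : 0 ≤ t := by positivity
  have ht1 : t ≤ 1 := by rw [ht, div_le_one ha0]; exact hT1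
  have hw0 : 0 ≤ w := by positivity
  have hw1 : w ≤ 1 := by rw [hw, div_le_one (by positivity)]; exact hW1
  have hη : ∀ j, 1 ≤ j → j ≤ N + 3 → ‖eta lam E j x‖ ≤ κ * (t ^ j * w) := fun j hj1 hj2 =>
    eta_bound hα hK hA hT hW hj2 hlo (hE j hj1 hj2)
  have hK4 : 1 ≤ K ^ 4 := one_le_pow₀ hK
  have hKle : K ≤ K ^ 4 := le_self_pow₀ hK (by norm_num)
  have hwle : w ≤ W / α := by
    rw [hw]
    exact div_le_div_of_nonneg_left hW hα0 (by nlinarith)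
  refine ⟨?_, ?_, fun j hj => ?_⟩
  · have e1 := h1 (fun j => eta lam E j x) t w ht0 ht1 hw0 hw1
      fun j a b => hη j a (by omega)
    -- The leading term -i p has real part Im p; the remainder has weight at least one.
    have e2 : pev lam E 1 s x = wp lam (E 0) x * (-Complex.I)
        + wp lam (E 0) x * MvPolynomial.eval (fun j => eta lam E j x)
          (s - MvPolynomial.C (-Complex.I)) := by
      simp only [pev, ev, map_sub, MvPolynomial.eval_C]; ring
    have e3 : (pev lam E 1 s x).re - (wp lam (E 0) x).im
        = (wp lam (E 0) x * MvPolynomial.eval (fun j => eta lam E j x)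
          (s - MvPolynomial.C (-Complex.I))).re := by
      rw [e2, Complex.add_re]
      have : (wp lam (E 0) x * (-Complex.I)).re = (wp lam (E 0) x).im := by simp
      rw [this]; ring
    rw [e3]
    refine (Complex.abs_re_le_norm _).trans ?_
    rw [norm_mul]
    have e4 : gsize t w 1 = t * w := by simp [gsize]
    rw [e4] at e1
    calc _ ≤ (K * a) * (B₁ * (t * w)) := mul_le_mul hhi e1 (norm_nonneg _) (by positivity)
      _ = K * B₁ * (T * w) := by rw [ht]; field_simp
      _ ≤ K * B₁ * (T * (W / α)) := by gcongr
      _ = K * B₁ * (T * W / α) := by ring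
      _ ≤ _ := by
        refine mul_le_mul_of_nonneg_right ?_ (by positivity)
        exact mul_le_mul hKle (by linarith) hB₁ (by positivity)
  · have e1 := h2 (fun j => eta lam E j x) t w ht0 ht1 hw0 hw1 hη
    have e4 : gsize t w (N + 1) = t ^ (N + 1) * w := by simp [gsize]
    rw [e4] at e1
    have e5 : t ^ (N + 1) = α ^ (-((N : ℝ) + 1) / 4) * T ^ (N + 1) := by
      rw [ht, div_pow, ha, ← Real.rpow_natCast (α ^ (1 / 4 : ℝ)), ← Real.rpow_mul hα0.le,
        div_eq_mul_inv, ← Real.rpow_neg hα0.le, mul_comm]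
      congr 2
      push_cast; ring
    rw [pev, norm_mul, norm_pow, norm_wp]
    -- The bound K α on |p|⁴ cancels the denominator of w, leaving W itself.
    calc _ ≤ (K * α) * (B₂ * (t ^ (N + 1) * w)) := mul_le_mul hn e1 (norm_nonneg _) (by positivity)
      _ = B₂ * (α ^ (-((N : ℝ) + 1) / 4) * (T ^ (N + 1) * W)) := by
        rw [e5, hw]; field_simp
      _ ≤ _ := by
        refine mul_le_mul_of_nonneg_right ?_ (by positivity)
        have : 1 * B₂ ≤ K ^ 4 * (B₁ + B₂ + S) :=
          mul_le_mul hK4 (by linarith) hB₂ (by positivity)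
        linarith
  · have e1 := (h3 j hj).2 (fun j => eta lam E j x) t w ht0 ht1 hw0 hw1 hη
    have e2 : B₃ j ≤ S := (le_abs_self _).trans
      (Finset.single_le_sum (f := fun j => |B₃ j|) (fun _ _ => abs_nonneg _)
        (Finset.mem_range.2 (by omega)))
    rw [pev, norm_mul, norm_pow]
    have e3 : ‖wp lam (E 0) x‖ ^ j ≤ K ^ 4 * α := by
      calc _ ≤ (K * a) ^ j := pow_le_pow_left₀ (norm_nonneg _) hhi j
        _ ≤ (K * a) ^ 4 := pow_le_pow_right₀ (by nlinarith) hj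
        _ = K ^ 4 * α := by rw [mul_pow, ha4]
    calc _ ≤ (K ^ 4 * α) * S := mul_le_mul e3 (e1.trans e2) (norm_nonneg _) (by positivity)
      _ = K ^ 4 * S * α := by ring
      _ ≤ _ := by
        refine mul_le_mul_of_nonneg_right ?_ hα0.le
        exact mul_le_mul_of_nonneg_left (by linarith) (by positivity)

/-! ### Decay of the WKB functions -/

/-- Estimates of the primitive of a function which is negative outside a bounded interval. -/
theorem integral_decay {G : ℝ → ℝ} {A B R δ w : ℝ} (hR : 0 ≤ R) (hw : 0 < w)
    (hRδ : R ≤ δ - 2 * w) (hG : ∀ x ∈ Ico 0 δ, IntervalIntegrable G volume 0 x)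
    (h1 : ∀ᵐ x, x ∈ Icc 0 R → |G x| ≤ A) (h2 : ∀ᵐ x, x ∈ Icc R δ → G x ≤ 0)
    (h3 : ∀ᵐ x, x ∈ Icc (δ - 2 * w) (δ - w) → G x ≤ -B) (hA : 0 ≤ A) :
    (∀ x ∈ Icc 0 R, -(A * R) ≤ ∫ y in (0 : ℝ)..x, G y) ∧
    ∀ x ∈ Ico (δ - w) δ, ∫ y in (0 : ℝ)..x, G y ≤ A * R - B * w := by
  have hint : ∀ a b, 0 ≤ a → a ≤ b → b < δ → IntervalIntegrable G volume a b :=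
    fun a b ha hab hb => (hG a ⟨ha, hab.trans_lt hb⟩).symm.trans (hG b ⟨ha.trans hab, hb⟩)
  have hle : ∀ a b c, 0 ≤ a → a ≤ b → b < δ → (∀ᵐ x, x ∈ Icc a b → G x ≤ c) →
      ∫ y in a..b, G y ≤ c * (b - a) := fun a b c ha hab hb h => by
    have := intervalIntegral.integral_mono_ae_restrict hab (hint a b ha hab hb)
      (intervalIntegrable_const (c := c)) ((ae_restrict_iff' measurableSet_Icc).2 h)
    rw [intervalIntegral.integral_const, smul_eq_mul] at this
    linarith
  have hge : ∀ a b c, 0 ≤ a → a ≤ b → b < δ → (∀ᵐ x, x ∈ Icc a b → c ≤ G x) →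
      c * (b - a) ≤ ∫ y in a..b, G y := fun a b c ha hab hb h => by
    have := intervalIntegral.integral_mono_ae_restrict hab
      (intervalIntegrable_const (c := c)) (hint a b ha hab hb)
      ((ae_restrict_iff' measurableSet_Icc).2 h)
    rw [intervalIntegral.integral_const, smul_eq_mul] at this
    linarith
  refine ⟨fun x hx => ?_, fun x hx => ?_⟩
  · have := hge 0 x (-A) le_rfl hx.1 (by linarith [hx.2]) (by
      filter_upwards [h1] with y hy hyx
      exact (abs_le.1 (hy ⟨hyx.1, hyx.2.trans hx.2⟩)).1)
    nlinarith [hx.1, hx.2]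
  · have i1 := hle 0 R A le_rfl hR (by linarith) (by
      filter_upwards [h1] with y hy hyx
      exact (abs_le.1 (hy hyx)).2)
    have i2 := hle R (δ - 2 * w) 0 hR hRδ (by linarith) (by
      filter_upwards [h2] with y hy hyx
      exact hy ⟨hyx.1, by linarith [hyx.2]⟩)
    have i3 := hle (δ - 2 * w) (δ - w) (-B) (by linarith) (by linarith) (by linarith) h3
    have i4 := hle (δ - w) x 0 (by linarith) hx.1 hx.2 (by
      filter_upwards [h2] with y hy hyx
      exact hy ⟨by linarith [hyx.1], by linarith [hyx.2, hx.2]⟩)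
    have j1 := intervalIntegral.integral_add_adjacent_intervals
      (hint 0 R le_rfl hR (by linarith)) (hint R (δ - 2 * w) hR hRδ (by linarith))
    have j2 := intervalIntegral.integral_add_adjacent_intervals
      (hint 0 (δ - 2 * w) le_rfl (by linarith) (by linarith))
      (hint (δ - 2 * w) (δ - w) (by linarith) (by linarith) (by linarith))
    have j3 := intervalIntegral.integral_add_adjacent_intervals
      (hint 0 (δ - w) le_rfl (by linarith) (by linarith))
      (hint (δ - w) x (by linarith) hx.1 hx.2)
    have e : -B * (δ - w - (δ - 2 * w)) = -(B * w) := by ring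
    rw [e] at i3
    linarith

/-! ### The cut-off function -/

/-- A smooth function equal to `1` on `(-∞, 0]` and to `0` on `[1/2, ∞)`. -/
noncomputable def step (y : ℝ) : ℝ := Real.smoothTransition (1 - 2 * y)

theorem contDiff_step : ContDiff ℝ ∞ step :=
  Real.smoothTransition.contDiff.comp (contDiff_const.sub (contDiff_const.mul contDiff_id))

theorem hasDerivAt_iteratedDeriv_step (j : ℕ) (y : ℝ) :
    HasDerivAt (iteratedDeriv j step) (iteratedDeriv (j + 1) step y) y := by
  rw [iteratedDeriv_succ]
  exact (contDiff_step.differentiable_iteratedDeriv j (by exact_mod_cast ENat.natCast_lt_top j)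
    y).hasDerivAt

theorem step_eq_one {y : ℝ} (hy : y ≤ 0) : step y = 1 :=
  Real.smoothTransition.one_of_one_le (by linarith)

theorem step_eq_zero {y : ℝ} (hy : 1 / 2 ≤ y) : step y = 0 :=
  Real.smoothTransition.zero_of_nonpos (by linarith)

theorem iteratedDeriv_step_left {j : ℕ} (hj : 1 ≤ j) {y : ℝ} (hy : y ≤ 0) :
    iteratedDeriv j step y = 0 := by
  have h1 : ∀ z < 0, iteratedDeriv j step z = 0 := fun z hz => by
    have : step =ᶠ[nhds z] fun _ => (1 : ℝ) := by
      filter_upwards [gt_mem_nhds hz] with w hw using step_eq_one hw.le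
    rw [this.iteratedDeriv_eq j, iteratedDeriv_const, if_neg (by omega)]
  have hc : Continuous (iteratedDeriv j step) :=
    contDiff_step.continuous_iteratedDeriv j (by exact_mod_cast le_top)
  have hcl : IsClosed {z | iteratedDeriv j step z = 0} := isClosed_eq hc continuous_const
  have := hcl.closure_subset_iff.2 (fun z (hz : z ∈ Iio 0) => h1 z hz)
  rw [closure_Iio] at this
  exact this hy

theorem iteratedDeriv_step_right (j : ℕ) {y : ℝ} (hy : 1 / 2 ≤ y) :
    iteratedDeriv j step y = 0 := by
  have h1 : ∀ z > 1 / 2, iteratedDeriv j step z = 0 := fun z hz => by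
    have : step =ᶠ[nhds z] fun _ => (0 : ℝ) := by
      filter_upwards [lt_mem_nhds hz] with w hw using step_eq_zero hw.le
    rw [this.iteratedDeriv_eq j, iteratedDeriv_const]
    split_ifs <;> rfl
  have hc : Continuous (iteratedDeriv j step) :=
    contDiff_step.continuous_iteratedDeriv j (by exact_mod_cast le_top)
  have hcl : IsClosed {z | iteratedDeriv j step z = 0} := isClosed_eq hc continuous_const
  have := hcl.closure_subset_iff.2 (fun z (hz : z ∈ Ioi (1 / 2 : ℝ)) => h1 z hz)
  rw [closure_Ioi] at this
  exact this hy

theorem exists_bound_iteratedDeriv_step :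
    ∃ B : ℝ, 0 ≤ B ∧ ∀ j ≤ 4, ∀ y, 1 ≤ j → |iteratedDeriv j step y| ≤ B := by
  have h : ∀ j : ℕ, ∃ B : ℝ, ∀ y ∈ Icc (0 : ℝ) (1 / 2), |iteratedDeriv j step y| ≤ B := fun j => by
    have hc : Continuous (iteratedDeriv j step) :=
      contDiff_step.continuous_iteratedDeriv j (by exact_mod_cast le_top)
    obtain ⟨B, hB⟩ := isCompact_Icc.exists_bound_of_continuousOn (hc.continuousOn
      (s := Icc (0 : ℝ) (1 / 2)))
    exact ⟨B, hB⟩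
  choose B hB using h
  refine ⟨∑ j ∈ Finset.range 5, |B j|, Finset.sum_nonneg fun _ _ => abs_nonneg _,
    fun j hj y hj1 => ?_⟩
  have hnn : 0 ≤ ∑ j ∈ Finset.range 5, |B j| := Finset.sum_nonneg fun _ _ => abs_nonneg _
  rcases le_or_gt y 0 with h0 | h0
  · rwa [iteratedDeriv_step_left hj1 h0, abs_zero]
  rcases le_or_gt (1 / 2) y with h2 | h2
  · rwa [iteratedDeriv_step_right j h2, abs_zero]
  exact ((hB j y ⟨h0.le, h2.le⟩).trans (le_abs_self _)).trans
    (Finset.single_le_sum (f := fun j => |B j|) (fun _ _ => abs_nonneg _)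
      (Finset.mem_range.2 (by omega)))

/-- The derivatives of the cut-off function which equals `1` on `[-(a - v), b - w]` and vanishes
outside `[-(a - v / 2), b - w / 2]`. -/
noncomputable def cut (a v b w : ℝ) (j : ℕ) (x : ℝ) : ℝ :=
  -- Two one-sided cut-offs are added and 1 is subtracted. As the transition zones do not overlap,
  -- this agrees with their product, while every derivative remains a sum of rescaled derivatives of
  -- `step`.
  w⁻¹ ^ j * iteratedDeriv j step ((x - (b - w)) / w)
    + (-1) ^ j * v⁻¹ ^ j * iteratedDeriv j step ((-x - (a - v)) / v) - if j = 0 then 1 else 0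

section cut

variable {a v b w : ℝ}

theorem hasDerivAt_cut (j : ℕ) (x : ℝ) :
    HasDerivAt (cut a v b w j) (cut a v b w (j + 1) x) x := by
  have h1 : HasDerivAt (fun x : ℝ => (x - (b - w)) / w) w⁻¹ x := by
    simpa using ((hasDerivAt_id x).sub_const (b - w)).div_const w
  have h2 : HasDerivAt (fun x : ℝ => (-x - (a - v)) / v) (-v⁻¹) x := by
    have := ((hasDerivAt_id x).neg.sub_const (a - v)).div_const v
    refine this.congr_deriv ?_
    rw [neg_div, one_div]
  have h3 := (((hasDerivAt_iteratedDeriv_step j ((x - (b - w)) / w)).comp x h1).const_mul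
    (w⁻¹ ^ j)).add (((hasDerivAt_iteratedDeriv_step j ((-x - (a - v)) / v)).comp x h2).const_mul
    ((-1) ^ j * v⁻¹ ^ j))
  refine (h3.sub_const (if j = 0 then 1 else 0)).congr_deriv ?_
  simp only [cut, Nat.add_eq_zero_iff, one_ne_zero, and_false, if_false]
  ring

theorem cut_eq_zero (hv : 0 < v) (hw : 0 < w) (hav : 0 ≤ a - v) (hbw : 0 ≤ b - w) (j : ℕ) {x : ℝ}
    (hx : x ∉ Icc (-(a - v / 2)) (b - w / 2)) : cut a v b w j x = 0 := by
  have hl : ∀ {y : ℝ}, y ≤ 0 → iteratedDeriv j step y = if j = 0 then 1 else 0 := fun {y} hy => by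
    split_ifs with h
    · rw [h, iteratedDeriv_zero, step_eq_one hy]
    · exact iteratedDeriv_step_left (by omega) hy
  rcases not_and_or.1 hx with h | h
  · have h1 : 1 / 2 ≤ (-x - (a - v)) / v := by rw [le_div_iff₀ hv]; linarith
    have h2 : (x - (b - w)) / w ≤ 0 := div_nonpos_of_nonpos_of_nonneg (by linarith) hw.le
    rw [cut, iteratedDeriv_step_right j h1, hl h2]
    split_ifs with h <;> simp [h]
  · have h1 : 1 / 2 ≤ (x - (b - w)) / w := by rw [le_div_iff₀ hw]; linarith
    have h2 : (-x - (a - v)) / v ≤ 0 := div_nonpos_of_nonpos_of_nonneg (by linarith) hv.le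
    rw [cut, iteratedDeriv_step_right j h1, hl h2]
    split_ifs with h <;> simp [h]

theorem cut_zero_eq_one (hv : 0 < v) (hw : 0 < w) {x : ℝ} (hx : x ∈ Icc (-(a - v)) (b - w)) :
    cut a v b w 0 x = 1 := by
  have h2 : (x - (b - w)) / w ≤ 0 := div_nonpos_of_nonpos_of_nonneg (by linarith [hx.2]) hw.le
  have h1 : (-x - (a - v)) / v ≤ 0 := div_nonpos_of_nonpos_of_nonneg (by linarith [hx.1]) hv.le
  simp [cut, step_eq_one h1, step_eq_one h2]

theorem cut_eq_zero_of_mem (hv : 0 < v) (hw : 0 < w) {j : ℕ} (hj : 1 ≤ j) {x : ℝ}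
    (hx : x ∈ Icc (-(a - v)) (b - w)) : cut a v b w j x = 0 := by
  have h2 : (x - (b - w)) / w ≤ 0 := div_nonpos_of_nonpos_of_nonneg (by linarith [hx.2]) hw.le
  have h1 : (-x - (a - v)) / v ≤ 0 := div_nonpos_of_nonpos_of_nonneg (by linarith [hx.1]) hv.le
  rw [cut, iteratedDeriv_step_left hj h1, iteratedDeriv_step_left hj h2, if_neg (by omega)]
  ring

theorem abs_cut_le {B α : ℝ} (hB : ∀ j ≤ 4, ∀ y, 1 ≤ j → |iteratedDeriv j step y| ≤ B)
    (hα : 1 ≤ α) (hv : 0 < v) (hw : 0 < w) (hv1 : α⁻¹ ≤ v) (hw1 : α⁻¹ ≤ w) {j : ℕ} (hj : 1 ≤ j)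
    (hj4 : j ≤ 4) (x : ℝ) : |cut a v b w j x| ≤ 2 * B * α ^ 4 := by
  have hα0 : 0 < α := by linarith
  have hB0 : 0 ≤ B := (abs_nonneg _).trans (hB 1 (by norm_num) 0 le_rfl)
  have key : ∀ u : ℝ, 0 < u → α⁻¹ ≤ u → u⁻¹ ^ j ≤ α ^ 4 := fun u hu hu1 => by
    have : u⁻¹ ≤ α := by rw [← inv_inv α]; exact inv_anti₀ (by positivity) hu1
    exact (pow_le_pow_left₀ (by positivity) this j).trans (pow_le_pow_right₀ hα hj4)
  rw [cut, if_neg (by omega), sub_zero]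
  refine (abs_add_le _ _).trans ?_
  rw [abs_mul, abs_mul, abs_mul, abs_pow (-1), abs_neg, abs_one, one_pow, one_mul,
    abs_of_nonneg (by positivity : 0 ≤ w⁻¹ ^ j), abs_of_nonneg (by positivity : 0 ≤ v⁻¹ ^ j)]
  have h1 := mul_le_mul (key w hw hw1) (hB j hj4 ((x - (b - w)) / w) hj) (abs_nonneg _)
    (by positivity)
  have h2 := mul_le_mul (key v hv hv1) (hB j hj4 ((-x - (a - v)) / v) hj) (abs_nonneg _)
    (by positivity)
  linarith

end cut

/-! ### The pseudomode for a fixed spectral parameter -/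

/-- That F lies in L² is part of the conclusion because the fourth derivative of the pseudomode is
beforehand only known to be measurable; its square integrability is read off from the residual. -/
theorem normL2_le {F Ψ : ℝ → ℂ} {Z : Set ℝ} {ρ k L : ℝ} (hF : AEStronglyMeasurable F volume)
    (hΨ : MemLp Ψ 2 volume) (hZ : MeasurableSet Z) (hvol : volume Z ≤ ENNReal.ofReal L)
    (hρ : 0 ≤ ρ) (hk : 0 ≤ k) (hL : 0 ≤ L)
    (h : ∀ᵐ x, ‖F x‖ ≤ ρ * ‖Ψ x‖ + Z.indicator (fun _ => k) x) :
    MemLp F 2 volume ∧ normL2 F ≤ ρ * normL2 Ψ + k * Real.sqrt L := by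
  have h1 : MemLp (fun x => ρ * ‖Ψ x‖) 2 volume := hΨ.norm.const_mul ρ
  have h2 : MemLp (Z.indicator fun _ => k) 2 volume :=
    memLp_indicator_const 2 hZ k (Or.inr (hvol.trans_lt ENNReal.ofReal_lt_top).ne)
  have h3 := h1.add h2
  have hmono : ∀ᵐ x, ‖F x‖ ≤ ((fun x => ρ * ‖Ψ x‖) + Z.indicator fun _ => k) x := h
  refine ⟨h3.mono' hF hmono, ?_⟩
  have e1 : eLpNorm F 2 volume ≤ ENNReal.ofReal ρ * eLpNorm Ψ 2 volume
      + ENNReal.ofReal k * ENNReal.ofReal L ^ (1 / 2 : ℝ) := by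
    refine (eLpNorm_mono_ae_real hmono).trans ((eLpNorm_add_le h1.1 h2.1 (by norm_num)).trans ?_)
    refine add_le_add ?_ ?_
    · have : eLpNorm (fun x => ρ * ‖Ψ x‖) 2 volume = ‖ρ‖ₑ * eLpNorm (fun x => ‖Ψ x‖) 2 volume :=
        eLpNorm_const_smul ρ _ _ _
      rw [this, eLpNorm_norm, Real.enorm_of_nonneg hρ]
    · rw [eLpNorm_indicator_const hZ (by norm_num) (by norm_num), Real.enorm_of_nonneg hk]
      simp only [ENNReal.toReal_ofNat]
      gcongr
  have hne : ENNReal.ofReal L ^ (1 / 2 : ℝ) ≠ ⊤ :=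
    ENNReal.rpow_ne_top_of_nonneg (by norm_num) ENNReal.ofReal_ne_top
  have ht1 := ENNReal.mul_ne_top (ENNReal.ofReal_ne_top (r := ρ)) hΨ.2.ne
  have ht2 := ENNReal.mul_ne_top (ENNReal.ofReal_ne_top (r := k)) hne
  have e3 := ENNReal.toReal_mono (ENNReal.add_ne_top.2 ⟨ht1, ht2⟩) e1
  rw [ENNReal.toReal_add ht1 ht2,
    ENNReal.toReal_mul, ENNReal.toReal_mul, ENNReal.toReal_ofReal hρ, ENNReal.toReal_ofReal hk,
    ← ENNReal.toReal_rpow, ENNReal.toReal_ofReal hL, ← Real.sqrt_eq_rpow] at e3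
  exact e3

theorem le_normL2 {Ψ : ℝ → ℂ} {m : ℝ} (hΨ : MemLp Ψ 2 volume) (hm : 0 ≤ m)
    (h : ∀ x ∈ Icc (0 : ℝ) 1, m ≤ ‖Ψ x‖) : m ≤ normL2 Ψ := by
  have e1 : eLpNorm ((Icc (0 : ℝ) 1).indicator fun _ => m) 2 volume ≤ eLpNorm Ψ 2 volume := by
    refine eLpNorm_mono fun x => ?_
    by_cases hx : x ∈ Icc (0 : ℝ) 1
    · rw [indicator_of_mem hx, Real.norm_of_nonneg hm]; exact h x hx
    · rw [indicator_of_notMem hx, norm_zero]; exact norm_nonneg _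
  rw [eLpNorm_indicator_const measurableSet_Icc (by norm_num) (by norm_num), Real.volume_Icc,
    Real.enorm_of_nonneg hm] at e1
  have e2 := ENNReal.toReal_mono hΨ.2.ne e1
  simpa [hm, normL2] using e2

theorem norm_wkb {lam : ℂ} {E : ℕ → ℝ → ℂ} {s : DPoly} {x : ℝ}
    (h : IntervalIntegrable (pev lam E 1 s) volume 0 x) :
    ‖wkb lam E s x‖ = Real.exp (∫ y in (0 : ℝ)..x, (pev lam E 1 s y).re) := by
  rw [wkb, Complex.norm_exp]
  congr 1
  exact (Complex.reCLM.intervalIntegral_comp_comm h).symm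

/-- A is the bound for the growth rate on [-R, R], and Q the phase gained across each window. Where
the cut-off is constant, the residual is p⁴ r times the pseudomode; elsewhere |u| ≤ e^{AR - Q},
against a norm of at least e^{-AR} contributed by [0, 1]. -/
theorem pseudomode_bound {N : ℕ} {lam : ℂ} {V : ℝ → ℂ} {E : ℕ → ℝ → ℂ} {s : DPoly}
    (hs : Graded N 0 s) (hE0 : E 0 = V) (hVc : Continuous V)
    (hE1 : ∀ j < N + 3, ∀ x, LipAt (E j) x)
    (hE2 : ∀ j < N + 3, ∀ᵐ x, HasDerivAt (E j) (E (j + 1) x) x)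
    {α R dm wm dp wp' A Q B D ρ : ℝ} (hα : 1 ≤ α) (hR : 1 ≤ R)
    (hslit : ∀ x ∈ Ioo (-dm) dp, lam - V x ∈ Complex.slitPlane)
    (hwm : 0 < wm) (hwp : 0 < wp') (hwm1 : α⁻¹ ≤ wm) (hwp1 : α⁻¹ ≤ wp')
    (hRm : R ≤ dm - 2 * wm) (hRp : R ≤ dp - 2 * wp')
    (hB : ∀ j ≤ 4, ∀ y, 1 ≤ j → |iteratedDeriv j step y| ≤ B) (hA : 0 ≤ A) (hD : 0 ≤ D)
    (hρ : 0 ≤ ρ)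
    (hres : ∀ᵐ x, x ∈ Ioo (-dm) dp → ‖pev lam E 4 (resid s) x‖ ≤ ρ)
    (hder : ∀ᵐ x, x ∈ Ioo (-dm) dp → ∀ j ≤ 4, ‖pev lam E j (derPoly s j) x‖ ≤ D)
    (hin : ∀ᵐ x, |x| ≤ R → |(pev lam E 1 s x).re| ≤ A)
    (hp : ∀ᵐ x, x ∈ Ico R dp → (pev lam E 1 s x).re ≤ 0)
    (hm : ∀ᵐ x, x ∈ Ioc (-dm) (-R) → 0 ≤ (pev lam E 1 s x).re)
    (hpQ : ∀ᵐ x, x ∈ Icc (dp - 2 * wp') (dp - wp') → (pev lam E 1 s x).re ≤ -(Q / wp'))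
    (hmQ : ∀ᵐ x, x ∈ Icc (-(dm - wm)) (-(dm - 2 * wm)) → Q / wm ≤ (pev lam E 1 s x).re) :
    ∃ Ψ ∈ domH V, HasCompactSupport Ψ ∧ Real.exp (-(A * R)) ≤ normL2 Ψ ∧
      normL2 (fun x => opH V Ψ x - lam * Ψ x) ≤ ρ * normL2 Ψ
        + 30 * B * α ^ 4 * D * Real.exp (A * R - Q) * Real.sqrt (wm + wp') := by
  set S := pev lam E 1 s with hS
  have h0 : (0 : ℝ) ∈ Ioo (-dm) dp := ⟨by linarith, by linarith⟩
  set ξ := cut dm wm dp wp' with hξ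
  have hslit' : ∀ x ∈ Ioo (-dm) dp, lam - E 0 x ∈ Complex.slitPlane := by rwa [hE0]
  obtain ⟨hΨc, hΨs, hΨ4, hΨi⟩ := distribEq_cutDer (ξ := ξ) hs hE1 hE2 h0
    (by linarith : -dm < -(dm - wm / 2)) (by linarith : dp - wp' / 2 < dp) hslit'
    (fun i x => hasDerivAt_cut i x)
    (fun i x hx => cut_eq_zero hwm hwp (by linarith) (by linarith) i hx)
  set U := wkbDer lam E s with hU
  set Ψ := cutDer ξ U 0 with hΨ
  have hΨL : MemLp Ψ 2 volume := hΨc.memLp_of_hasCompactSupport hΨs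
  -- the size of the WKB function
  have hSc : ContinuousOn S (Ioo (-dm) dp) := fun x hx =>
    ((hs.lipAt_pev (n := N + 3) (by omega) 1 (hslit' x hx)
      fun j hj => hE1 j hj x).continuousAt).continuousWithinAt
  have hSi : ∀ a ∈ Ioo (-dm) dp, ∀ b ∈ Ioo (-dm) dp, IntervalIntegrable S volume a b :=
    fun a ha b hb => (hSc.mono (ordConnected_Ioo.uIcc_subset ha hb)).intervalIntegrable
  have hGi : ∀ a ∈ Ioo (-dm) dp, ∀ b ∈ Ioo (-dm) dp,
      IntervalIntegrable (fun x => (S x).re) volume a b := fun a ha b hb =>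
    ((Complex.continuous_re.comp_continuousOn hSc).mono
      (ordConnected_Ioo.uIcc_subset ha hb)).intervalIntegrable
  have hnorm : ∀ x ∈ Ioo (-dm) dp,
      ‖wkb lam E s x‖ = Real.exp (∫ y in (0 : ℝ)..x, (S y).re) := fun x hx =>
    norm_wkb (hSi 0 h0 x hx)
  -- The estimates are available only strictly inside (-dm, dp); the endpoints are null.
  have hnul : ∀ c : ℝ, ∀ᵐ x : ℝ, x ≠ c := fun c => by simp [ae_iff, measure_singleton]
  obtain ⟨hr1, hr2⟩ := integral_decay (G := fun x => (S x).re) (A := A) (B := Q / wp') (R := R)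
    (δ := dp) (w := wp') (by linarith) hwp hRp
    (fun x hx => hGi 0 h0 x ⟨by linarith [hx.1], hx.2⟩)
    (by filter_upwards [hin] with x hx hxm
        exact hx (abs_le.2 ⟨by linarith [hxm.1], hxm.2⟩))
    (by filter_upwards [hp, hnul dp] with x hx hxd hxm
        exact hx ⟨hxm.1, lt_of_le_of_ne hxm.2 hxd⟩)
    hpQ hA
  have hneg : ∀ {P : ℝ → Prop}, (∀ᵐ x, P x) → ∀ᵐ x : ℝ, P (-x) := fun {P} h =>
    (Measure.measurePreserving_neg volume).quasiMeasurePreserving.ae h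
  have hnegint : ∀ x : ℝ, ∫ y in (0 : ℝ)..x, -(S (-y)).re = ∫ y in (0 : ℝ)..(-x), (S y).re :=
    fun x => by
      rw [intervalIntegral.integral_neg,
        intervalIntegral.integral_comp_neg (fun y => (S y).re), neg_zero,
        ← intervalIntegral.integral_symm]
  -- The decay to the left is the same estimate for the reflected rate -Re(p s)(-x).
  obtain ⟨-, hl2⟩ := integral_decay (G := fun x => -(S (-x)).re) (A := A) (B := Q / wm) (R := R)
    (δ := dm) (w := wm) (by linarith) hwm hRm
    (fun x hx => by
      have := (IntervalIntegrable.iff_comp_neg enorm_ne_top).1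
        (hGi 0 h0 (-x) ⟨by linarith [hx.2], by linarith [hx.1]⟩)
      rw [neg_zero, neg_neg] at this
      exact this.neg)
    (by filter_upwards [hneg hin] with x hx hxm
        rw [abs_neg]
        exact hx (by rw [abs_neg]; exact abs_le.2 ⟨by linarith [hxm.1], hxm.2⟩))
    (by filter_upwards [hneg hm, hnul dm] with x hx hxd hxm
        have := hx ⟨neg_lt_neg (lt_of_le_of_ne hxm.2 hxd), neg_le_neg hxm.1⟩
        linarith)
    (by filter_upwards [hneg hmQ] with x hx hxm
        have := hx ⟨neg_le_neg hxm.2, neg_le_neg hxm.1⟩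
        linarith) hA
  have hlow : ∀ x ∈ Icc (0 : ℝ) 1, Real.exp (-(A * R)) ≤ ‖Ψ x‖ := fun x hx => by
    have hxJ : x ∈ Ioo (-dm) dp := ⟨by linarith [hx.1], by linarith [hx.2]⟩
    have h1 : Ψ x = wkb lam E s x := by
      simp only [hΨ, cutDer, hξ, hU, wkbDer, derPoly, pev, ev]
      rw [cut_zero_eq_one hwm hwp ⟨by linarith [hx.1], by linarith [hx.2]⟩]
      simp
    rw [h1, hnorm x hxJ]
    exact Real.exp_le_exp.2 (hr1 x ⟨hx.1, hx.2.trans hR⟩)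
  have hup : ∀ x ∈ Ioo (-dm) dp, x ∉ Icc (-(dm - wm)) (dp - wp') →
      ‖wkb lam E s x‖ ≤ Real.exp (A * R - Q) := fun x hx hxz => by
    rw [hnorm x hx]
    refine Real.exp_le_exp.2 ?_
    rcases not_and_or.1 hxz with h | h
    · have := hl2 (-x) ⟨by linarith, by linarith [hx.1]⟩
      rw [hnegint, neg_neg, div_mul_cancel₀ _ hwm.ne'] at this
      exact this
    · have := hr2 x ⟨by linarith, hx.2⟩
      rw [div_mul_cancel₀ _ hwp.ne'] at this
      exact this
  -- the residual
  set f : ℝ → ℂ := fun x => cutDer ξ U 4 x + V x * Ψ x with hf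
  set Z : Set ℝ := Icc (-dm) (-(dm - wm)) ∪ Icc (dp - wp') dp with hZ
  have hB0 : 0 ≤ B := (abs_nonneg _).trans (hB 1 (by norm_num) 0 le_rfl)
  set k := 30 * B * α ^ 4 * D * Real.exp (A * R - Q) with hk
  have hk0 : 0 ≤ k := by positivity
  have hpt : ∀ᵐ x, ‖f x - lam * Ψ x‖ ≤ ρ * ‖Ψ x‖ + Z.indicator (fun _ => k) x := by
    filter_upwards [hres, hder] with x hx1 hx2
    by_cases hxJ : x ∈ Ioo (-dm) dp
    swap
    · have hz : ∀ i, ξ i x = 0 := fun i =>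
        cut_eq_zero hwm hwp (by linarith) (by linarith) i fun h =>
          hxJ ⟨by linarith [h.1], by linarith [h.2]⟩
      have e1 := cutDer_eq_zero (U := U) hz 4
      have e2 : Ψ x = 0 := cutDer_eq_zero (U := U) hz 0
      simp only [hf, e1, e2, mul_zero, add_zero, sub_zero, norm_zero, zero_add]
      exact indicator_nonneg (fun _ _ => hk0) _
    have hU0 : U 0 x = wkb lam E s x := by
      simp [hU, wkbDer, derPoly, pev, ev]
    have hU4 : U 4 x + (V x - lam) * U 0 x = pev lam E 4 (resid s) x * wkb lam E s x := by
      have e := wp_pow_four lam (E 0) x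
      rw [hE0] at e
      rw [hU0]
      simp only [hU, wkbDer, derPoly_four, pev, ev, map_add, map_one, e, hE0]
      ring
    have hsplit : f x - lam * Ψ x = pev lam E 4 (resid s) x * Ψ x
        + (ξ 4 x * U 0 x + 4 * ξ 3 x * U 1 x + 6 * ξ 2 x * U 2 x + 4 * ξ 1 x * U 3 x) := by
      have e1 : Ψ x = ξ 0 x * wkb lam E s x := by simp only [hΨ, cutDer, hU0]
      have e2 : pev lam E 4 (resid s) x * Ψ x = ξ 0 x * (U 4 x + (V x - lam) * U 0 x) := by
        rw [hU4, e1]; ring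
      rw [e2]
      simp only [hf, cutDer]
      rw [e1, hU0]
      ring
    rw [hsplit]
    refine (norm_add_le _ _).trans (add_le_add ?_ ?_)
    · rw [norm_mul]
      exact mul_le_mul_of_nonneg_right (hx1 hxJ) (norm_nonneg _)
    by_cases hxz : x ∈ Icc (-(dm - wm)) (dp - wp')
    · have hz : ∀ i, 1 ≤ i → ξ i x = 0 := fun i hi => cut_eq_zero_of_mem hwm hwp hi hxz
      rw [hz 4 (by norm_num), hz 3 (by norm_num), hz 2 (by norm_num), hz 1 (by norm_num)]
      simp only [Complex.ofReal_zero, mul_zero, zero_mul, add_zero, norm_zero]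
      exact indicator_nonneg (fun _ _ => hk0) _
    · have hxZ : x ∈ Z := by
        rcases not_and_or.1 hxz with h | h
        · exact Or.inl ⟨hxJ.1.le, (not_le.1 h).le⟩
        · exact Or.inr ⟨(not_le.1 h).le, hxJ.2.le⟩
      rw [indicator_of_mem hxZ]
      have hUb : ∀ j ≤ 4, ‖U j x‖ ≤ D * Real.exp (A * R - Q) := fun j hj => by
        simp only [hU, wkbDer, norm_mul]
        exact mul_le_mul (hx2 hxJ j hj) (hup x hxJ hxz) (norm_nonneg _) hD
      have hξb : ∀ j, 1 ≤ j → j ≤ 4 → ‖(ξ j x : ℂ)‖ ≤ 2 * B * α ^ 4 := fun j h1 h2 => by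
        rw [Complex.norm_real]
        exact abs_cut_le hB hα hwm hwp hwm1 hwp1 h1 h2 x
      have hprod : ∀ i j, 1 ≤ i → i ≤ 4 → j ≤ 4 →
          ‖(ξ i x : ℂ) * U j x‖ ≤ 2 * B * α ^ 4 * (D * Real.exp (A * R - Q)) :=
        fun i j h1 h2 h3 => by
          rw [norm_mul]
          exact mul_le_mul (hξb i h1 h2) (hUb j h3) (norm_nonneg _) (by positivity)
      have e : (ξ 4 x * U 0 x + 4 * ξ 3 x * U 1 x + 6 * ξ 2 x * U 2 x + 4 * ξ 1 x * U 3 x : ℂ)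
          = ξ 4 x * U 0 x + 4 * (ξ 3 x * U 1 x) + 6 * (ξ 2 x * U 2 x) + 4 * (ξ 1 x * U 3 x) := by
        ring
      rw [e]
      have n4 : ‖(4 : ℂ)‖ = 4 := by simp
      have n6 : ‖(6 : ℂ)‖ = 6 := by simp
      have t1 := norm_add_le ((ξ 4 x : ℂ) * U 0 x + 4 * (ξ 3 x * U 1 x) + 6 * (ξ 2 x * U 2 x))
        (4 * (ξ 1 x * U 3 x))
      have t2 := norm_add_le ((ξ 4 x : ℂ) * U 0 x + 4 * (ξ 3 x * U 1 x)) (6 * (ξ 2 x * U 2 x))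
      have t3 := norm_add_le ((ξ 4 x : ℂ) * U 0 x) (4 * (ξ 3 x * U 1 x))
      rw [norm_mul 4, n4] at t1 t3
      rw [norm_mul 6, n6] at t2
      have p1 := hprod 4 0 (by norm_num) (by norm_num) (by norm_num)
      have p2 := hprod 3 1 (by norm_num) (by norm_num) (by norm_num)
      have p3 := hprod 2 2 (by norm_num) (by norm_num) (by norm_num)
      have p4 := hprod 1 3 (by norm_num) (by norm_num) (by norm_num)
      -- 15 = 1 + 4 + 6 + 4 is the sum of the binomial coefficients in the commutator of d⁴/dx⁴ with
      -- the cut-off.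
      have ek : k = 15 * (2 * B * α ^ 4 * (D * Real.exp (A * R - Q))) := by rw [hk]; ring
      rw [ek]
      linarith
  have hVΨc : Continuous fun x => V x * Ψ x := hVc.mul hΨc
  have hVΨs : HasCompactSupport fun x => V x * Ψ x := hΨs.mul_left
  have hVΨ : MemLp (fun x => V x * Ψ x) 2 volume := hVΨc.memLp_of_hasCompactSupport hVΨs
  have hfm : AEStronglyMeasurable f volume := hΨ4.add hVΨ.1
  have hvol : volume Z ≤ ENNReal.ofReal (wm + wp') := by
    refine (measure_union_le _ _).trans ?_
    rw [Real.volume_Icc, Real.volume_Icc, ENNReal.ofReal_add hwm.le hwp.le]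
    refine add_le_add (le_of_eq ?_) (le_of_eq ?_)
    · congr 1; ring
    · congr 1; ring
  obtain ⟨hFL, hFn⟩ := normL2_le (hfm.sub (hΨL.1.const_mul lam)) hΨL
    (measurableSet_Icc.union measurableSet_Icc) hvol hρ hk0 (by linarith) hpt
  have hfL : MemLp f 2 volume := by
    have := hFL.add (hΨL.const_mul lam)
    refine this.congr_norm hfm (Eventually.of_forall fun x => ?_)
    simp
  have h4L : MemLp (cutDer ξ U 4) 2 volume := by
    refine (hfL.sub hVΨ).congr_norm hΨ4 (Eventually.of_forall fun x => ?_)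
    simp [hf]
  have hdist : DistribEq V Ψ f := fun φ hφ => by
    have i1 : Integrable (fun x => φ x • cutDer ξ U 4 x) volume :=
      (h4L.locallyIntegrable one_le_two).integrable_smul_left_of_hasCompactSupport
        hφ.1.continuous hφ.2
    have i2 : Integrable (fun x => φ x • (V x * Ψ x)) volume :=
      hVΨc.locallyIntegrable.integrable_smul_left_of_hasCompactSupport hφ.1.continuous hφ.2
    rw [hΨi φ hφ, ← integral_add i1 i2]
    simp only [hf, smul_add]
  have hop := opH_ae_eq hΨL hfL hdist
  refine ⟨Ψ, ⟨hΨL, f, hfL, hdist⟩, hΨs, le_normL2 hΨL (Real.exp_pos _).le hlow, ?_⟩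
  have : normL2 (fun x => opH V Ψ x - lam * Ψ x) = normL2 (f - fun x => lam * Ψ x) := by
    unfold normL2
    congr 1
    refine eLpNorm_congr_ae ?_
    filter_upwards [hop] with x hx
    simp [hx]
  rw [this]
  exact hFn

/-! ### The pseudomode from pointwise bounds on the potential -/

/-- The leading term q = y/d is at least c I / (4K³ α^{3/4}), twice the bound claimed; by the choice
of θ the correction consumes at most half of it. -/
theorem phase_lower_bound {α d q y r c θ B t I K : ℝ} (hα : 1 ≤ α) (hK : 1 ≤ K) (hB : 0 ≤ B)
    (hI : 0 ≤ I) (hc : 0 < c) (hd : α ^ (3 / 4 : ℝ) / 8 ≤ d)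
    (hd' : d ≤ 4 * K ^ 3 * α ^ (3 / 4 : ℝ)) (hq : q * d = y) (hy : c * I ≤ y)
    (hr : |r - q| ≤ B * (t / α)) (ht : t ≤ θ * α ^ (1 / 4 : ℝ) * I)
    (hθ : B * θ ≤ c / (8 * K ^ 3)) :
    c / (8 * K ^ 3) * α ^ (-(3 / 4) : ℝ) * I ≤ r := by
  have hα0 : 0 < α := by linarith
  have hK3 : 0 < K ^ 3 := by positivity
  set a := α ^ (3 / 4 : ℝ) with ha
  have ha0 : 0 < a := by positivity
  have hna : α ^ (-(3 / 4) : ℝ) = a⁻¹ := by rw [Real.rpow_neg hα0.le]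
  have hqa : α ^ (1 / 4 : ℝ) = α * a⁻¹ := by
    rw [← hna, ← Real.rpow_one_add' hα0.le (by norm_num)]; norm_num
  have hd0 : 0 < d := lt_of_lt_of_le (by positivity) hd
  have h1 : c * I / (4 * K ^ 3 * a) ≤ q := by
    rw [eq_div_of_mul_eq hd0.ne' hq]
    exact div_le_div₀ ((by positivity : 0 ≤ c * I).trans hy) hy hd0 hd'
  have h2 : B * (t / α) ≤ c / (8 * K ^ 3) * (a⁻¹ * I) := by
    calc B * (t / α) ≤ B * (θ * (α * a⁻¹) * I / α) := by
          rw [hqa] at ht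
          gcongr
      _ = B * θ * (a⁻¹ * I) := by field_simp
      _ ≤ _ := mul_le_mul_of_nonneg_right hθ (by positivity)
  have h3 : c * I / (4 * K ^ 3 * a) = 2 * (c / (8 * K ^ 3) * (a⁻¹ * I)) := by
    field_simp; ring
  have h4 := (abs_le.1 hr).1
  rw [hna, mul_assoc]
  linarith

/-- T and W are majorants in the roles of τ and |V|. Keeping them abstract permits constants in the
middle region, where the derivatives of V are not controlled by V. -/
theorem pseudomode_of_pointwise {N : ℕ} {lam : ℂ} {V : ℝ → ℂ} {E : ℕ → ℝ → ℂ} {s : DPoly}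
    (hs : Graded N 0 s) (hE0 : E 0 = V) (hVc : Continuous V)
    (hE1 : ∀ j < N + 3, ∀ x, LipAt (E j) x)
    (hE2 : ∀ j < N + 3, ∀ᵐ x, HasDerivAt (E j) (E (j + 1) x) x)
    {T W : ℝ → ℝ} {α R dm wm dp wp' B Bs c K L θ S q : ℝ} (hα : 1 ≤ α) (hR : 1 ≤ R) (hK : 1 ≤ K)
    (hB : 0 ≤ B) (hc : 0 < c) (hL : 0 ≤ L) (hS : 0 ≤ S)
    (hBs : ∀ j ≤ 4, ∀ y, 1 ≤ j → |iteratedDeriv j step y| ≤ Bs)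
    (hz : ∀ x ∈ Ioo (-dm) dp, α / 2 ≤ (lam - V x).re ∧ ‖lam - V x‖ ≤ K * α)
    (hwm1 : α⁻¹ ≤ wm) (hwp1 : α⁻¹ ≤ wp')
    (hRm : R ≤ dm - 2 * wm) (hRp : R ≤ dp - 2 * wp')
    (hwkb : ∀ᵐ x, x ∈ Ioo (-dm) dp →
      |(pev lam E 1 s x).re - (wp lam V x).im| ≤ B * (T x * W x / α) ∧
      ‖pev lam E 4 (resid s) x‖ ≤ B * (α ^ (-((N : ℝ) + 1) / 4) * (T x ^ (N + 1) * W x)) ∧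
      ∀ j ≤ 4, ‖pev lam E j (derPoly s j) x‖ ≤ B * α)
    (hTS : ∀ x ∈ Ioo (-dm) dp, T x ^ (N + 1) * W x ≤ S)
    (hin : ∀ x, |x| < R → |(lam - V x).im| ≤ L ∧ T x * W x ≤ L)
    (hTW : ∀ x ∈ Ioo (-dm) dp, R ≤ |x| →
      T x * W x ≤ θ * α ^ (1 / 4 : ℝ) * (1 + |(V x).im|))
    (hθ : B * θ ≤ c / (8 * K ^ 3))
    (hp : ∀ x ∈ Ico R dp, c * (1 + |(V x).im|) ≤ -(lam - V x).im)
    (hm : ∀ x ∈ Ioc (-dm) (-R), c * (1 + |(V x).im|) ≤ (lam - V x).im)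
    (hpq : ∀ x ∈ Icc (dp - 2 * wp') (dp - wp'), q ≤ wp' * (1 + |(V x).im|))
    (hmq : ∀ x ∈ Icc (-(dm - wm)) (-(dm - 2 * wm)), q ≤ wm * (1 + |(V x).im|)) :
    ∃ Ψ ∈ domH V, HasCompactSupport Ψ ∧ Real.exp (-((8 + B) * L * R)) ≤ normL2 Ψ ∧
      normL2 (fun x => opH V Ψ x - lam * Ψ x) ≤
        B * (α ^ (-((N : ℝ) + 1) / 4) * S) * normL2 Ψ
        + 30 * Bs * α ^ 4 * (B * α) * Real.exp ((8 + B) * L * R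
            - c / (8 * K ^ 3) * α ^ (-(3 / 4) : ℝ) * q) * Real.sqrt (wm + wp') := by
  have hα0 : 0 < α := by linarith
  have hwm : 0 < wm := lt_of_lt_of_le (by positivity) hwm1
  have hwp : 0 < wp' := lt_of_lt_of_le (by positivity) hwp1
  set b := c / (8 * K ^ 3) * α ^ (-(3 / 4) : ℝ) with hb
  have hb0 : 0 ≤ b := by positivity
  have hright : ∀ᵐ x, x ∈ Ico R dp → (pev lam E 1 s x).re ≤ -(b * (1 + |(V x).im|)) := by
    filter_upwards [hwkb] with x hx hxm
    have hxJ : x ∈ Ioo (-dm) dp := ⟨by linarith [hxm.1], hxm.2⟩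
    obtain ⟨d, hd1, hd2, hd3⟩ := wp_im hα hK (hz x hxJ).1 (hz x hxJ).2
    have h1 : |-(pev lam E 1 s x).re - -(wp lam V x).im| ≤ B * (T x * W x / α) := by
      rw [← abs_neg]
      convert (hx hxJ).1 using 2
      ring
    have := phase_lower_bound hα hK hB (by positivity) hc hd1 hd2
      (by rw [neg_mul, hd3]) (hp x hxm) h1
      (hTW x hxJ (hxm.1.trans (le_abs_self x))) hθ
    linarith
  have hleft : ∀ᵐ x, x ∈ Ioc (-dm) (-R) → b * (1 + |(V x).im|) ≤ (pev lam E 1 s x).re := by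
    filter_upwards [hwkb] with x hx hxm
    have hxJ : x ∈ Ioo (-dm) dp := ⟨hxm.1, by linarith [hxm.2]⟩
    obtain ⟨d, hd1, hd2, hd3⟩ := wp_im hα hK (hz x hxJ).1 (hz x hxJ).2
    exact phase_lower_bound hα hK hB (by positivity) hc hd1 hd2 hd3 (hm x hxm) (hx hxJ).1
      (hTW x hxJ ((le_neg_of_le_neg hxm.2).trans (neg_le_abs x))) hθ
  have hnul : ∀ c : ℝ, ∀ᵐ x : ℝ, x ≠ c := fun c => by simp [ae_iff, measure_singleton]
  have hin' : ∀ᵐ x, |x| ≤ R → |(pev lam E 1 s x).re| ≤ (8 + B) * L := by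
    filter_upwards [hwkb, hnul R, hnul (-R)] with x hx hx1 hx2 hxR
    have hxR' : |x| < R := lt_of_le_of_ne hxR fun h => by
      rcases eq_or_eq_neg_of_abs_eq h with h | h
      · exact hx1 h
      · exact hx2 h
    have hxa := abs_lt.1 hxR'
    have hxJ : x ∈ Ioo (-dm) dp := ⟨by linarith, by linarith⟩
    obtain ⟨d, hd1, hd2, hd3⟩ := wp_im hα hK (hz x hxJ).1 (hz x hxJ).2
    obtain ⟨hi1, hi2⟩ := hin x hxR'
    have hα1 : 1 ≤ α ^ (3 / 4 : ℝ) := Real.one_le_rpow hα (by norm_num)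
    have hd0 : 1 / 8 ≤ d := by linarith
    have h1 : |(wp lam V x).im| ≤ 8 * L := by
      have h2 : |(wp lam V x).im| * d ≤ L := by
        rw [← hd3, abs_mul, abs_of_nonneg (by linarith : 0 ≤ d)] at hi1
        exact hi1
      have h3 := mul_le_mul_of_nonneg_left hd0 (abs_nonneg (wp lam V x).im)
      linarith
    have h2 : B * (T x * W x / α) ≤ B * L := by
      refine mul_le_mul_of_nonneg_left ?_ hB
      rw [div_le_iff₀ hα0]
      exact hi2.trans (le_mul_of_one_le_right hL hα)
    have h3 := abs_sub_abs_le_abs_sub (pev lam E 1 s x).re (wp lam V x).im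
    have h4 := (hx hxJ).1
    linarith
  have hBs0 : 0 ≤ Bs := (abs_nonneg _).trans (hBs 1 (by norm_num) 0 le_rfl)
  obtain ⟨Ψ, h1, h2, h3, h4⟩ := pseudomode_bound (lam := lam) (Q := b * q) (D := B * α)
    (A := (8 + B) * L) (ρ := B * (α ^ (-((N : ℝ) + 1) / 4) * S))
    hs hE0 hVc hE1 hE2 hα hR
    (fun x hx => Complex.mem_slitPlane_iff.2 (Or.inl (by linarith [(hz x hx).1])))
    hwm hwp hwm1 hwp1 hRm hRp hBs (by positivity) (by positivity) (by positivity)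
    (by
      filter_upwards [hwkb] with x hx hxJ
      refine (hx hxJ).2.1.trans (mul_le_mul_of_nonneg_left ?_ hB)
      exact mul_le_mul_of_nonneg_left (hTS x hxJ) (by positivity))
    (by filter_upwards [hwkb] with x hx hxJ using (hx hxJ).2.2)
    hin'
    (by
      filter_upwards [hright] with x hx hxm
      have : 0 ≤ b * (1 + |(V x).im|) := by positivity
      linarith [hx hxm])
    (by
      filter_upwards [hleft] with x hx hxm
      exact le_trans (by positivity) (hx hxm))
    (by
      filter_upwards [hright] with x hx hxm
      refine (hx ⟨by linarith [hxm.1], by linarith [hxm.2]⟩).trans (neg_le_neg ?_)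
      rw [div_le_iff₀ hwp, mul_assoc b]
      exact mul_le_mul_of_nonneg_left ((hpq x hxm).trans_eq (mul_comm _ _)) hb0)
    (by
      filter_upwards [hleft] with x hx hxm
      refine le_trans ?_ (hx ⟨by linarith [hxm.1], by linarith [hxm.2]⟩)
      rw [div_le_iff₀ hwm, mul_assoc b]
      exact mul_le_mul_of_nonneg_left ((hmq x hxm).trans_eq (mul_comm _ _)) hb0)
  exact ⟨Ψ, h1, h2, h3, h4⟩

/-- The error produced by the cut-off is eventually negligible. -/
theorem eventually_exp_error_le (C a b κ r : ℝ) (hb : 0 < b) (hκ : 0 < κ) :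
    ∀ᶠ α : ℝ in atTop,
      C * α ^ 4 * α * Real.exp (a - b * α ^ κ) * Real.sqrt (α + α) ≤ α ^ r := by
  have h1 : Tendsto (fun α : ℝ => α ^ κ) atTop atTop := tendsto_rpow_atTop hκ
  -- In the variable α^κ, the power α^{6-r} has exponent (6 - r)/κ. Here 6 = 4 + 1 + 1, the last
  -- unit coming from √(2α) ≤ 2α.
  have h2 := (tendsto_rpow_mul_exp_neg_mul_atTop_nhds_zero ((6 - r) / κ) b hb).comp h1
  set c := |C| * Real.exp a * 2 with hc
  have h3 := h2.const_mul c
  rw [mul_zero] at h3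
  filter_upwards [h3.eventually (eventually_le_nhds (zero_lt_one)), eventually_ge_atTop 1]
    with α h4 h5
  have hα0 : 0 < α := by linarith
  have h6 : (α ^ κ) ^ ((6 - r) / κ) = α ^ (6 : ℕ) / α ^ r := by
    rw [← Real.rpow_mul hα0.le, mul_div_cancel₀ _ hκ.ne', Real.rpow_sub hα0]
    norm_cast
  have h7 : Real.sqrt (α + α) ≤ 2 * α := by
    rw [Real.sqrt_le_left (by linarith)]
    nlinarith
  simp only [Function.comp_apply, h6] at h4
  have hr : 0 < α ^ r := by positivity
  calc C * α ^ 4 * α * Real.exp (a - b * α ^ κ) * Real.sqrt (α + α)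
      ≤ |C| * α ^ 4 * α * Real.exp (a - b * α ^ κ) * (2 * α) := by
        gcongr
        exact le_abs_self C
    _ = c * (α ^ 6 / α ^ r * Real.exp (-b * α ^ κ)) * α ^ r := by
        rw [sub_eq_add_neg, Real.exp_add, hc, neg_mul]
        field_simp
    _ ≤ 1 * α ^ r := mul_le_mul_of_nonneg_right h4 hr.le
    _ = α ^ r := one_mul _

/-! ### The family of pseudomodes -/

theorem CutoffBounds.weaken {v : ℝ → ℂ} {τ δ : ℝ → ℝ} {R c κ K c' κ' K' : ℝ}
    (h : CutoffBounds v τ δ R c κ K) (hc' : 0 ≤ c') (hc : c' ≤ c) (hκ : κ' ≤ κ) (hK : K ≤ K') :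
    CutoffBounds v τ δ R c' κ' K' := fun θ hθ => by
  filter_upwards [h θ hθ, eventually_ge_atTop 1] with α ⟨h1, w, h2, h3, h4, h5⟩ hα
  refine ⟨fun x hx => ⟨(h1 x hx).1, (h1 x hx).2.1.trans ?_, (h1 x hx).2.2⟩, w, h2, h3, h4,
    fun x hx => le_trans ?_ (h5 x hx)⟩
  · exact mul_le_mul_of_nonneg_right hK (by linarith)
  · exact mul_le_mul hc (Real.rpow_le_rpow_of_exponent_le hα (by linarith)) (by positivity)
      (hc'.trans hc)

-- The constant is fixed before α, β and the majorants Sm, Sp, which gives uniformity in λ. The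
-- middle region contributes the constant M to the supremum in the residual, hence the bare term
-- α^{-(N+1)/4}.
set_option maxHeartbeats 1000000 in
theorem exists_pseudomodes {N : ℕ} {V : ℝ → ℂ} {E : ℕ → ℝ → ℂ} {τm τp δm δp : ℝ → ℝ}
    {R A c κ c' K βm βp : ℝ} (hE0 : E 0 = V) (hVc : Continuous V)
    (hE1 : ∀ j < N + 3, ∀ x, LipAt (E j) x)
    (hE2 : ∀ j < N + 3, ∀ᵐ x, HasDerivAt (E j) (E (j + 1) x) x)
    (hR : 1 ≤ R) (hA : 0 ≤ A) (hc : 0 < c) (hc' : 0 < c') (hκ : 0 < κ) (hK : 0 ≤ K)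
    (hp : ∀ x ≥ R, c * (1 + |(V x).im|) ≤ (V x).im - βp)
    (hm : ∀ x ≥ R, c * (1 + |(V (-x)).im|) ≤ -βm - (V (-x)).im)
    (hτp : ∀ x ≥ R, 0 ≤ τp x) (hτm : ∀ x ≥ R, 0 ≤ τm (-x))
    (hEi : ∀ᵐ x, |x| ≤ R → ∀ j, 1 ≤ j → j ≤ N + 3 → ‖E j x‖ ≤ A)
    (hEp : ∀ᵐ x, R ≤ x → ∀ j, 1 ≤ j → j ≤ N + 3 → ‖E j x‖ ≤ A * (τp x ^ j * ‖V x‖))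
    (hEm : ∀ᵐ x, x ≤ -R → ∀ j, 1 ≤ j → j ≤ N + 3 → ‖E j x‖ ≤ A * (τm x ^ j * ‖V x‖))
    (hgp : CutoffBounds V τp δp R c' κ K)
    (hgm : CutoffBounds (fun x => V (-x)) (fun x => τm (-x)) δm R c' κ K) :
    ∃ C : ℝ, 0 < C ∧ ∀ᶠ α in atTop, ∀ β ∈ Icc (-βm) βp, ∀ Sm Sp : ℝ, 0 ≤ Sm → 0 ≤ Sp →
      (∀ x ∈ Icc R (δm α), τm (-x) ^ (N + 1) * ‖V (-x)‖ ≤ Sm) →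
      (∀ x ∈ Icc R (δp α), τp x ^ (N + 1) * ‖V x‖ ≤ Sp) →
      ∃ Ψ ∈ domH V, HasCompactSupport Ψ ∧ 0 < normL2 Ψ ∧
        normL2 (fun x => opH V Ψ x - (α + β * Complex.I) * Ψ x) / normL2 Ψ ≤
          C * (α ^ (-((N : ℝ) + 1) / 4) + α ^ (-((N : ℝ) + 1) / 4) * Sm
            + α ^ (-((N : ℝ) + 1) / 4) * Sp) := by
  obtain ⟨s, hs1, hr⟩ := exists_wkb N
  have hs : Graded N 0 s := by
    have h := (hs1.weaken (Nat.zero_le 1)).add (.const (-Complex.I))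
    rwa [sub_add_cancel] at h
  obtain ⟨M₀, hM₀⟩ := (isCompact_Icc (a := -R) (b := R)).exists_bound_of_continuousOn
    hVc.continuousOn
  set M := max M₀ 1 with hM
  have hM1 : 1 ≤ M := le_max_right _ _
  have hVM : ∀ x, |x| < R → ‖V x‖ ≤ M := fun x hx =>
    (hM₀ x ⟨(abs_lt.1 hx).1.le, (abs_lt.1 hx).2.le⟩).trans (le_max_left _ _)
  set K₁ := K + 3 with hK₁
  obtain ⟨B, hB, hwkb⟩ := exists_wkb_bound hs hs1 hr A K₁ hA (by linarith)
  obtain ⟨Bs, hBs0, hBs⟩ := exists_bound_iteratedDeriv_step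
  set c₁ := c / (8 * K₁ ^ 3) with hc₁
  have hc₁0 : 0 < c₁ := by positivity
  -- θ ≤ 1/4 keeps Re(λ - V) ≥ α/2; the second bound gives B θ ≤ c₁, as needed to absorb the
  -- correction to the phase.
  set θ := min (1 / 4) (c₁ / (B + 1)) with hθ
  have hθ0 : 0 < θ := by positivity
  have hθ4 : θ ≤ 1 / 4 := min_le_left _ _
  have hBθ : B * θ ≤ c₁ := by
    have h1 : θ * (B + 1) ≤ c₁ := (le_div_iff₀ (by positivity)).1 (min_le_right _ _)
    nlinarith
  set L := |βm| + |βp| + M with hL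
  set a := (8 + B) * L * R with ha
  set r := -((N : ℝ) + 1) / 4 with hr'
  refine ⟨B * M + B + 1, by positivity, ?_⟩
  filter_upwards [hgp θ hθ0, hgm θ hθ0, eventually_ge_atTop 1, eventually_ge_atTop (2 * L),
    -- One `a` comes from the growth of |u| in the middle region, the other from dividing by the
    -- norm, which is at least e^{-a}.
    eventually_exp_error_le (30 * Bs * B) (a + a) (c₁ * c') κ r (by positivity) hκ]
    with α ⟨gp, wp', gp1, gp2, gp3, gp4⟩ ⟨gm, wm, gm1, gm2, gm3, gm4⟩ hα hαL herr β hβ Sm Sp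
      hSm hSp hσm hσp
  have hα0 : 0 < α := by linarith
  have hqα : 1 ≤ α ^ (1 / 4 : ℝ) := Real.one_le_rpow hα (by norm_num)
  have hβL : |β| + M ≤ L := by
    have : |β| ≤ |βm| + |βp| := abs_le.2
      ⟨by linarith [neg_abs_le βm, le_abs_self βm, abs_nonneg βp, hβ.1],
        by linarith [le_abs_self βp, abs_nonneg βm, hβ.2]⟩
    linarith
  have hβ0 := abs_nonneg β
  set lam : ℂ := α + β * Complex.I with hlam
  have hre : lam.re = α := by simp [hlam]
  have him : lam.im = β := by simp [hlam]
  -- With T = 1 and W = M ≥ 1 on |x| < R, the bound A on the derivatives takes the same form A T^j W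
  -- as at the ends.
  set T : ℝ → ℝ := fun x => if R ≤ x then τp x else if x ≤ -R then τm x else 1 with hT
  set W : ℝ → ℝ := fun x => if R ≤ x then ‖V x‖ else if x ≤ -R then ‖V x‖ else M with hW
  have tri : ∀ x, (R ≤ x ∧ T x = τp x ∧ W x = ‖V x‖) ∨ (x ≤ -R ∧ T x = τm x ∧ W x = ‖V x‖) ∨
      (|x| < R ∧ T x = 1 ∧ W x = M) := fun x => by
    by_cases h1 : R ≤ x
    · exact Or.inl ⟨h1, if_pos h1, if_pos h1⟩
    · by_cases h2 : x ≤ -R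
      · exact Or.inr (Or.inl ⟨h2, by simp [hT, h1, h2], by simp [hW, h1, h2]⟩)
      · exact Or.inr (Or.inr ⟨abs_lt.2 ⟨not_le.1 h2, not_le.1 h1⟩, by simp [hT, h1, h2],
          by simp [hW, h1, h2]⟩)
  have right : ∀ x ∈ Ioo (-δm α) (δp α), R ≤ x → x ∈ Icc R (δp α) := fun x hx h => ⟨h, hx.2.le⟩
  have left : ∀ x ∈ Ioo (-δm α) (δp α), x ≤ -R → -x ∈ Icc R (δm α) := fun x hx h =>
    ⟨by linarith, by linarith [hx.1]⟩
  have key : ∀ x ∈ Ioo (-δm α) (δp α), |(V x).re| ≤ α / 2 ∧ ‖V x‖ ≤ (K + 1) * α ∧ 0 ≤ T x ∧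
      T x ≤ α ^ (1 / 4 : ℝ) ∧ 0 ≤ W x ∧ W x ≤ K₁ * α ∧ T x ^ (N + 1) * W x ≤ M + Sm + Sp := by
    intro x hx
    have hKα : 0 ≤ K * α := by positivity
    have hθα : θ * α ≤ 1 / 4 * α := mul_le_mul_of_nonneg_right hθ4 hα0.le
    rcases tri x with ⟨h, e1, e2⟩ | ⟨h, e1, e2⟩ | ⟨h, e1, e2⟩ <;> rw [e1, e2]
    · obtain ⟨h1, h2, h3, h4⟩ := gp x (right x hx h)
      refine ⟨?_, by linarith, hτp x h, h3, norm_nonneg _, by linarith, ?_⟩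
      · linarith
      · linarith [hσp x (right x hx h)]
    · have h' := left x hx h
      obtain ⟨h1, h2, h3, h4⟩ := gm (-x) h'
      have h5 := hσm (-x) h'
      have h6 := hτm (-x) h'.1
      simp only [neg_neg] at h1 h2 h3 h4 h5 h6
      refine ⟨?_, by linarith, h6, h3, norm_nonneg _, by linarith, by linarith⟩
      linarith
    · have h1 := hVM x h
      refine ⟨?_, by linarith, zero_le_one, hqα, by linarith, by linarith, ?_⟩
      · linarith [Complex.abs_re_le_norm (V x)]
      · rw [one_pow, one_mul]; linarith
  have hz : ∀ x ∈ Ioo (-δm α) (δp α), α / 2 ≤ (lam - V x).re ∧ ‖lam - V x‖ ≤ K₁ * α := by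
    intro x hx
    obtain ⟨h1, h2, -⟩ := key x hx
    refine ⟨?_, ?_⟩
    · rw [Complex.sub_re, hre]
      linarith [le_abs_self (V x).re]
    · have h3 := norm_sub_le lam (V x)
      have h4 := Complex.norm_le_abs_re_add_abs_im lam
      rw [hre, him, abs_of_pos hα0] at h4
      rw [hK₁]
      linarith
  have hEall : ∀ᵐ x, ∀ j, 1 ≤ j → j ≤ N + 3 → ‖E j x‖ ≤ A * (T x ^ j * W x) := by
    filter_upwards [hEi, hEp, hEm] with x h1 h2 h3 j hj1 hj2
    rcases tri x with ⟨h, e1, e2⟩ | ⟨h, e1, e2⟩ | ⟨h, e1, e2⟩ <;> rw [e1, e2]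
    · exact h2 h j hj1 hj2
    · exact h3 h j hj1 hj2
    · rw [one_pow, one_mul]
      exact (h1 h.le j hj1 hj2).trans (le_mul_of_one_le_right hA hM1)
  obtain ⟨Ψ, hΨ, hsupp, hlow, hbound⟩ := pseudomode_of_pointwise (lam := lam) (T := T) (W := W)
    (α := α) (R := R) (dm := δm α) (wm := wm) (dp := δp α) (wp' := wp') (B := B) (Bs := Bs)
    (c := c) (K := K₁) (L := L) (θ := θ) (S := M + Sm + Sp) (q := c' * α ^ (3 / 4 + κ))
    hs hE0 hVc hE1 hE2 hα hR (by linarith) hB hc (by positivity) (by positivity) hBs hz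
    gm1 gp1 gm3 gp3
    (by
      filter_upwards [hEall] with x h1 hx
      obtain ⟨k1, k2, k3, k4, k5, k6, k7⟩ := key x hx
      have := hwkb lam E x α (T x) (W x) hα (by rw [hE0]; exact (hz x hx).1)
        (by rw [hE0]; exact (hz x hx).2) k3 k4 k5 k6 h1
      rwa [hE0] at this)
    (fun x hx => (key x hx).2.2.2.2.2.2)
    (fun x hx => by
      refine ⟨?_, ?_⟩
      · rw [Complex.sub_im, him]
        linarith [abs_sub β (V x).im, Complex.abs_im_le_norm (V x), hVM x hx]
      · rcases tri x with ⟨h, -⟩ | ⟨h, -⟩ | ⟨h, e1, e2⟩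
        · linarith [(abs_lt.1 hx).2]
        · linarith [(abs_lt.1 hx).1]
        · rw [e1, e2, one_mul]; linarith)
    (fun x hx hxR => by
      rcases tri x with ⟨h, e1, e2⟩ | ⟨h, e1, e2⟩ | ⟨h, e1, e2⟩
      · rw [e1, e2, mul_comm]
        exact (gp x (right x hx h)).2.2.2
      · have := (gm (-x) (left x hx h)).2.2.2
        simp only [neg_neg] at this
        rw [e1, e2, mul_comm]
        exact this
      · exact absurd hxR (not_le.2 h))
    hBθ
    (fun x hx => by
      have := hp x hx.1
      rw [Complex.sub_im, him]
      linarith [hβ.2])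
    (fun x hx => by
      have := hm (-x) (by linarith [hx.2])
      rw [neg_neg] at this
      rw [Complex.sub_im, him]
      linarith [hβ.1])
    gp4
    (fun x hx => by
      have := gm4 (-x) ⟨by linarith [hx.2], by linarith [hx.1]⟩
      simpa using this)
  have hpos : 0 < normL2 Ψ := lt_of_lt_of_le (Real.exp_pos _) hlow
  refine ⟨Ψ, hΨ, hsupp, hpos, ?_⟩
  rw [div_le_iff₀ hpos]
  have hr0 : 0 < α ^ r := by positivity
  have hexp : c₁ * α ^ (-(3 / 4) : ℝ) * (c' * α ^ (3 / 4 + κ)) = c₁ * c' * α ^ κ := by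
    have : α ^ κ = α ^ (-(3 / 4) : ℝ) * α ^ (3 / 4 + κ) := by
      rw [← Real.rpow_add hα0]; congr 1; ring
    rw [this]; ring
  have herr' : 30 * Bs * α ^ 4 * (B * α) * Real.exp (a - c₁ * α ^ (-(3 / 4) : ℝ) *
      (c' * α ^ (3 / 4 + κ))) * Real.sqrt (wm + wp') ≤ α ^ r * normL2 Ψ := by
    have h1 : Real.exp (a - c₁ * c' * α ^ κ)
        = Real.exp (a + a - c₁ * c' * α ^ κ) * Real.exp (-a) := by
      rw [← Real.exp_add]; congr 1; ring
    rw [hexp, h1]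
    calc _ = 30 * Bs * B * α ^ 4 * α * Real.exp (a + a - c₁ * c' * α ^ κ) * Real.sqrt (wm + wp')
          * Real.exp (-a) := by ring
      _ ≤ 30 * Bs * B * α ^ 4 * α * Real.exp (a + a - c₁ * c' * α ^ κ) * Real.sqrt (α + α)
          * Real.exp (-a) := by gcongr
      _ ≤ α ^ r * normL2 Ψ := mul_le_mul herr hlow (Real.exp_pos _).le hr0.le
  refine hbound.trans ((add_le_add le_rfl herr').trans ?_)
  rw [← add_mul]
  refine mul_le_mul_of_nonneg_right ?_ hpos.le
  have e : (B * M + B + 1) * (α ^ r + α ^ r * Sm + α ^ r * Sp)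
      = B * (α ^ r * (M + Sm + Sp)) + α ^ r
        + α ^ r * (B + (B * M + 1) * Sm + (B * M + 1) * Sp) := by ring
  rw [e]
  have : 0 ≤ α ^ r * (B + (B * M + 1) * Sm + (B * M + 1) * Sp) := by positivity
  linarith

/-! ### The main theorem -/

/-- The quotient (g - β)/(1 + g) increases with g, so its value at g = b serves as c. Bounding g - β
by a multiple of 1 + |g| gives uniform decay even if Im V is unbounded. -/
theorem exists_gap {g : ℝ → ℝ} {β b : ℝ} (hβ : 0 ≤ β) (hb : β < b)
    (h : ∀ᶠ x in atTop, b < g x) :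
    0 < b ∧ ∃ c : ℝ, 0 < c ∧ ∀ᶠ x in atTop, b ≤ |g x| ∧ c * (1 + |g x|) ≤ g x - β := by
  have hb0 : 0 < b := hβ.trans_lt hb
  refine ⟨hb0, (b - β) / (1 + b), div_pos (by linarith) (by linarith), ?_⟩
  filter_upwards [h] with x hx
  rw [abs_of_pos (hb0.trans hx)]
  refine ⟨hx.le, ?_⟩
  rw [div_mul_eq_mul_div, div_le_iff₀ (by linarith)]
  nlinarith

/-- A real number strictly in between also covers an infinite lower limit. -/
theorem exists_eventually_lt {g : ℝ → ℝ} {β : ℝ}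
    (h : (β : EReal) < liminf (fun x => (g x : EReal)) atTop) :
    ∃ b : ℝ, β < b ∧ ∀ᶠ x in atTop, b < g x := by
  obtain ⟨b, h1, h2⟩ := EReal.lt_iff_exists_real_btwn.1 h
  refine ⟨b, EReal.coe_lt_coe_iff.1 h1, ?_⟩
  filter_upwards [eventually_lt_of_lt_liminf h2] with x hx
  exact EReal.coe_lt_coe_iff.1 hx

theorem exists_eventually_lt_neg {g : ℝ → ℝ} {β : ℝ}
    (h : limsup (fun x => (g x : EReal)) atBot < ((-β : ℝ) : EReal)) :
    ∃ b : ℝ, β < b ∧ ∀ᶠ x in atTop, b < -g (-x) := by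
  obtain ⟨b, h1, h2⟩ := EReal.lt_iff_exists_real_btwn.1 h
  refine ⟨-b, by linarith [EReal.coe_lt_coe_iff.1 h2], ?_⟩
  filter_upwards [tendsto_neg_atTop_atBot.eventually (eventually_lt_of_limsup_lt h1)] with x hx
  linarith [EReal.coe_lt_coe_iff.1 hx]

theorem le_sSup_image_Icc {f : ℝ → ℝ} (hf : ContinuousOn f (Ici 0)) {δ x : ℝ}
    (hx : x ∈ Icc 0 δ) : f x ≤ sSup (f '' Icc 0 δ) :=
  le_csSup (isCompact_Icc.bddAbove_image (hf.mono Icc_subset_Ici_self)) (mem_image_of_mem f hx)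

/-- The left supremum in terms of the reflected functions. -/
theorem image_Icc_neg (f : ℝ → ℝ) (δ : ℝ) :
    f '' Icc (-δ) 0 = (fun x => f (-x)) '' Icc 0 δ := by
  rw [← image_image f Neg.neg, image_neg_Icc, neg_zero]

theorem exists_sSup_bound {V : ℝ → ℂ} {τ : ℝ → ℝ} (hV : Continuous V)
    (hτ : ContinuousOn τ (Ici 0)) (hpos : ∀ x ∈ Ici (0 : ℝ), 0 < τ x) (n : ℕ)
    (hVb : BoundedAtEnd atTop V) (hτb : ∃ M : ℝ, ∀ᶠ x in atTop, τ x ≤ M) :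
    ∃ C : ℝ, 0 < C ∧ ∀ δ : ℝ, sSup ((fun x => τ x ^ n * ‖V x‖) '' Icc 0 δ) ≤ C := by
  obtain ⟨C, hC⟩ := hVb
  obtain ⟨M, hM⟩ := hτb
  obtain ⟨R, hR⟩ := eventually_atTop.1 (hC.and hM)
  have hf : ContinuousOn (fun x => τ x ^ n * ‖V x‖) (Ici 0) :=
    (hτ.pow n).mul hV.norm.continuousOn
  obtain ⟨C₁, hC₁⟩ := (isCompact_Icc (a := (0 : ℝ)) (b := R)).exists_bound_of_continuousOn
    (hf.mono Icc_subset_Ici_self)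
  refine ⟨max C₁ (max (M ^ n * C) 1), by positivity, fun δ => Real.sSup_le ?_ (by positivity)⟩
  rintro _ ⟨x, hx, rfl⟩
  by_cases hxR : x ≤ R
  · exact ((le_abs_self _).trans (hC₁ x ⟨hx.1, hxR⟩)).trans (le_max_left _ _)
  · obtain ⟨h1, h2⟩ := hR x (not_le.1 hxR).le
    refine le_trans ?_ ((le_max_left _ _).trans (le_max_right _ _))
    have h3 := (hpos x hx.1).le
    exact mul_le_mul (pow_le_pow_left₀ h3 h2 n) h1 (norm_nonneg _) (pow_nonneg (h3.trans h2) n)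

theorem sSup_image_nonneg {V : ℝ → ℂ} {τ : ℝ → ℝ} (hpos : ∀ x ∈ Ici (0 : ℝ), 0 < τ x) (n : ℕ)
    (δ : ℝ) : 0 ≤ sSup ((fun x => τ x ^ n * ‖V x‖) '' Icc 0 δ) := by
  refine Real.sSup_nonneg ?_
  rintro _ ⟨x, hx, rfl⟩
  exact mul_nonneg (pow_nonneg (hpos x hx.1).le n) (norm_nonneg _)

theorem sigmaMinus_eq (N : ℕ) (V : ℝ → ℂ) (τ : ℝ → ℝ) (ε α : ℝ) :
    sigmaMinus N V τ ε α = α ^ (-((N : ℝ) + 1) / 4) *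
      sSup ((fun x => τ (-x) ^ (N + 1) * ‖V (-x)‖) '' Icc 0 (deltaMinus V τ ε α)) := by
  rw [sigmaMinus, image_Icc_neg]

theorem Assumption.exists_eventually {N : ℕ} {V : ℝ → ℂ} {D : ℕ → ℝ → ℂ} {τm τp : ℝ → ℝ}
    {εm εp : ℝ} (hV : Assumption N V D τm τp εm εp) {βm βp : ℝ} (hβm : 0 ≤ βm) (hβp : 0 ≤ βp)
    (hBm : limsup (fun x => ((V x).im : EReal)) atBot < ((-βm : ℝ) : EReal))
    (hBp : ((βp : ℝ) : EReal) < liminf (fun x => ((V x).im : EReal)) atTop) :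
    ∃ C : ℝ, 0 < C ∧ ∀ᶠ α in atTop,
      (¬ BoundedAtEnd atBot V → IsLeast (crossingSet (-1) V τm εm α) (deltaMinus V τm εm α)) ∧
      (¬ BoundedAtEnd atTop V → IsLeast (crossingSet 1 V τp εp α) (deltaPlus V τp εp α)) ∧
      ∀ β ∈ Icc (-βm) βp, ∃ Ψ ∈ domH V, HasCompactSupport Ψ ∧ 0 < normL2 Ψ ∧
        normL2 (fun x => opH V Ψ x - (α + β * Complex.I) * Ψ x) / normL2 Ψ ≤
          C * (α ^ (-((N : ℝ) + 1) / 4) + sigmaMinus N V τm εm α + sigmaPlus N V τp εp α) := by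
  have hVc := hV.continuous
  obtain ⟨E, hE0, hED, hE1, hE2⟩ := hV.sobolev.exists_chain (by omega) hVc
  have hE1c : Continuous (E 1) :=
    continuous_iff_continuousAt.2 fun x => (hE1 1 (by omega) x).continuousAt
  have hVd : ∀ x, HasDerivAt V (E 1 x) x := fun x => by
    have h1 := hE1 0 (by omega)
    have h2 := hE2 0 (by omega)
    rw [hE0] at h1 h2
    exact hasDerivAt_of_lipAt h1 h2 hE1c x
  have hright := hV.right
  have hleft := hV.left.reflect
  obtain ⟨bp, hbp, hbp'⟩ := exists_eventually_lt hBp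
  obtain ⟨bm, hbm, hbm'⟩ := exists_eventually_lt_neg hBm
  obtain ⟨hbp0, cp, hcp, hgp⟩ := exists_gap hβp hbp hbp'
  obtain ⟨hbm0, cm, hcm, hgm⟩ := exists_gap hβm hbm hbm'
  obtain ⟨hleastp, Rp, c₁, κ₁, K₁, hc₁, hκ₁, hK₁, hgood₁⟩ :=
    hright.cutoffGood hVc hE1c (hED 1 (by omega)) hVd hbp0 (hgp.mono fun x hx => hx.1)
  obtain ⟨hleastm, Rm, c₂, κ₂, K₂, hc₂, hκ₂, hK₂, hgood₂⟩ :=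
    hleft.cutoffGood (V' := fun x => -E 1 (-x)) (b := bm) (hVc.comp continuous_neg)
      (hE1c.comp continuous_neg).neg
      (by
        have := (Measure.measurePreserving_neg volume).quasiMeasurePreserving.ae
          (hED 1 (by omega))
        filter_upwards [this] with x hx
        simp [hx])
      (fun x => by
        have := (hVd (-x)).scomp x (hasDerivAt_neg x)
        simpa [Function.comp_def] using this)
      hbm0
      (hgm.mono fun x hx => by simpa using hx.1)
  rw [cutoffRadius_neg] at hleastm hgood₂
  simp only [crossingSet_neg, boundedAtEnd_neg] at hleastm
  obtain ⟨R₃, A₁, hR₃, hA₁, hdp⟩ := hright.exists_deriv_bound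
  obtain ⟨R₄, A₂, hR₄, hA₂, hdm⟩ := hleft.exists_deriv_bound
  obtain ⟨R₅, hR₅⟩ := eventually_atTop.1 (hgp.and hgm)
  -- One radius beyond which all asymptotic bounds hold at both ends.
  set R := max (max (max Rp Rm) (max R₃ R₄)) (max R₅ 1) with hR
  have hRp : Rp ≤ R := by simp [hR]
  have hRm : Rm ≤ R := by simp [hR]
  have hR3 : R₃ ≤ R := by simp [hR]
  have hR4 : R₄ ≤ R := by simp [hR]
  have hR5 : R₅ ≤ R := by simp [hR]
  have hR1 : 1 ≤ R := by simp [hR]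
  -- Between the two ends only the local boundedness of the weak derivatives is available.
  have hAi : ∃ A : ℝ, 0 ≤ A ∧ ∀ᵐ x, |x| ≤ R → ∀ j, 1 ≤ j → j ≤ N + 3 → ‖E j x‖ ≤ A := by
    have h : ∀ j, ∃ A : ℝ, j ≤ N + 3 → ∀ᵐ x, x ∈ Icc (-R) R → ‖E j x‖ ≤ A := fun j => by
      by_cases hj : j ≤ N + 3
      · obtain ⟨A, hA⟩ := (hV.sobolev.2 j hj).1.exists_bound R
        refine ⟨A, fun _ => ?_⟩
        filter_upwards [hA, hED j hj] with x h1 h2 hx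
        rw [h2]
        exact h1 hx
      · exact ⟨0, fun h => absurd h hj⟩
    choose A hA using h
    refine ⟨∑ j ∈ Finset.range (N + 4), |A j|, by positivity, ?_⟩
    have h' := (ae_ball_iff (Finset.range (N + 4)).countable_toSet (p := fun x j _ =>
      x ∈ Icc (-R) R → ‖E j x‖ ≤ A j) (μ := volume)).2
      fun j hj => hA j (by have := Finset.mem_range.1 (Finset.mem_coe.1 hj); omega)
    filter_upwards [h'] with x hx hxR j _ hj
    have hjm : j ∈ Finset.range (N + 4) := Finset.mem_range.2 (by omega)
    exact ((hx j hjm (abs_le.1 hxR)).trans (le_abs_self _)).trans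
      (Finset.single_le_sum (f := fun j => |A j|) (fun i _ => abs_nonneg _) hjm)
  obtain ⟨A₃, hA₃, hEi⟩ := hAi
  have hED' : ∀ᵐ x, ∀ j, j ≤ N + 3 → E j x = D j x := by
    rw [ae_all_iff]
    intro j
    by_cases hj : j ≤ N + 3
    · filter_upwards [hED j hj] with x hx _ using hx
    · exact Eventually.of_forall fun x h => absurd h hj
  have hneg : ∀ {P : ℝ → Prop}, (∀ᵐ x, P x) → ∀ᵐ x : ℝ, P (-x) := fun {P} h =>
    (Measure.measurePreserving_neg volume).quasiMeasurePreserving.ae h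
  have hτp : ∀ x ≥ R, 0 ≤ τp x := fun x hx =>
    (hright.weight_pos x (by simp only [mem_Ici]; linarith)).le
  have hτm : ∀ x ≥ R, 0 ≤ τm (-x) := fun x hx =>
    (hleft.weight_pos x (by simp only [mem_Ici]; linarith)).le
  obtain ⟨C, hC, hmain⟩ := exists_pseudomodes (N := N) (V := V) (E := E) (τm := τm) (τp := τp)
    (δm := cutoffRadius (-1) atBot V τm εm) (δp := cutoffRadius 1 atTop V τp εp)
    (R := R) (A := A₁ + A₂ + A₃) (c := min cp cm) (κ := min κ₁ κ₂) (c' := min c₁ c₂)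
    (K := max K₁ K₂) (βm := βm) (βp := βp) hE0 hVc hE1 hE2 hR1 (by positivity) (by positivity)
    (by positivity) (by positivity) (hK₁.trans (le_max_left _ _))
    (fun x hx => by
      refine le_trans ?_ (hR₅ x (hR5.trans hx)).1.2
      exact mul_le_mul_of_nonneg_right (min_le_left _ _) (by positivity))
    (fun x hx => by
      have := (hR₅ x (hR5.trans hx)).2.2
      rw [abs_neg] at this
      refine le_trans (mul_le_mul_of_nonneg_right (min_le_right _ _) (by positivity))
        (this.trans_eq (by ring)))
    hτp hτm
    (by
      filter_upwards [hEi] with x hx h j hj1 hj2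
      linarith [hx h j hj1 hj2])
    (by
      filter_upwards [hdp, hED'] with x hx hx' h j hj1 hj2
      rw [hx' j hj2]
      refine (hx (hR3.trans h) j hj1 hj2).trans (mul_le_mul_of_nonneg_right (by linarith) ?_)
      exact mul_nonneg (pow_nonneg (hτp x h) _) (norm_nonneg _))
    (by
      filter_upwards [hneg hdm, hED'] with x hx hx' h j hj1 hj2
      have h1 := hx (by linarith) j hj1 hj2
      have h2 := hτm (-x) (by linarith)
      simp only [neg_neg, norm_mul, norm_pow, norm_neg, norm_one, one_pow, one_mul] at h1 h2
      rw [hx' j hj2]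
      refine h1.trans (mul_le_mul_of_nonneg_right (by linarith) ?_)
      exact mul_nonneg (pow_nonneg h2 _) (norm_nonneg _))
    (CutoffBounds.weaken (hgood₁ R hRp) (by positivity) (min_le_left _ _) (min_le_left _ _)
      (le_max_left _ _))
    (CutoffBounds.weaken (hgood₂ R hRm) (by positivity) (min_le_right _ _) (min_le_right _ _)
      (le_max_right _ _))
  have hfp : ContinuousOn (fun x => τp x ^ (N + 1) * ‖V x‖) (Ici 0) :=
    (hright.continuousOn_weight.pow _).mul hVc.norm.continuousOn
  have hfm : ContinuousOn (fun x => τm (-x) ^ (N + 1) * ‖V (-x)‖) (Ici 0) :=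
    (hleft.continuousOn_weight.pow _).mul (hVc.comp continuous_neg).norm.continuousOn
  refine ⟨C, hC, ?_⟩
  have hm' : ∀ᶠ α in atTop, ¬ BoundedAtEnd atBot V →
      IsLeast (crossingSet (-1) V τm εm α) (deltaMinus V τm εm α) := by
    by_cases hb : BoundedAtEnd atBot V
    · exact Eventually.of_forall fun _ h => absurd hb h
    · exact (hleastm hb).mono fun _ h _ => h
  have hp' : ∀ᶠ α in atTop, ¬ BoundedAtEnd atTop V →
      IsLeast (crossingSet 1 V τp εp α) (deltaPlus V τp εp α) := by
    by_cases hb : BoundedAtEnd atTop V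
    · exact Eventually.of_forall fun _ h => absurd hb h
    · exact (hleastp hb).mono fun _ h _ => h
  filter_upwards [hm', hp', hmain] with α h1 h2 h3
  refine ⟨h1, h2, fun β hβ => ?_⟩
  rw [sigmaMinus_eq]
  -- The suprema over [0, δ] dominate the values on [R, δ], the only ones required.
  exact h3 β hβ _ _ (sSup_image_nonneg (V := fun x => V (-x)) hleft.weight_pos _ _)
    (sSup_image_nonneg hright.weight_pos _ _)
    (fun x hx => le_sSup_image_Icc hfm ⟨by linarith [hx.1], hx.2⟩)
    (fun x hx => le_sSup_image_Icc hfp ⟨by linarith [hx.1], hx.2⟩)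

end Biharmonic

open Biharmonic in
theorem theorem1 (N : ℕ) (V : ℝ → ℂ) (D : ℕ → ℝ → ℂ) (τm τp : ℝ → ℝ) (εm εp : ℝ)
    (hV : Assumption N V D τm τp εm εp)
    (βm βp : ℝ) (hβm : 0 ≤ βm) (hβp : 0 ≤ βp)
    (hBm : limsup (fun x => ((V x).im : EReal)) atBot < ((-βm : ℝ) : EReal))
    (hBp : ((βp : ℝ) : EReal) < liminf (fun x => ((V x).im : EReal)) atTop) :
    (∃ (Ψ : ℂ → ℝ → ℂ) (α₀ C : ℝ), 0 < α₀ ∧ 0 < C ∧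
      ∀ α β : ℝ, α₀ ≤ α → β ∈ Icc (-βm) βp →
        ∀ lam : ℂ, lam = (α : ℂ) + (β : ℂ) * Complex.I →
          (¬ BoundedAtEnd atBot V → IsLeast (crossingSet (-1) V τm εm α) (deltaMinus V τm εm α)) ∧
          (¬ BoundedAtEnd atTop V → IsLeast (crossingSet 1 V τp εp α) (deltaPlus V τp εp α)) ∧
          Ψ lam ∈ domH V ∧
          HasCompactSupport (Ψ lam) ∧
          0 < normL2 (Ψ lam) ∧
          normL2 (fun x => opH V (Ψ lam) x - lam * Ψ lam x) / normL2 (Ψ lam) ≤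
            C * (α ^ (-((N : ℝ) + 1) / 4) + sigmaMinus N V τm εm α + sigmaPlus N V τp εp α)) ∧
    (BoundedAtEnd atBot V → (∃ M : ℝ, ∀ᶠ x in atBot, τm x ≤ M) →
      ∃ α₀ C : ℝ, 0 < α₀ ∧ 0 < C ∧ ∀ α : ℝ, α₀ ≤ α →
        sigmaMinus N V τm εm α ≤ C * α ^ (-((N : ℝ) + 1) / 4)) ∧
    (BoundedAtEnd atTop V → (∃ M : ℝ, ∀ᶠ x in atTop, τp x ≤ M) →
      ∃ α₀ C : ℝ, 0 < α₀ ∧ 0 < C ∧ ∀ α : ℝ, α₀ ≤ α →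
        sigmaPlus N V τp εp α ≤ C * α ^ (-((N : ℝ) + 1) / 4)) := by
  have hleft := hV.left.reflect
  refine ⟨?_, fun hb ⟨M, hM⟩ => ?_, fun hb hM => ?_⟩
  · obtain ⟨C, hC, h⟩ := hV.exists_eventually hβm hβp hBm hBp
    obtain ⟨α₁, h1⟩ := eventually_atTop.1 h
    -- To obtain a single family indexed by λ, a function is chosen for every λ; it is arbitrary
    -- outside the half-strip.
    have hex : ∀ lam : ℂ, ∃ Ψ : ℝ → ℂ, α₁ ≤ lam.re → lam.im ∈ Icc (-βm) βp →
        Ψ ∈ domH V ∧ HasCompactSupport Ψ ∧ 0 < normL2 Ψ ∧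
        normL2 (fun x => opH V Ψ x - lam * Ψ x) / normL2 Ψ ≤
          C * (lam.re ^ (-((N : ℝ) + 1) / 4) + sigmaMinus N V τm εm lam.re
            + sigmaPlus N V τp εp lam.re) := fun lam => by
      by_cases hl : α₁ ≤ lam.re ∧ lam.im ∈ Icc (-βm) βp
      · obtain ⟨Ψ, h2, h3, h4, h5⟩ := (h1 _ hl.1).2.2 _ hl.2
        rw [Complex.re_add_im] at h5
        exact ⟨Ψ, fun _ _ => ⟨h2, h3, h4, h5⟩⟩
      · exact ⟨0, fun h2 h3 => absurd ⟨h2, h3⟩ hl⟩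
    choose Ψ hΨ using hex
    refine ⟨Ψ, max α₁ 1, C, by positivity, hC, fun α β hα hβ lam hlam => ?_⟩
    have hα' : α₁ ≤ α := (le_max_left _ _).trans hα
    have hre : lam.re = α := by simp [hlam]
    have him : lam.im = β := by simp [hlam]
    have h2 := hΨ lam (by rwa [hre]) (by rwa [him])
    rw [hre] at h2
    exact ⟨(h1 α hα').1, (h1 α hα').2.1, h2⟩
  · obtain ⟨C, hC, h⟩ := exists_sSup_bound (hV.continuous.comp continuous_neg)
      hleft.continuousOn_weight hleft.weight_pos (N + 1) (boundedAtEnd_neg.2 hb)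
      ⟨M, tendsto_neg_atTop_atBot.eventually hM⟩
    refine ⟨1, C, one_pos, hC, fun α hα => ?_⟩
    rw [sigmaMinus_eq, mul_comm C]
    exact mul_le_mul_of_nonneg_left (h _) (Real.rpow_nonneg (by linarith) _)
  · obtain ⟨C, hC, h⟩ := exists_sSup_bound hV.continuous hV.right.continuousOn_weight
      hV.right.weight_pos (N + 1) hb hM
    refine ⟨1, C, one_pos, hC, fun α hα => ?_⟩
    rw [sigmaPlus, mul_comm C]
    exact mul_le_mul_of_nonneg_left (h _) (Real.rpow_nonneg (by linarith) _)
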